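/- Let $W:\mathbb R\to\mathbb R$ be continuous with $W\ge 0$, $W(z)=0$ if and only if $z=\pm1$, and $\liminf_{z\to\pm\infty}W(z)>0$. For $s\in[\frac12,1)$ and a measurable $u$ on $(0,1)$ put $$[u]_s^2=\int_0^1\!\!\int_0^1\frac{|u(x)-u(y)|^2}{|x-y|^{1+2s}}\,dx\,dy\in[0,\infty],\qquad F_\varepsilon^s(u)=\frac1\varepsilon\int_0^1W(u)\,dt+\varepsilon^{2s-1}[u]_s^2 ,$$ and for $\varepsilon\in(0,1)$ $$\lambda(\varepsilon,s)=\begin{cases}\dfrac1{|\log\varepsilon|}& s=\frac12,\\[2mm] \dfrac{1-2s}{\varepsilon^{2s-1}-1}& s\in(\frac12,1),\end{cases}\qquad \mathcal F^s_\varepsilon=\lambda(\varepsilon,s)F^s_\varepsilon .$$ For $s\in(\frac12,1)$ let $$m_s=\inf\Bigl\{\int_{\mathbb R}W(u)\,dt+\int_{\mathbb R}\!\int_{\mathbb R}\frac{|u(x)-u(y)|^2}{|x-y|^{1+2s}}\,dx\,dy\Bigr\},$$ the infimum being over measurable $u:\mathbb R\to\mathbb R$ with $u(\pm\infty)=\pm1$.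 Put $\sigma(s)=(2s-1)m_s$ for $s\in(\frac12,1)$ and $\sigma(\frac12)=8$. Let $G_s(u)=\sigma(s)\,\#S(u)$ if $u\in BV((0,1),\{-1,1\})$, where $S(u)$ is the set of jump points of $u$ in $(0,1)$, and $G_s(u)=+\infty$ for every other measurable $u$. Then: 1. $\lambda$ is jointly continuous on $(0,1)\times[\frac12,1)$. 2. Every $s_0\in[\frac12,1)$ is a regular point: for any two sequences $(s_j,\varepsilon_j)\to(s_0,0)$ and $(s_j',\varepsilon_j')\to(s_0,0)$ with $s_j,s_j'\in[\frac12,1)$ and $\varepsilon_j,\varepsilon_j'>0$, the $\Gamma$-limits of $\mathcal F^{s_j}_{\varepsilon_j}$ and of $\mathcal F^{s'_j}_{\varepsilon'_j}$ as $j\to\infty$ exist and coincide. Their common value is $G_{s_0}$. This holds for $\Gamma$-convergence with respect to convergence in measure and also with respect to the $L^2(0,1)$ distance. 3. The $\Gamma$-limits are continuous in $s$ on $[\frac12,1)$: $s\mapsto G_s(u)$ is continuous on $[\frac12,1)$ for every measurable $u$, and $G_{s_j}$ $\Gamma$-converges to $G_{s_0}$ with respect to convergence in measure whenever $s_j\to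 s_0$ in $[\frac12,1)$. 4. The rescaled surface tension satisfies $0<\sigma(s)<\infty$ for every $s\in[\frac12,1)$, and $\sigma$ is continuous on $[\frac12,1)$; in particular $(2s-1)m_s\to8$ as $s\to\frac12^+$. -/

import Mathlib

open Filter Topology MeasureTheory Set
open scoped ENNReal

noncomputable section

namespace FracPhase

/-- Double-well potential with wells at `-1` and `1`. The lower limits at infinity are taken in the
extended reals, so that they also make sense (and may be `⊤`) when `W` is unbounded. -/
structure IsDoubleWell (W : ℝ → ℝ) : Prop where
  continuous : Continuous W
  nonneg : ∀ z, 0 ≤ W z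
  zero_iff : ∀ z, W z = 0 ↔ z = 1 ∨ z = -1
  liminf_atTop : 0 < liminf (fun z => (W z : EReal)) atTop
  liminf_atBot : 0 < liminf (fun z => (W z : EReal)) atBot

/-- The squared Gagliardo seminorm of order `s` of `u` on `E`, with values in `[0,∞]`. -/
def gagliardoSq (s : ℝ) (E : Set ℝ) (u : ℝ → ℝ) : ℝ≥0∞ :=
  ∫⁻ x in E, ∫⁻ y in E, ENNReal.ofReal (|u x - u y| ^ 2 / |x - y| ^ (1 + 2 * s))

/-- The integral over `E` of the potential along `u`. -/
def potentialEnergy (W : ℝ → ℝ) (E : Set ℝ) (u : ℝ → ℝ) : ℝ≥0∞ :=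
  ∫⁻ x in E, ENNReal.ofReal (W (u x))

/-- The optimal-profile constant `m_s`. A measurable `u` competes with finite energy only if its
Gagliardo seminorm on the line is finite, i.e. `u` is locally in `H^s` with finite seminorm. -/
def surfaceTension (W : ℝ → ℝ) (s : ℝ) : ℝ≥0∞ :=
  ⨅ (u : ℝ → ℝ) (_ : Measurable u) (_ : Tendsto u atTop (𝓝 1)) (_ : Tendsto u atBot (𝓝 (-1))),
    potentialEnergy W univ u + gagliardoSq s univ u

/-- The rescaled surface tension: `(2s-1) m_s` for `s ≠ 1/2`, and `8` for `s = 1/2`. -/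
def rescaledTension (W : ℝ → ℝ) (s : ℝ) : ℝ≥0∞ :=
  if s = 1 / 2 then 8 else ENNReal.ofReal (2 * s - 1) * surfaceTension W s

/-- The scaling factor, for `ε ∈ (0,1)` and `s ∈ [1/2,1)`. -/
def scaling (ε s : ℝ) : ℝ :=
  if s = 1 / 2 then 1 / |Real.log ε| else (1 - 2 * s) / (ε ^ (2 * s - 1) - 1)

/-- Real measurable functions on `(0,1)`, up to equality almost everywhere. -/
abbrev UnitFun : Type := ℝ →ₘ[(volume : Measure ℝ).restrict (Ioo 0 1)] ℝ

/-- The scaled functional, for `ε ∈ (0,1)` and `s ∈ [1/2,1)`. It is `⊤` when the Gagliardo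
seminorm of `u` on `(0,1)` is infinite, that is, when `u` is not in `H^s(0,1)`. -/
def scaledEnergy (W : ℝ → ℝ) (ε s : ℝ) (u : UnitFun) : ℝ≥0∞ :=
  ENNReal.ofReal (scaling ε s) *
    (ENNReal.ofReal (1 / ε) * potentialEnergy W (Ioo 0 1) u
      + ENNReal.ofReal (ε ^ (2 * s - 1)) * gagliardoSq s (Ioo 0 1) u)

/-- `u ∈ BV((0,1))`: some representative has bounded variation on `(0,1)`. -/
def IsBV (u : UnitFun) : Prop :=
  ∃ v : ℝ → ℝ, BoundedVariationOn v (Ioo 0 1) ∧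
    (u : ℝ → ℝ) =ᵐ[(volume : Measure ℝ).restrict (Ioo 0 1)] v

/-- `u ∈ BV((0,1), {-1,1})`. -/
def IsBVSign (u : UnitFun) : Prop :=
  IsBV u ∧ ∀ᵐ x ∂(volume : Measure ℝ).restrict (Ioo 0 1), u x = 1 ∨ u x = -1

/-- `u` has approximate limit `z` at `t`. -/
def HasApproxLimit (u : UnitFun) (t z : ℝ) : Prop :=
  Tendsto (fun r : ℝ => (ENNReal.ofReal (2 * r))⁻¹ *
    ∫⁻ x in Ioo (t - r) (t + r), ENNReal.ofReal |u x - z|) (𝓝[>] 0) (𝓝 0)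

/-- The set `S(u)` of points of `(0,1)` at which `u` has no approximate limit; for `u` of bounded
variation these are its jump points. -/
def jumpSet (u : UnitFun) : Set ℝ :=
  {t | t ∈ Ioo (0 : ℝ) 1 ∧ ¬ ∃ z : ℝ, HasApproxLimit u t z}

open Classical in
/-- The sharp-interface functional `c #S(u)` on `BV((0,1), {-1,1})`, extended by `⊤`. -/
def sharpInterface (c : ℝ≥0∞) (u : UnitFun) : ℝ≥0∞ :=
  if IsBVSign u then c * ((jumpSet u).encard : ℝ≥0∞) else ⊤

/-- Convergence in measure on `(0,1)`. -/
def ConvMeasure (u : ℕ → UnitFun) (v : UnitFun) : Prop :=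
  TendstoInMeasure ((volume : Measure ℝ).restrict (Ioo 0 1)) (fun j => (u j : ℝ → ℝ)) atTop v

/-- Convergence in the `L²` distance on `(0,1)`. -/
def ConvL2 (u : ℕ → UnitFun) (v : UnitFun) : Prop :=
  Tendsto (fun j => eLpNorm (fun x => u j x - v x) 2 ((volume : Measure ℝ).restrict (Ioo 0 1)))
    atTop (𝓝 0)

/-- Sequential `Γ`-convergence of `F j` to `G` with respect to a notion of convergence `conv`:
the lower bound along every convergent sequence, and a recovery sequence for every point. -/
def GammaConverges {X : Type*} (conv : (ℕ → X) → X → Prop) (F : ℕ → X → ℝ≥0∞)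
    (G : X → ℝ≥0∞) : Prop :=
  (∀ (u : ℕ → X) (v : X), conv u v → G v ≤ liminf (fun j => F j (u j)) atTop) ∧
  (∀ v : X, ∃ u : ℕ → X, conv u v ∧ limsup (fun j => F j (u j)) atTop ≤ G v)

/-- `(s_j, ε_j) → (s₀, 0)` with `s_j ∈ [1/2,1)` and `ε_j > 0`. -/
def Approaches (s ε : ℕ → ℝ) (s₀ : ℝ) : Prop :=
  (∀ j, s j ∈ Ico (1 / 2 : ℝ) 1) ∧ (∀ j, 0 < ε j) ∧
    Tendsto s atTop (𝓝 s₀) ∧ Tendsto ε atTop (𝓝 0)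

/-- `s₀` is a regular point: along any two sequences `(s_j, ε_j)`, `(s'_j, ε'_j)` approaching
`(s₀, 0)` the scaled functionals have a `Γ`-limit, and the two `Γ`-limits coincide. -/
def IsRegularPoint (conv : (ℕ → UnitFun) → UnitFun → Prop) (W : ℝ → ℝ) (s₀ : ℝ) : Prop :=
  ∀ s ε s' ε' : ℕ → ℝ, Approaches s ε s₀ → Approaches s' ε' s₀ →
    ∃ G : UnitFun → ℝ≥0∞,
      GammaConverges conv (fun j => scaledEnergy W (ε j) (s j)) G ∧
      GammaConverges conv (fun j => scaledEnergy W (ε' j) (s' j)) G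

end FracPhase

end

noncomputable section

namespace FracPhase

/-! ### The fractional kernel and elementary properties of the energies -/

/-! Everything rests on a lower bound for one transition that is local and uniform as `(s,ε) →
(s₀,0)`, stated in `local_liminf`: if `u j` tends in measure to `v` on an interval where `v` takes
both values `±1` on sets of positive measure, then the scaled energy on that interval is
asymptotically at least the rescaled tension at `s₀`. The scaling factor is `1/Λ`, where `Λ = logInt
ε s` is the integral of `exp (-(2s-1)x)` over `[0, -log ε]`. This one formula covers both cases of
the definition, gives joint continuity, and shows that `Λ → ∞` whenever `(s,ε) → (1/2,0)`, with no
relation between the rates.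

For `s₀ > 1/2`, blowing up at scale `ε` removes `ε` from the energy. Cut the blown-up interval into
blocks of fixed length. A block on which the function is close to neither well costs a fixed amount
(`exists_bad_cost`), so bounded energy allows boundedly many of them, and a block near `-1` lies at
bounded distance from a block near `1`. The function can be replaced by the constants `∓1` outside
these two blocks at small cost (`exists_glue`), and box averages make the transition Lipschitz
(`profileTension_le_energy_add`). For Lipschitz transitions of bounded width, dominated convergence
allows the exponent to be changed from `s j` to `s₀`.

For `s₀ = 1/2`, only interactions between the phases at intermediate distances matter. Since bounded
energy makes the transition set of measure `O(εΛ)`, the pairs at a distance `h` much larger than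
this that lie in opposite phases have measure at least almost `h` (`zone_shift`). Their contribution
is almost `8` times the integral of `h^{-2s}` between a scale comparable to `εΛ` and a fixed scale,
where `8` is the squared jump `4` times `2` for the two orders of a pair. After scaling, this range
carries asymptotically the full weight `1` (`tendsto_captured`).

The continuity of the tension uses the same bound. Almost optimal competitors for `m_s`, blown down
to a step function, satisfy the hypotheses of `local_liminf`; this gives lower semicontinuity and,
at a fixed exponent, the equality of the tension with the infimum over Lipschitz profiles
(`rescaledProfileTension_eq`). Upper semicontinuity uses a fixed profile: an almost optimal one for
`s₀ > 1/2`, and the linear one at `1/2`, whose seminorm is at most `8/(2s-1)` plus a bounded term.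

For the `Γ`-limit, jumps are described by measure: `essJump v` is the set of points around which
both values have positive measure. The local bounds on disjoint intervals add up because the energy
is superadditive, so finite limit energy makes `essJump v` finite, and then `v` is a sign function
of bounded variation whose jump set is `essJump v` (`IsBVSign.jumpSet_eq`). Recovery sequences
replace each jump by a rescaled profile; interactions between different transitions carry the factor
`λ ε^{2s-1}`, which tends to `0`. The lower bound is proved for convergence in measure and recovery
in `L²`, which settles both topologies. The continuity of `G_s` follows from that of the tension,
together with the fact that the limit of sign functions in measure has no more jumps than they have.
-/

/-- The kernel `|h|^{-1-2s}`, with value `0` at `h = 0`. -/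
def fracKernel (s h : ℝ) : ℝ≥0∞ := ENNReal.ofReal (1 / |h| ^ (1 + 2 * s))

/-- The unscaled energy at parameter `s` on the set `E`. -/
def energy (W : ℝ → ℝ) (s : ℝ) (E : Set ℝ) (u : ℝ → ℝ) : ℝ≥0∞ :=
  potentialEnergy W E u + gagliardoSq s E u

/-- The squared increment `|a - b|²` as an extended nonnegative real. -/
def sqDist (a b : ℝ) : ℝ≥0∞ := ENNReal.ofReal (|a - b| ^ 2)

lemma sqDist_comm (a b : ℝ) : sqDist a b = sqDist b a := by
  simp only [sqDist, abs_sub_comm]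

lemma sqDist_mono {a b c d : ℝ} (h : |a - b| ≤ |c - d|) : sqDist a b ≤ sqDist c d :=
  ENNReal.ofReal_le_ofReal (pow_le_pow_left₀ (abs_nonneg _) h 2)

lemma sqDist_le {a b c : ℝ} (h : |a - b| ≤ c) : sqDist a b ≤ ENNReal.ofReal (c ^ 2) :=
  ENNReal.ofReal_le_ofReal (pow_le_pow_left₀ (abs_nonneg _) h 2)

lemma le_sqDist {a b c : ℝ} (hc : 0 ≤ c) (h : c ≤ |a - b|) : ENNReal.ofReal (c ^ 2) ≤ sqDist a b :=
  ENNReal.ofReal_le_ofReal (pow_le_pow_left₀ hc h 2)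

@[simp] lemma sqDist_self (a : ℝ) : sqDist a a = 0 := by simp [sqDist]

@[fun_prop]
lemma measurable_sqDist {α : Type*} [MeasurableSpace α] {f g : α → ℝ} (hf : Measurable f)
    (hg : Measurable g) : Measurable fun x => sqDist (f x) (g x) := by
  unfold sqDist
  exact (((_root_.continuous_abs.measurable.comp (hf.sub hg)).pow_const 2)).ennreal_ofReal

lemma fracKernel_neg (s h : ℝ) : fracKernel s (-h) = fracKernel s h := by
  simp [fracKernel]

lemma fracKernel_sub_comm (s x y : ℝ) : fracKernel s (x - y) = fracKernel s (y - x) := by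
  rw [← fracKernel_neg, neg_sub]

lemma measurable_fracKernel (s : ℝ) : Measurable (fracKernel s) := by
  unfold fracKernel
  exact (measurable_const.div ((_root_.continuous_abs.measurable).pow_const _)).ennreal_ofReal

@[fun_prop]
lemma measurable_fracKernel_comp {α : Type*} [MeasurableSpace α] (s : ℝ) {f : α → ℝ}
    (hf : Measurable f) : Measurable fun x => fracKernel s (f x) :=
  (measurable_fracKernel s).comp hf

lemma fracKernel_of_pos {s h : ℝ} (hh : 0 < h) :
    fracKernel s h = ENNReal.ofReal (h ^ (-1 - 2 * s)) := by
  rw [fracKernel, abs_of_pos hh, show (-1 - 2 * s) = -(1 + 2 * s) by ring, Real.rpow_neg hh.le,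
    one_div]

lemma fracKernel_ne_top (s h : ℝ) : fracKernel s h ≠ ⊤ := ENNReal.ofReal_ne_top

lemma gagliardoSq_eq (s : ℝ) (E : Set ℝ) (u : ℝ → ℝ) :
    gagliardoSq s E u = ∫⁻ x in E, ∫⁻ y in E, sqDist (u x) (u y) * fracKernel s (x - y) := by
  unfold gagliardoSq
  congr 1 with x
  congr 1 with y
  rw [sqDist, fracKernel, ← ENNReal.ofReal_mul (by positivity), mul_one_div]

lemma measurable_gagliardo_integrand {u : ℝ → ℝ} (hu : Measurable u) (s : ℝ) :
    Measurable fun p : ℝ × ℝ => sqDist (u p.1) (u p.2) * fracKernel s (p.1 - p.2) := by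
  have h1 : Measurable fun p : ℝ × ℝ => u p.1 := hu.comp measurable_fst
  have h2 : Measurable fun p : ℝ × ℝ => u p.2 := hu.comp measurable_snd
  exact (measurable_sqDist h1 h2).mul
    (measurable_fracKernel_comp s (measurable_fst.sub measurable_snd))

lemma gagliardoSq_mono_set {s : ℝ} {E F : Set ℝ} (h : E ⊆ F) (u : ℝ → ℝ) :
    gagliardoSq s E u ≤ gagliardoSq s F u := by
  unfold gagliardoSq
  exact (lintegral_mono_set h).trans (lintegral_mono fun x => lintegral_mono_set h)

lemma potentialEnergy_mono_set (W : ℝ → ℝ) {E F : Set ℝ} (h : E ⊆ F) (u : ℝ → ℝ) :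
    potentialEnergy W E u ≤ potentialEnergy W F u := lintegral_mono_set h

lemma energy_mono_set (W : ℝ → ℝ) (s : ℝ) {E F : Set ℝ} (h : E ⊆ F) (u : ℝ → ℝ) :
    energy W s E u ≤ energy W s F u :=
  add_le_add (potentialEnergy_mono_set W h u) (gagliardoSq_mono_set h u)

lemma gagliardoSq_mono_fun (s : ℝ) (E : Set ℝ) {u w : ℝ → ℝ}
    (h : ∀ x y, |u x - u y| ≤ |w x - w y|) : gagliardoSq s E u ≤ gagliardoSq s E w := by
  simp only [gagliardoSq_eq]
  exact lintegral_mono fun x => lintegral_mono fun y => mul_le_mul_left (sqDist_mono (h x y)) _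

lemma gagliardoSq_congr_ae {s : ℝ} {E : Set ℝ} {u w : ℝ → ℝ}
    (h : u =ᵐ[volume.restrict E] w) : gagliardoSq s E u = gagliardoSq s E w := by
  unfold gagliardoSq
  refine lintegral_congr_ae ?_
  filter_upwards [h] with x hx
  refine lintegral_congr_ae ?_
  filter_upwards [h] with y hy
  rw [hx, hy]

lemma potentialEnergy_congr_ae (W : ℝ → ℝ) {E : Set ℝ} {u w : ℝ → ℝ}
    (h : u =ᵐ[volume.restrict E] w) : potentialEnergy W E u = potentialEnergy W E w := by
  unfold potentialEnergy
  refine lintegral_congr_ae ?_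
  filter_upwards [h] with x hx
  rw [hx]

/-- Interactions between different sets are nonnegative and are dropped. This superadditivity is
what lets local lower bounds be summed. -/
lemma sum_gagliardoSq_le {ι : Type*} (S : Finset ι) (E : ι → Set ℝ) (F : Set ℝ)
    (hE : ∀ i ∈ S, MeasurableSet (E i)) (hd : (S : Set ι).PairwiseDisjoint E)
    (hF : ∀ i ∈ S, E i ⊆ F) (s : ℝ) (u : ℝ → ℝ) :
    ∑ i ∈ S, gagliardoSq s (E i) u ≤ gagliardoSq s F u := by
  unfold gagliardoSq
  calc _ ≤ ∑ i ∈ S, ∫⁻ x in E i, ∫⁻ y in F,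
        ENNReal.ofReal (|u x - u y| ^ 2 / |x - y| ^ (1 + 2 * s)) :=
        Finset.sum_le_sum fun i hi => lintegral_mono fun x => lintegral_mono_set (hF i hi)
    _ = _ := (lintegral_biUnion_finset hd hE _).symm
    _ ≤ _ := lintegral_mono_set (iUnion₂_subset hF)

lemma sum_potentialEnergy_le {ι : Type*} (W : ℝ → ℝ) (S : Finset ι) (E : ι → Set ℝ) (F : Set ℝ)
    (hE : ∀ i ∈ S, MeasurableSet (E i)) (hd : (S : Set ι).PairwiseDisjoint E)
    (hF : ∀ i ∈ S, E i ⊆ F) (u : ℝ → ℝ) :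
    ∑ i ∈ S, potentialEnergy W (E i) u ≤ potentialEnergy W F u := by
  unfold potentialEnergy
  rw [← lintegral_biUnion_finset hd hE]
  exact lintegral_mono_set (iUnion₂_subset hF)

lemma sum_energy_le {ι : Type*} (W : ℝ → ℝ) (S : Finset ι) (E : ι → Set ℝ) (F : Set ℝ)
    (hE : ∀ i ∈ S, MeasurableSet (E i)) (hd : (S : Set ι).PairwiseDisjoint E)
    (hF : ∀ i ∈ S, E i ⊆ F) (s : ℝ) (u : ℝ → ℝ) :
    ∑ i ∈ S, energy W s (E i) u ≤ energy W s F u := by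
  simp only [energy, Finset.sum_add_distrib]
  exact add_le_add (sum_potentialEnergy_le W S E F hE hd hF u) (sum_gagliardoSq_le S E F hE hd hF s u)

/-! ### Truncation -/

/-- Truncation to the interval `[-1,1]`. -/
def trunc (z : ℝ) : ℝ := max (-1) (min 1 z)

lemma continuous_trunc : Continuous trunc := by unfold trunc; fun_prop

lemma abs_trunc_le (z : ℝ) : |trunc z| ≤ 1 := by
  unfold trunc; rw [abs_le]; exact ⟨le_max_left _ _, max_le (by norm_num) (min_le_left _ _)⟩

lemma abs_trunc_sub_le (a b : ℝ) : |trunc a - trunc b| ≤ |a - b| := by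
  unfold trunc
  grind

lemma trunc_of_abs_le {z : ℝ} (h : |z| ≤ 1) : trunc z = z := by
  rw [abs_le] at h
  rw [trunc, min_eq_right h.2, max_eq_right h.1]

lemma trunc_of_one_le {z : ℝ} (h : 1 ≤ z) : trunc z = 1 := by
  rw [trunc, min_eq_left h]; norm_num

lemma trunc_of_le_neg_one {z : ℝ} (h : z ≤ -1) : trunc z = -1 := by
  rw [trunc, min_eq_right (by linarith), max_eq_left h]

lemma IsDoubleWell.one {W : ℝ → ℝ} (hW : IsDoubleWell W) : W 1 = 0 := (hW.zero_iff 1).2 (Or.inl rfl)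

lemma IsDoubleWell.neg_one {W : ℝ → ℝ} (hW : IsDoubleWell W) : W (-1) = 0 :=
  (hW.zero_iff (-1)).2 (Or.inr rfl)

lemma IsDoubleWell.trunc_le {W : ℝ → ℝ} (hW : IsDoubleWell W) (z : ℝ) : W (trunc z) ≤ W z := by
  rcases le_total 1 z with h | h
  · rw [trunc_of_one_le h, hW.one]; exact hW.nonneg z
  rcases le_total z (-1) with h' | h'
  · rw [trunc_of_le_neg_one h', hW.neg_one]; exact hW.nonneg z
  · rw [trunc_of_abs_le (abs_le.2 ⟨h', h⟩)]

/-- Truncation is `1`-Lipschitz, and the values it changes are moved to a well. Lower bounds may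
therefore assume `|u| ≤ 1`, so the behaviour of `W` at infinity does not enter them. -/
lemma energy_trunc_le {W : ℝ → ℝ} (hW : IsDoubleWell W) (s : ℝ) (E : Set ℝ) (u : ℝ → ℝ) :
    energy W s E (fun x => trunc (u x)) ≤ energy W s E u :=
  add_le_add (lintegral_mono fun _ => ENNReal.ofReal_le_ofReal (hW.trunc_le _))
    (gagliardoSq_mono_fun s E fun _ _ => abs_trunc_sub_le _ _)

lemma IsDoubleWell.measurable {W : ℝ → ℝ} (hW : IsDoubleWell W) : Measurable W :=
  hW.continuous.measurable

/-! ### Affine changes of variables -/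

lemma lintegral_affine (f : ℝ → ℝ≥0∞) (c : ℝ) {e : ℝ} (he : e ≠ 0) :
    ∫⁻ x, f x = ENNReal.ofReal |e| * ∫⁻ z, f (c + e * z) := by
  have hemb : MeasurableEmbedding (fun z : ℝ => e * z) :=
    (Homeomorph.mulLeft₀ e he).measurableEmbedding
  rw [← lintegral_add_left_eq_self (μ := volume) f c]
  conv_lhs => rw [← Real.smul_map_volume_mul_left he]
  rw [lintegral_smul_measure, hemb.lintegral_map]
  rfl

lemma setLIntegral_affine {E : Set ℝ} (hE : MeasurableSet E) (f : ℝ → ℝ≥0∞) (c : ℝ) {e : ℝ}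
    (he : e ≠ 0) :
    ∫⁻ x in E, f x = ENNReal.ofReal |e| * ∫⁻ z in (fun z => c + e * z) ⁻¹' E, f (c + e * z) := by
  have hm : Measurable fun z : ℝ => c + e * z := by fun_prop
  rw [← lintegral_indicator hE, lintegral_affine _ c he, ← lintegral_indicator (hm hE)]
  rfl

lemma fracKernel_mul (s e h : ℝ) :
    fracKernel s (e * h) = ENNReal.ofReal (1 / |e| ^ (1 + 2 * s)) * fracKernel s h := by
  unfold fracKernel
  rw [← ENNReal.ofReal_mul (by positivity), abs_mul, Real.mul_rpow (abs_nonneg _) (abs_nonneg _)]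
  congr 1
  rw [one_div_mul_one_div]

lemma potentialEnergy_affine (W : ℝ → ℝ) {E : Set ℝ} (hE : MeasurableSet E) (u : ℝ → ℝ) (c : ℝ)
    {e : ℝ} (he : e ≠ 0) :
    potentialEnergy W E u = ENNReal.ofReal |e| *
      potentialEnergy W ((fun z => c + e * z) ⁻¹' E) (fun z => u (c + e * z)) :=
  setLIntegral_affine hE _ c he

/-- Each of the two integrals contributes a factor `|e|`, and the kernel contributes `|e|^{-1-2s}`.
-/
lemma gagliardoSq_affine (s : ℝ) {E : Set ℝ} (hE : MeasurableSet E) (u : ℝ → ℝ) (c : ℝ)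
    {e : ℝ} (he : e ≠ 0) :
    gagliardoSq s E u = ENNReal.ofReal (|e| ^ (1 - 2 * s)) *
      gagliardoSq s ((fun z => c + e * z) ⁻¹' E) (fun z => u (c + e * z)) := by
  have he' : 0 < |e| := abs_pos.2 he
  rw [gagliardoSq_eq, gagliardoSq_eq, setLIntegral_affine hE _ c he]
  have : ∀ z : ℝ, ∫⁻ y in E, sqDist (u (c + e * z)) (u y) * fracKernel s (c + e * z - y)
      = ENNReal.ofReal (|e| * (1 / |e| ^ (1 + 2 * s))) *
        ∫⁻ y in (fun z => c + e * z) ⁻¹' E,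
          sqDist (u (c + e * z)) (u (c + e * y)) * fracKernel s (z - y) := by
    intro z
    rw [setLIntegral_affine hE _ c he, ENNReal.ofReal_mul he'.le, mul_assoc]
    congr 1
    rw [← lintegral_const_mul' _ _ ENNReal.ofReal_ne_top]
    refine lintegral_congr fun y => ?_
    rw [show c + e * z - (c + e * y) = e * (z - y) by ring, fracKernel_mul]
    ring
  simp_rw [this]
  rw [lintegral_const_mul' _ _ ENNReal.ofReal_ne_top, ← mul_assoc,
    ← ENNReal.ofReal_mul he'.le]
  have hpow : |e| ^ (1 - 2 * s) = |e| * (|e| * (1 / |e| ^ (1 + 2 * s))) := by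
    rw [show (1 - 2 * s) = 1 + (1 + -(1 + 2 * s)) by ring, Real.rpow_add he' 1,
      Real.rpow_add he' 1 (-(1 + 2 * s)), Real.rpow_one, Real.rpow_neg he'.le, one_div]
  rw [hpow]

/-- Used to reduce a transition from `1` to `-1` to one from `-1` to `1`. -/
lemma energy_reflect (W : ℝ → ℝ) (s : ℝ) {E : Set ℝ} (hE : MeasurableSet E) (u : ℝ → ℝ) (c : ℝ) :
    energy W s E u = energy W s ((fun z => c - z) ⁻¹' E) (fun z => u (c - z)) := by
  have h1 := potentialEnergy_affine W hE u c (e := -1) (by norm_num)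
  have h2 := gagliardoSq_affine s hE u c (e := -1) (by norm_num)
  simp only [neg_mul, one_mul, abs_neg, abs_one, ENNReal.ofReal_one, Real.one_rpow,
    ← sub_eq_add_neg] at h1 h2
  rw [energy, h1, h2, energy]

lemma energy_translate (W : ℝ → ℝ) (s : ℝ) {E : Set ℝ} (hE : MeasurableSet E) (u : ℝ → ℝ) (c : ℝ) :
    energy W s E u = energy W s ((fun z => c + z) ⁻¹' E) (fun z => u (c + z)) := by
  have h1 := potentialEnergy_affine W hE u c (e := 1) (by norm_num)
  have h2 := gagliardoSq_affine s hE u c (e := 1) (by norm_num)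
  simp only [one_mul, abs_one, ENNReal.ofReal_one, Real.one_rpow] at h1 h2
  rw [energy, h1, h2, energy]

/-- The blow-up at scale `e` turns the scaled energy into the unscaled one. -/
lemma scaled_energy_affine (W : ℝ → ℝ) (s : ℝ) {E : Set ℝ} (hE : MeasurableSet E) (u : ℝ → ℝ)
    (c : ℝ) {e : ℝ} (he : 0 < e) :
    ENNReal.ofReal (1 / e) * potentialEnergy W E u
      + ENNReal.ofReal (e ^ (2 * s - 1)) * gagliardoSq s E u
      = energy W s ((fun z => c + e * z) ⁻¹' E) (fun z => u (c + e * z)) := by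
  rw [potentialEnergy_affine W hE u c he.ne', gagliardoSq_affine s hE u c he.ne', abs_of_pos he,
    ← mul_assoc, ← mul_assoc, ← ENNReal.ofReal_mul (by positivity),
    ← ENNReal.ofReal_mul (by positivity), ← Real.rpow_add he, energy]
  rw [one_div_mul_cancel he.ne', show 2 * s - 1 + (1 - 2 * s) = 0 by ring, Real.rpow_zero]
  simp

lemma preimage_affine_Ioo (c a b : ℝ) {e : ℝ} (he : 0 < e) :
    (fun z => c + e * z) ⁻¹' Ioo a b = Ioo ((a - c) / e) ((b - c) / e) := by
  ext z
  simp only [mem_preimage, mem_Ioo, div_lt_iff₀ he, lt_div_iff₀ he]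
  constructor <;> rintro ⟨h1, h2⟩ <;> constructor <;> nlinarith

/-! ### Slicing -/

lemma lintegral_lintegral_shift {F : ℝ → ℝ → ℝ≥0∞} (hF : Measurable (Function.uncurry F)) :
    ∫⁻ x, ∫⁻ y, F x y = ∫⁻ h, ∫⁻ x, F x (x + h) := by
  have : ∀ x, ∫⁻ y, F x y = ∫⁻ h, F x (x + h) := fun x =>
    (lintegral_add_left_eq_self (μ := volume) (F x) x).symm
  simp_rw [this]
  refine lintegral_lintegral_swap (Measurable.aemeasurable ?_)
  exact hF.comp (measurable_fst.prodMk (measurable_fst.add measurable_snd))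

lemma setLIntegral_setLIntegral_eq_indicator {E : Set ℝ} (hE : MeasurableSet E)
    (F : ℝ → ℝ → ℝ≥0∞) :
    ∫⁻ x in E, ∫⁻ y in E, F x y = ∫⁻ x, ∫⁻ y, E.indicator 1 x * (E.indicator 1 y * F x y) := by
  rw [← lintegral_indicator hE]
  congr 1 with x
  by_cases hx : x ∈ E
  · simp only [indicator_of_mem hx, Pi.one_apply, one_mul]
    rw [← lintegral_indicator hE]
    congr 1 with y
    by_cases hy : y ∈ E <;> simp [hy]
  · simp [hx]

/-- Fubini in the increment `h = y - x`. The exponent enters only through the kernel in front of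
each slice, so energies at different exponents can be compared slice by slice. -/
lemma gagliardoSq_slice {u : ℝ → ℝ} (hu : Measurable u) (s : ℝ) {E : Set ℝ}
    (hE : MeasurableSet E) :
    gagliardoSq s E u = ∫⁻ h, fracKernel s h *
      ∫⁻ x, E.indicator 1 x * (E.indicator 1 (x + h) * sqDist (u x) (u (x + h))) := by
  rw [gagliardoSq_eq, setLIntegral_setLIntegral_eq_indicator hE]
  have hi : Measurable (E.indicator (1 : ℝ → ℝ≥0∞)) := measurable_one.indicator hE
  rw [lintegral_lintegral_shift]
  · congr 1 with h
    rw [← lintegral_const_mul']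
    · congr 1 with x
      rw [show x - (x + h) = -h by ring, fracKernel_neg]; ring
    · exact fracKernel_ne_top s h
  · exact (hi.comp measurable_fst).mul ((hi.comp measurable_snd).mul
      (measurable_gagliardo_integrand hu s))

lemma gagliardoSq_univ_slice {u : ℝ → ℝ} (hu : Measurable u) (s : ℝ) :
    gagliardoSq s univ u = ∫⁻ h, fracKernel s h * ∫⁻ x, sqDist (u x) (u (x + h)) := by
  rw [gagliardoSq_slice hu s MeasurableSet.univ]
  simp

/-! ### Integrals of powers -/

lemma lintegral_Ioc_rpow {a b : ℝ} (ha : 0 < a) (hab : a ≤ b) (r : ℝ) :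
    ∫⁻ h in Ioc a b, ENNReal.ofReal (h ^ r) = ENNReal.ofReal (∫ h in a..b, h ^ r) := by
  rw [intervalIntegral.integral_of_le hab, ofReal_integral_eq_lintegral_ofReal]
  · have : IntervalIntegrable (fun x : ℝ => x ^ r) volume a b :=
      intervalIntegral.intervalIntegrable_rpow (Or.inr (by
        rw [uIcc_of_le hab]; exact fun h => absurd h.1 (not_le.2 ha)))
    exact (intervalIntegrable_iff_integrableOn_Ioc_of_le hab).1 this
  · filter_upwards [self_mem_ae_restrict measurableSet_Ioc] with x hx
    exact Real.rpow_nonneg (ha.le.trans hx.1.le) _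

lemma lintegral_Ioc_zero_one_rpow {r : ℝ} (hr : -1 < r) :
    ∫⁻ h in Ioc (0 : ℝ) 1, ENNReal.ofReal (h ^ r) = ENNReal.ofReal (1 / (r + 1)) := by
  have h1 : IntervalIntegrable (fun x : ℝ => x ^ r) volume 0 1 :=
    intervalIntegral.intervalIntegrable_rpow' hr
  rw [← ofReal_integral_eq_lintegral_ofReal
    ((intervalIntegrable_iff_integrableOn_Ioc_of_le zero_le_one).1 h1),
    ← intervalIntegral.integral_of_le zero_le_one, integral_rpow (Or.inl hr)]
  · rw [Real.one_rpow, Real.zero_rpow (by linarith), sub_zero]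
  · filter_upwards [self_mem_ae_restrict measurableSet_Ioc] with x hx
    exact Real.rpow_nonneg hx.1.le _

lemma lintegral_Ioi_rpow {a : ℝ} (ha : 0 < a) {r : ℝ} (hr : r < -1) :
    ∫⁻ h in Ioi a, ENNReal.ofReal (h ^ r) = ENNReal.ofReal (-a ^ (r + 1) / (r + 1)) := by
  rw [← ofReal_integral_eq_lintegral_ofReal (integrableOn_Ioi_rpow_of_lt hr ha),
    integral_Ioi_rpow_of_lt hr ha]
  filter_upwards [self_mem_ae_restrict measurableSet_Ioi] with x hx
  exact Real.rpow_nonneg (ha.le.trans (le_of_lt hx)) _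

lemma lintegral_eq_of_even {f : ℝ → ℝ≥0∞} (hf : ∀ h, f (-h) = f h) :
    ∫⁻ h, f h = 2 * ∫⁻ h in Ioi (0 : ℝ), f h := by
  have h1 : ∫⁻ h in Iio (0 : ℝ), f h = ∫⁻ h in Ioi (0 : ℝ), f h := by
    have := setLIntegral_affine (E := Iio (0 : ℝ)) measurableSet_Iio f 0 (e := -1) (by norm_num)
    simp only [abs_neg, abs_one, ENNReal.ofReal_one, zero_add, neg_mul, one_mul, hf] at this
    rw [this]
    congr 2
    ext z; simp
  have h2 : ∫⁻ h, f h = (∫⁻ h in Iio (0 : ℝ), f h) + ∫⁻ h in Ici (0 : ℝ), f h := by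
    rw [← lintegral_add_compl f (measurableSet_Iio (a := (0 : ℝ))), compl_Iio]
  rw [h2, h1, ← restrict_Ioi_eq_restrict_Ici, two_mul]

/-! ### Step-like Lipschitz functions -/

/-- The function `f` is constant on `(-∞,-R]` and on `[R,∞)`, and its increments are at most
`D min(1,|x-y|)`. -/
structure IsStep (f : ℝ → ℝ) (R D : ℝ) : Prop where
  R_pos : 0 < R
  D_nonneg : 0 ≤ D
  left : ∀ x ≤ -R, f x = f (-R)
  right : ∀ x, R ≤ x → f x = f R
  incr : ∀ x y, |f x - f y| ≤ D * min 1 |x - y|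

lemma IsStep.continuous {f : ℝ → ℝ} {R D : ℝ} (h : IsStep f R D) : Continuous f := by
  have : LipschitzWith ⟨D, h.D_nonneg⟩ f := LipschitzWith.of_dist_le_mul fun x y => by
    rw [Real.dist_eq, Real.dist_eq]
    exact (h.incr x y).trans (mul_le_mul_of_nonneg_left (min_le_right _ _) h.D_nonneg)
  exact this.continuous

/-- The weight `min(1,h²)(2R+|h|)` that bounds the squared increments of step-like functions. -/
def stepWeight (R h : ℝ) : ℝ≥0∞ := ENNReal.ofReal (min 1 (h ^ 2) * (2 * R + |h|))

lemma measurable_stepWeight (R : ℝ) : Measurable (stepWeight R) := by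
  unfold stepWeight
  exact Measurable.ennreal_ofReal (Continuous.measurable (by fun_prop))

/-- The points `x` and `x + h` lie on the same constant tail unless `x` belongs to an interval of
length `2R + |h|`, and there the increment is at most `D min(1,|h|)`. -/
lemma IsStep.lintegral_sqDist_le {f : ℝ → ℝ} {R D : ℝ} (hf : IsStep f R D) (h : ℝ) :
    ∫⁻ x, sqDist (f x) (f (x + h)) ≤ ENNReal.ofReal (D ^ 2) * stepWeight R h := by
  obtain ⟨a, b, hab, hlen⟩ : ∃ a b : ℝ, (∀ x, x ∉ Icc a b → f x = f (x + h)) ∧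
      b - a = 2 * R + |h| := by
    rcases le_total 0 h with h0 | h0
    · refine ⟨-R - h, R, fun x hx => ?_, by rw [abs_of_nonneg h0]; ring⟩
      rw [mem_Icc, not_and_or, not_le, not_le] at hx
      rcases hx with hx | hx
      · rw [hf.left x (by linarith), hf.left (x + h) (by linarith)]
      · rw [hf.right x (by linarith), hf.right (x + h) (by linarith)]
    · refine ⟨-R, R - h, fun x hx => ?_, by rw [abs_of_nonpos h0]; ring⟩
      rw [mem_Icc, not_and_or, not_le, not_le] at hx
      rcases hx with hx | hx
      · rw [hf.left x (by linarith), hf.left (x + h) (by linarith)]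
      · rw [hf.right x (by linarith), hf.right (x + h) (by linarith)]
  have hpt : ∀ x, sqDist (f x) (f (x + h)) ≤
      (Icc a b).indicator (fun _ => ENNReal.ofReal (D ^ 2 * min 1 (h ^ 2))) x := by
    intro x
    by_cases hx : x ∈ Icc a b
    · rw [indicator_of_mem hx]
      have h1 := hf.incr x (x + h)
      rw [show x - (x + h) = -h by ring, abs_neg] at h1
      refine (sqDist_le h1).trans (ENNReal.ofReal_le_ofReal ?_)
      rw [mul_pow]
      refine mul_le_mul_of_nonneg_left ?_ (sq_nonneg D)
      have h3 : 0 ≤ min 1 |h| := le_min zero_le_one (abs_nonneg h)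
      refine le_min ?_ ?_
      · exact pow_le_one₀ h3 (min_le_left _ _)
      · rw [← sq_abs h]
        exact pow_le_pow_left₀ h3 (min_le_right _ _) 2
    · rw [indicator_of_notMem hx, hab x hx, sqDist_self]
  refine (lintegral_mono hpt).trans ?_
  rw [lintegral_indicator measurableSet_Icc, setLIntegral_const, Real.volume_Icc, hlen, stepWeight,
    ← ENNReal.ofReal_mul (by positivity), ← ENNReal.ofReal_mul (by positivity), mul_assoc]

/-- Near `0` the integrand behaves like `h^{1-2s}`, integrable since `s < 1`; at infinity it behaves
like `h^{-2s}`, integrable since `s > 1/2`. -/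
lemma lintegral_stepWeight_mul_fracKernel_lt_top {s : ℝ} (hs : s ∈ Ioo (1 / 2 : ℝ) 1) {R : ℝ}
    (hR : 0 ≤ R) : ∫⁻ h, stepWeight R h * fracKernel s h < ⊤ := by
  rw [lintegral_eq_of_even]
  swap
  · intro h; rw [fracKernel_neg]; simp [stepWeight]
  refine ENNReal.mul_lt_top (by simp) ?_
  rw [← Ioc_union_Ioi_eq_Ioi (zero_le_one (α := ℝ)),
    lintegral_union measurableSet_Ioi (Ioc_disjoint_Ioi le_rfl)]
  refine ENNReal.add_lt_top.2 ⟨?_, ?_⟩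
  · calc _ ≤ ∫⁻ h in Ioc (0 : ℝ) 1, ENNReal.ofReal (2 * R + 1) * ENNReal.ofReal (h ^ (1 - 2 * s)) := by
          refine setLIntegral_mono' measurableSet_Ioc fun h hh => ?_
          rw [fracKernel_of_pos hh.1, stepWeight, abs_of_pos hh.1,
            ← ENNReal.ofReal_mul (by have := hh.1; positivity), ← ENNReal.ofReal_mul (by positivity)]
          refine ENNReal.ofReal_le_ofReal ?_
          have h1 : h ^ (1 - 2 * s) = h ^ 2 * h ^ (-1 - 2 * s) := by
            rw [← Real.rpow_natCast h 2, ← Real.rpow_add hh.1]; congr 1; push_cast; ring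
          rw [h1, ← mul_assoc]
          refine mul_le_mul_of_nonneg_right ?_ (Real.rpow_nonneg hh.1.le _)
          rw [mul_comm]
          exact mul_le_mul (by linarith [hh.2]) (min_le_right _ _)
            (le_min zero_le_one (sq_nonneg _)) (by positivity)
      _ < ⊤ := by
          rw [lintegral_const_mul' _ _ ENNReal.ofReal_ne_top,
            lintegral_Ioc_zero_one_rpow (by linarith [hs.2])]
          exact ENNReal.mul_lt_top ENNReal.ofReal_lt_top ENNReal.ofReal_lt_top
  · calc _ ≤ ∫⁻ h in Ioi (1 : ℝ), ENNReal.ofReal (2 * R + 1) * ENNReal.ofReal (h ^ (-2 * s)) := by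
          refine setLIntegral_mono' measurableSet_Ioi fun h hh => ?_
          have hh0 : (0 : ℝ) < h := zero_lt_one.trans hh
          have hh1 : (1 : ℝ) ≤ h := le_of_lt hh
          rw [fracKernel_of_pos hh0, stepWeight, abs_of_pos hh0,
            ← ENNReal.ofReal_mul (by positivity), ← ENNReal.ofReal_mul (by positivity)]
          refine ENNReal.ofReal_le_ofReal ?_
          have h1 : h ^ (-2 * s) = h * h ^ (-1 - 2 * s) := by
            rw [← Real.rpow_one_add' hh0.le (by linarith [hs.1])]; congr 1; ring
          rw [h1, ← mul_assoc]
          refine mul_le_mul_of_nonneg_right ?_ (Real.rpow_nonneg hh0.le _)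
          calc min 1 (h ^ 2) * (2 * R + h) ≤ 1 * (2 * R + h) :=
                mul_le_mul_of_nonneg_right (min_le_left _ _) (by positivity)
            _ ≤ (2 * R + 1) * h := by nlinarith
      _ < ⊤ := by
          rw [lintegral_const_mul' _ _ ENNReal.ofReal_ne_top,
            lintegral_Ioi_rpow one_pos (by linarith [hs.1])]
          exact ENNReal.mul_lt_top ENNReal.ofReal_lt_top ENNReal.ofReal_lt_top

/-- The larger exponent dominates for `|h| ≤ 1` and the smaller one for `|h| ≥ 1`. The sum is a
majorant uniform in `s ∈ [s₁,s₂]`. -/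
lemma fracKernel_le_add {s s₁ s₂ : ℝ} (hs : 0 ≤ s) (h₁ : s₁ ≤ s) (h₂ : s ≤ s₂) (h : ℝ) :
    fracKernel s h ≤ fracKernel s₁ h + fracKernel s₂ h := by
  rcases eq_or_ne h 0 with rfl | hh
  · simp [fracKernel, Real.zero_rpow (show 1 + 2 * s ≠ 0 by positivity)]
  have hp : 0 < |h| := abs_pos.2 hh
  unfold fracKernel
  rcases le_total |h| 1 with h1 | h1
  · refine le_add_left (ENNReal.ofReal_le_ofReal ?_)
    exact one_div_le_one_div_of_le (Real.rpow_pos_of_pos hp _)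
      (Real.rpow_le_rpow_of_exponent_ge hp h1 (by linarith))
  · refine le_add_right (ENNReal.ofReal_le_ofReal ?_)
    exact one_div_le_one_div_of_le (Real.rpow_pos_of_pos hp _)
      (Real.rpow_le_rpow_of_exponent_le h1 (by linarith))

lemma tendsto_fracKernel {s₀ : ℝ} (hs₀ : 0 < s₀) (h : ℝ) :
    Tendsto (fun s => fracKernel s h) (𝓝 s₀) (𝓝 (fracKernel s₀ h)) := by
  unfold fracKernel
  refine ENNReal.tendsto_ofReal ?_
  rcases eq_or_ne h 0 with rfl | hh
  · refine tendsto_const_nhds.congr' ?_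
    filter_upwards [eventually_gt_nhds hs₀] with s hs
    rw [abs_zero, Real.zero_rpow (by positivity), Real.zero_rpow (by positivity)]
  have hp : 0 < |h| := abs_pos.2 hh
  refine ContinuousAt.tendsto (f := fun s : ℝ => 1 / |h| ^ (1 + 2 * s)) ?_
  refine ContinuousAt.div continuousAt_const ?_ (Real.rpow_pos_of_pos hp _).ne'
  exact ContinuousAt.rpow continuousAt_const (by fun_prop) (Or.inl hp.ne')

/-- The subtraction is truncated at `0`, so the kernel at `s₀` alone dominates. This direction
controls the energy at `s₀` by the energy at `s`. -/
lemma tendsto_kernel_defect {s₀ : ℝ} (hs₀ : s₀ ∈ Ioo (1 / 2 : ℝ) 1) {R : ℝ} (hR : 0 ≤ R) :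
    Tendsto (fun s => ∫⁻ h, stepWeight R h * (fracKernel s₀ h - fracKernel s h)) (𝓝 s₀) (𝓝 0) := by
  have : (0 : ℝ≥0∞) = ∫⁻ _ : ℝ, 0 := by simp
  rw [this]
  refine tendsto_lintegral_filter_of_dominated_convergence
    (fun h => stepWeight R h * fracKernel s₀ h) ?_ ?_
    (lintegral_stepWeight_mul_fracKernel_lt_top hs₀ hR).ne ?_
  · exact Eventually.of_forall fun s => (measurable_stepWeight R).mul
      ((measurable_fracKernel s₀).sub (measurable_fracKernel s))
  · exact Eventually.of_forall fun s => Eventually.of_forall fun h => by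
      gcongr; exact tsub_le_self
  · refine Eventually.of_forall fun h => ?_
    have h1 := ENNReal.Tendsto.sub (tendsto_const_nhds (x := fracKernel s₀ h))
      (tendsto_fracKernel (s₀ := s₀) (by linarith [hs₀.1]) h) (Or.inl (fracKernel_ne_top s₀ h))
    rw [tsub_self] at h1
    have h2 := ENNReal.Tendsto.const_mul (a := stepWeight R h) h1 (Or.inr ENNReal.ofReal_ne_top)
    rwa [mul_zero] at h2

/-- Here the majorant must be uniform in `s`, hence the two bracketing exponents `s₁` and `s₂`. This
direction controls the energy at `s` by the energy at `s₀`. -/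
lemma tendsto_kernel_excess {s₀ : ℝ} (hs₀ : s₀ ∈ Ioo (1 / 2 : ℝ) 1) {R : ℝ} (hR : 0 ≤ R) :
    Tendsto (fun s => ∫⁻ h, stepWeight R h * (fracKernel s h - fracKernel s₀ h)) (𝓝 s₀) (𝓝 0) := by
  have : (0 : ℝ≥0∞) = ∫⁻ _ : ℝ, 0 := by simp
  rw [this]
  obtain ⟨s₁, h₁, h₁'⟩ := exists_between hs₀.1
  obtain ⟨s₂, h₂, h₂'⟩ := exists_between hs₀.2
  refine tendsto_lintegral_filter_of_dominated_convergence
    (fun h => stepWeight R h * fracKernel s₁ h + stepWeight R h * fracKernel s₂ h) ?_ ?_ ?_ ?_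
  · exact Eventually.of_forall fun s => (measurable_stepWeight R).mul
      ((measurable_fracKernel s).sub (measurable_fracKernel s₀))
  · filter_upwards [Ioo_mem_nhds h₁' h₂] with s hs
    refine Eventually.of_forall fun h => ?_
    rw [← mul_add]
    gcongr
    exact tsub_le_self.trans (fracKernel_le_add (by linarith [hs.1]) hs.1.le hs.2.le h)
  · rw [lintegral_add_left (by exact (measurable_stepWeight R).mul (measurable_fracKernel s₁))]
    exact (ENNReal.add_lt_top.2
      ⟨lintegral_stepWeight_mul_fracKernel_lt_top ⟨h₁, h₁'.trans hs₀.2⟩ hR,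
        lintegral_stepWeight_mul_fracKernel_lt_top ⟨hs₀.1.trans h₂, h₂'⟩ hR⟩).ne
  · refine Eventually.of_forall fun h => ?_
    have h1 := ENNReal.Tendsto.sub (tendsto_fracKernel (s₀ := s₀) (by linarith [hs₀.1]) h)
      (tendsto_const_nhds (x := fracKernel s₀ h)) (Or.inl (fracKernel_ne_top s₀ h))
    rw [tsub_self] at h1
    have h2 := ENNReal.Tendsto.const_mul (a := stepWeight R h) h1 (Or.inr ENNReal.ofReal_ne_top)
    rwa [mul_zero] at h2

lemma IsStep.gagliardoSq_le {f : ℝ → ℝ} {R D : ℝ} (hf : IsStep f R D) (s s' : ℝ) :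
    gagliardoSq s' univ f ≤ gagliardoSq s univ f +
      ENNReal.ofReal (D ^ 2) * ∫⁻ h, stepWeight R h * (fracKernel s' h - fracKernel s h) := by
  have hm := hf.continuous.measurable
  have hm2 : Measurable fun h => ∫⁻ x, sqDist (f x) (f (x + h)) := by
    refine Measurable.lintegral_prod_right' (f := fun p : ℝ × ℝ => sqDist (f p.2) (f (p.2 + p.1))) ?_
    exact measurable_sqDist (hm.comp measurable_snd) (hm.comp (measurable_snd.add measurable_fst))
  rw [gagliardoSq_univ_slice hm, gagliardoSq_univ_slice hm,
    ← lintegral_const_mul' _ _ ENNReal.ofReal_ne_top,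
    ← lintegral_add_left (by exact (measurable_fracKernel s).mul hm2)]
  refine lintegral_mono fun h => ?_
  calc fracKernel s' h * ∫⁻ x, sqDist (f x) (f (x + h))
      ≤ (fracKernel s h + (fracKernel s' h - fracKernel s h)) * ∫⁻ x, sqDist (f x) (f (x + h)) := by
        gcongr; exact le_add_tsub
    _ ≤ _ := by
        rw [add_mul, ← mul_assoc, mul_comm (fracKernel s' h - fracKernel s h)]
        gcongr
        exact hf.lintegral_sqDist_le h

lemma IsStep.gagliardoSq_lt_top {f : ℝ → ℝ} {R D : ℝ} (hf : IsStep f R D) {s : ℝ}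
    (hs : s ∈ Ioo (1 / 2 : ℝ) 1) : gagliardoSq s univ f < ⊤ := by
  rw [gagliardoSq_univ_slice hf.continuous.measurable]
  calc _ ≤ ∫⁻ h, ENNReal.ofReal (D ^ 2) * (stepWeight R h * fracKernel s h) := by
        refine lintegral_mono fun h => ?_
        rw [mul_comm, ← mul_assoc]
        gcongr
        exact hf.lintegral_sqDist_le h
    _ < ⊤ := by
        rw [lintegral_const_mul' _ _ ENNReal.ofReal_ne_top]
        exact ENNReal.mul_lt_top ENNReal.ofReal_lt_top
          (lintegral_stepWeight_mul_fracKernel_lt_top hs hf.R_pos.le)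

/-! ### Lipschitz transition profiles -/

/-- A Lipschitz transition from `-1` to `1` that is constant outside `(-R,R)`. -/
structure IsProfile (u : ℝ → ℝ) (R D : ℝ) : Prop where
  step : IsStep u R D
  left : ∀ x ≤ -R, u x = -1
  right : ∀ x, R ≤ x → u x = 1
  bound : ∀ x, |u x| ≤ 1

/-- The infimum of the energy over Lipschitz profiles with compact transition. -/
def profileTension (W : ℝ → ℝ) (s : ℝ) : ℝ≥0∞ :=
  ⨅ (u : ℝ → ℝ) (R : ℝ) (D : ℝ) (_ : IsProfile u R D), energy W s univ u

lemma isProfile_trunc : IsProfile trunc 1 2 := by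
  refine ⟨⟨one_pos, zero_le_two, fun x hx => ?_, fun x hx => ?_, fun x y => ?_⟩,
    fun x hx => trunc_of_le_neg_one hx, fun x hx => trunc_of_one_le hx, abs_trunc_le⟩
  · rw [trunc_of_le_neg_one hx, trunc_of_le_neg_one le_rfl]
  · rw [trunc_of_one_le hx, trunc_of_one_le le_rfl]
  · rw [mul_min_of_nonneg _ _ zero_le_two]
    refine le_min ?_ ?_
    · have := abs_sub (trunc x) (trunc y)
      linarith [abs_trunc_le x, abs_trunc_le y]
    · linarith [abs_trunc_sub_le x y, abs_nonneg (x - y)]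

lemma IsDoubleWell.potentialEnergy_lt_top {W : ℝ → ℝ} (hW : IsDoubleWell W) {u : ℝ → ℝ} {a b : ℝ}
    (hl : ∀ x ≤ a, u x = -1) (hr : ∀ x, b ≤ x → u x = 1) (hb : ∀ x, |u x| ≤ 1) :
    potentialEnergy W univ u < ⊤ := by
  obtain ⟨C, hC⟩ := (isCompact_Icc (a := (-1 : ℝ)) (b := 1)).exists_bound_of_continuousOn
    hW.continuous.continuousOn
  have : ∀ x, ENNReal.ofReal (W (u x)) ≤ (Icc a b).indicator (fun _ => ENNReal.ofReal C) x := by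
    intro x
    by_cases hx : x ∈ Icc a b
    · rw [indicator_of_mem hx]
      exact ENNReal.ofReal_le_ofReal ((le_abs_self _).trans (hC _ (abs_le.1 (hb x))))
    · rw [indicator_of_notMem hx]
      rw [mem_Icc, not_and_or, not_le, not_le] at hx
      rcases hx with hx | hx
      · rw [hl x hx.le, hW.neg_one]; simp
      · rw [hr x hx.le, hW.one]; simp
  rw [potentialEnergy, setLIntegral_univ]
  refine (lintegral_mono this).trans_lt ?_
  rw [lintegral_indicator measurableSet_Icc, setLIntegral_const, Real.volume_Icc]
  exact ENNReal.mul_lt_top ENNReal.ofReal_lt_top ENNReal.ofReal_lt_top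

lemma IsProfile.energy_lt_top {W : ℝ → ℝ} (hW : IsDoubleWell W) {u : ℝ → ℝ} {R D : ℝ}
    (hu : IsProfile u R D) {s : ℝ} (hs : s ∈ Ioo (1 / 2 : ℝ) 1) : energy W s univ u < ⊤ :=
  ENNReal.add_lt_top.2 ⟨hW.potentialEnergy_lt_top hu.left hu.right hu.bound,
    hu.step.gagliardoSq_lt_top hs⟩

lemma profileTension_le {W : ℝ → ℝ} {s : ℝ} {u : ℝ → ℝ} {R D : ℝ} (hu : IsProfile u R D) :
    profileTension W s ≤ energy W s univ u :=
  iInf_le_of_le u (iInf_le_of_le R (iInf_le_of_le D (iInf_le_of_le hu le_rfl)))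

lemma profileTension_lt_top {W : ℝ → ℝ} (hW : IsDoubleWell W) {s : ℝ}
    (hs : s ∈ Ioo (1 / 2 : ℝ) 1) : profileTension W s < ⊤ :=
  (profileTension_le isProfile_trunc).trans_lt (isProfile_trunc.energy_lt_top hW hs)

lemma surfaceTension_le_energy {W : ℝ → ℝ} {s : ℝ} {u : ℝ → ℝ} {R D : ℝ} (hu : IsProfile u R D) :
    surfaceTension W s ≤ energy W s univ u := by
  refine iInf_le_of_le u (iInf_le_of_le hu.step.continuous.measurable (iInf_le_of_le ?_
    (iInf_le_of_le ?_ le_rfl)))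
  · exact tendsto_const_nhds.congr' ((eventually_ge_atTop R).mono fun x hx => (hu.right x hx).symm)
  · exact tendsto_const_nhds.congr' ((eventually_le_atBot (-R)).mono fun x hx => (hu.left x hx).symm)

lemma surfaceTension_le_profileTension (W : ℝ → ℝ) (s : ℝ) :
    surfaceTension W s ≤ profileTension W s :=
  le_iInf fun _ => le_iInf fun _ => le_iInf fun _ => le_iInf fun hu => surfaceTension_le_energy hu

/-! ### Regularization by box averages -/

lemma intervalIntegrable_of_bounded {g : ℝ → ℝ} (hg : Measurable g) {C : ℝ}
    (hC : ∀ x, |g x| ≤ C) (a b : ℝ) : IntervalIntegrable g volume a b :=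
  (intervalIntegrable_const (c := C)).mono_fun hg.aestronglyMeasurable
    (Eventually.of_forall fun x => by
      simpa using (hC x).trans (le_abs_self C))

/-- Jensen's inequality for the square, obtained by expanding the nonnegative variance of `g`. -/
lemma ofReal_sq_average_le {g : ℝ → ℝ} (hg : Measurable g) {C : ℝ} (hC : ∀ x, |g x| ≤ C) {r : ℝ}
    (hr : 0 < r) :
    ENNReal.ofReal (|(1 / r) * ∫ t in (0 : ℝ)..r, g t| ^ 2) ≤
      ENNReal.ofReal (1 / r) * ∫⁻ t in Ioc 0 r, ENNReal.ofReal (|g t| ^ 2) := by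
  have hi := intervalIntegrable_of_bounded hg hC 0 r
  have hi2 : IntervalIntegrable (fun t => g t ^ 2) volume 0 r :=
    intervalIntegrable_of_bounded (hg.pow_const 2) (C := C ^ 2)
      (fun x => by rw [abs_pow]; exact pow_le_pow_left₀ (abs_nonneg _) (hC x) 2) 0 r
  set m := (1 / r) * ∫ t in (0 : ℝ)..r, g t with hm
  have hint : ∫ t in (0 : ℝ)..r, g t = r * m := by rw [hm]; field_simp
  have h0 : 0 ≤ ∫ t in (0 : ℝ)..r, (g t - m) ^ 2 :=
    intervalIntegral.integral_nonneg hr.le fun _ _ => sq_nonneg _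
  have h1 : ∫ t in (0 : ℝ)..r, (g t - m) ^ 2 = (∫ t in (0 : ℝ)..r, g t ^ 2) - r * m ^ 2 := by
    have : ∀ t, (g t - m) ^ 2 = g t ^ 2 - (2 * m) * g t + m ^ 2 := fun t => by ring
    simp_rw [this]
    rw [intervalIntegral.integral_add (hi2.sub (hi.const_mul _)) intervalIntegrable_const,
      intervalIntegral.integral_sub hi2 (hi.const_mul _), intervalIntegral.integral_const_mul, hint,
      intervalIntegral.integral_const]
    simp only [sub_zero, smul_eq_mul]; ring
  have h2 : ∫⁻ t in Ioc 0 r, ENNReal.ofReal (|g t| ^ 2) =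
      ENNReal.ofReal (∫ t in (0 : ℝ)..r, g t ^ 2) := by
    rw [intervalIntegral.integral_of_le hr.le, ofReal_integral_eq_lintegral_ofReal
      ((intervalIntegrable_iff_integrableOn_Ioc_of_le hr.le).1 hi2)
      (Eventually.of_forall fun _ => sq_nonneg _)]
    simp only [sq_abs]
  rw [h2, ← ENNReal.ofReal_mul (by positivity), sq_abs]
  refine ENNReal.ofReal_le_ofReal ?_
  rw [one_div, ← div_eq_inv_mul, le_div_iff₀ hr]
  linarith

/-- The average of `V` over the interval `[x, x+r]`. -/
def boxAverage (V : ℝ → ℝ) (r x : ℝ) : ℝ := (1 / r) * ∫ t in (0 : ℝ)..r, V (x + t)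

lemma boxAverage_sub {V : ℝ → ℝ} (hV : Measurable V) (hb : ∀ x, |V x| ≤ 1) (r : ℝ) (x : ℝ) (f : ℝ → ℝ) (hf : Measurable f) {C : ℝ} (hC : ∀ t, |f t| ≤ C) :
    boxAverage V r x - (1 / r) * ∫ t in (0 : ℝ)..r, f t
      = (1 / r) * ∫ t in (0 : ℝ)..r, (V (x + t) - f t) := by
  have h1 : IntervalIntegrable (fun t => V (x + t)) volume 0 r :=
    intervalIntegrable_of_bounded (hV.comp (measurable_const_add x)) (fun t => hb _) 0 r
  rw [boxAverage, ← mul_sub, intervalIntegral.integral_sub h1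
    (intervalIntegrable_of_bounded hf hC 0 r)]

lemma sqDist_boxAverage_le {V : ℝ → ℝ} (hV : Measurable V) (hb : ∀ x, |V x| ≤ 1)
    {r : ℝ} (hr : 0 < r) (x y : ℝ) : sqDist (boxAverage V r x) (boxAverage V r y) ≤
    ENNReal.ofReal (1 / r) * ∫⁻ t in Ioc 0 r, sqDist (V (x + t)) (V (y + t)) := by
  have h1 : Measurable fun t => V (x + t) := hV.comp (measurable_const_add x)
  have h2 : Measurable fun t => V (y + t) := hV.comp (measurable_const_add y)
  have := boxAverage_sub hV hb r x (fun t => V (y + t)) h2 (fun t => hb _)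
  change boxAverage V r x - boxAverage V r y = _ at this
  rw [sqDist, this]
  refine ofReal_sq_average_le (h1.sub h2) (C := 2) (fun t => ?_) hr
  have := abs_sub (V (x + t)) (V (y + t))
  simp only [Pi.sub_apply]
  linarith [hb (x + t), hb (y + t)]

lemma sqDist_boxAverage_self_le {V : ℝ → ℝ} (hV : Measurable V) (hb : ∀ x, |V x| ≤ 1)
    {r : ℝ} (hr : 0 < r) (x : ℝ) : sqDist (boxAverage V r x) (V x) ≤
    ENNReal.ofReal (1 / r) * ∫⁻ t in Ioc 0 r, sqDist (V x) (V (x + t)) := by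
  have h1 : Measurable fun t => V (x + t) := hV.comp (measurable_const_add x)
  have h3 := boxAverage_sub hV hb r x (fun _ => V x) measurable_const (fun t => hb x)
  rw [intervalIntegral.integral_const, sub_zero, smul_eq_mul, ← mul_assoc,
    one_div_mul_cancel hr.ne', one_mul] at h3
  rw [sqDist, h3]
  simp_rw [sqDist_comm (V x)]
  refine ofReal_sq_average_le (h1.sub measurable_const) (C := 2) (fun t => ?_) hr
  have := abs_sub (V (x + t)) (V x)
  simp only [Pi.sub_apply]
  linarith [hb (x + t), hb x]

/-- Jensen bounds the increment of the average by the average of the increments, and by translation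
invariance every translate has the same integral. Averaging thus decreases every slice of the
seminorm, whatever the exponent. -/
lemma lintegral_sqDist_boxAverage_le {V : ℝ → ℝ} (hV : Measurable V) (hb : ∀ x, |V x| ≤ 1)
    {r : ℝ} (hr : 0 < r) (h : ℝ) :
    ∫⁻ x, sqDist (boxAverage V r x) (boxAverage V r (x + h)) ≤ ∫⁻ x, sqDist (V x) (V (x + h)) := by
  calc _ ≤ ∫⁻ x, ENNReal.ofReal (1 / r) *
          ∫⁻ t in Ioc 0 r, sqDist (V (x + t)) (V (x + h + t)) :=
        lintegral_mono fun x => sqDist_boxAverage_le hV hb hr x (x + h)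
    _ = ENNReal.ofReal (1 / r) *
          ∫⁻ t in Ioc 0 r, ∫⁻ x, sqDist (V (x + t)) (V (x + h + t)) := by
        rw [lintegral_const_mul' _ _ ENNReal.ofReal_ne_top]
        congr 1
        refine lintegral_lintegral_swap (Measurable.aemeasurable ?_)
        exact measurable_sqDist (hV.comp (measurable_fst.add measurable_snd))
          (hV.comp ((measurable_fst.add_const h).add measurable_snd))
    _ = ENNReal.ofReal (1 / r) * ∫⁻ _ in Ioc 0 r, ∫⁻ x, sqDist (V x) (V (x + h)) := by
        congr 1
        refine lintegral_congr fun t => ?_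
        rw [← lintegral_add_right_eq_self (fun x => sqDist (V x) (V (x + h))) t]
        refine lintegral_congr fun x => ?_
        rw [add_right_comm]
    _ = _ := by
        rw [setLIntegral_const, Real.volume_Ioc, sub_zero, mul_comm, mul_assoc,
          ← ENNReal.ofReal_mul hr.le, mul_one_div_cancel hr.ne', ENNReal.ofReal_one, mul_one]

lemma continuous_boxAverage {V : ℝ → ℝ} (hV : Measurable V) (hb : ∀ x, |V x| ≤ 1) (r : ℝ) : Continuous (boxAverage V r) := by
  have h : ∀ x, boxAverage V r x = (1 / r) * ∫ t in x..(x + r), V t := fun x => by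
    rw [boxAverage, intervalIntegral.integral_comp_add_left (f := V), add_zero]
  have h2 : ∀ x, boxAverage V r x =
      (1 / r) * ((∫ t in (0 : ℝ)..(x + r), V t) - ∫ t in (0 : ℝ)..x, V t) := fun x => by
    rw [h, intervalIntegral.integral_interval_sub_left]
    · exact intervalIntegrable_of_bounded hV hb _ _
    · exact intervalIntegrable_of_bounded hV hb _ _
  have h3 : Continuous fun x => ∫ t in (0 : ℝ)..x, V t :=
    intervalIntegral.continuous_primitive (fun a b => intervalIntegrable_of_bounded hV hb a b) 0
  rw [show boxAverage V r = _ from funext h2]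
  exact continuous_const.mul ((h3.comp (continuous_add_const r)).sub h3)

lemma gagliardoSq_boxAverage_le {V : ℝ → ℝ} (hV : Measurable V) (hb : ∀ x, |V x| ≤ 1)
    {r : ℝ} (hr : 0 < r) (s : ℝ) :
    gagliardoSq s univ (boxAverage V r) ≤ gagliardoSq s univ V := by
  rw [gagliardoSq_univ_slice hV,
    gagliardoSq_univ_slice (continuous_boxAverage hV hb r).measurable]
  exact lintegral_mono fun h => mul_le_mul_right (lintegral_sqDist_boxAverage_le hV hb hr h) _

/-- For `0 < t ≤ r ≤ 1` and `s ≥ 1/2` one has `1 ≤ r² t^{-1-2s}`, so the increments at distances up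
to `r` are paid for by the seminorm. The gain `r` makes the effect of averaging on the potential
small. -/
lemma lintegral_sqDist_boxAverage_self_le {V : ℝ → ℝ} (hV : Measurable V) (hb : ∀ x, |V x| ≤ 1)
    {r : ℝ} (hr : 0 < r) (hr1 : r ≤ 1) {s : ℝ} (hs : 1 / 2 ≤ s) :
    ∫⁻ x, sqDist (boxAverage V r x) (V x) ≤ ENNReal.ofReal r * gagliardoSq s univ V := by
  calc _ ≤ ∫⁻ x, ENNReal.ofReal (1 / r) * ∫⁻ t in Ioc 0 r, sqDist (V x) (V (x + t)) :=
        lintegral_mono fun x => sqDist_boxAverage_self_le hV hb hr x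
    _ = ENNReal.ofReal (1 / r) * ∫⁻ t in Ioc 0 r, ∫⁻ x, sqDist (V x) (V (x + t)) := by
        rw [lintegral_const_mul' _ _ ENNReal.ofReal_ne_top]
        congr 1
        refine lintegral_lintegral_swap (Measurable.aemeasurable ?_)
        exact measurable_sqDist (hV.comp measurable_fst)
          (hV.comp (measurable_fst.add measurable_snd))
    _ ≤ ENNReal.ofReal (1 / r) * ∫⁻ t in Ioc 0 r, ENNReal.ofReal (r ^ 2) *
          (fracKernel s t * ∫⁻ x, sqDist (V x) (V (x + t))) := by
        refine mul_le_mul_right (setLIntegral_mono' measurableSet_Ioc fun t ht => ?_) _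
        rw [← mul_assoc]
        refine le_mul_of_one_le_left' ?_
        rw [fracKernel_of_pos ht.1, ← ENNReal.ofReal_mul (by positivity), ← ENNReal.ofReal_one]
        refine ENNReal.ofReal_le_ofReal ?_
        calc (1 : ℝ) = r ^ 2 * r ^ (-2 : ℝ) := by
              rw [Real.rpow_neg hr.le, Real.rpow_two, mul_inv_cancel₀ (by positivity)]
          _ ≤ r ^ 2 * t ^ (-2 : ℝ) := by
              gcongr r ^ 2 * ?_
              exact Real.rpow_le_rpow_of_nonpos ht.1 ht.2 (by norm_num)
          _ ≤ _ := by
              gcongr r ^ 2 * ?_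
              exact Real.rpow_le_rpow_of_exponent_ge ht.1 (ht.2.trans hr1) (by linarith)
    _ ≤ ENNReal.ofReal (1 / r) * (ENNReal.ofReal (r ^ 2) * gagliardoSq s univ V) := by
        rw [lintegral_const_mul' _ _ ENNReal.ofReal_ne_top, gagliardoSq_univ_slice hV]
        exact mul_le_mul_right (mul_le_mul_right (setLIntegral_le_lintegral _ _) _) _
    _ = _ := by
        rw [← mul_assoc, ← ENNReal.ofReal_mul (by positivity)]
        congr 2
        field_simp

lemma isProfile_boxAverage {V : ℝ → ℝ} (hV : Measurable V) (hb : ∀ x, |V x| ≤ 1)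
    {r : ℝ} (hr : 0 < r) (hr1 : r ≤ 1) {M : ℝ} (hM : 0 < M) (hl : ∀ x ≤ 0, V x = -1)
    (hright : ∀ x, M ≤ x → V x = 1) : IsProfile (boxAverage V r) (M + 1) (2 / r) := by
  have hL : ∀ x ≤ -(M + 1), boxAverage V r x = -1 := fun x hx => by
    have : ∫ t in (0 : ℝ)..r, V (x + t) = ∫ t in (0 : ℝ)..r, (-1 : ℝ) :=
      intervalIntegral.integral_congr fun t ht => by
        rw [uIcc_of_le hr.le] at ht
        exact hl _ (by linarith [ht.2])
    rw [boxAverage, this, intervalIntegral.integral_const]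
    simp only [sub_zero, smul_eq_mul]; field_simp
  have hR : ∀ x, M + 1 ≤ x → boxAverage V r x = 1 := fun x hx => by
    have : ∫ t in (0 : ℝ)..r, V (x + t) = ∫ t in (0 : ℝ)..r, (1 : ℝ) :=
      intervalIntegral.integral_congr fun t ht => by
        rw [uIcc_of_le hr.le] at ht
        exact hright _ (by linarith [ht.1])
    rw [boxAverage, this, intervalIntegral.integral_const]
    simp only [sub_zero, smul_eq_mul]; field_simp
  have hB : ∀ x, |boxAverage V r x| ≤ 1 := fun x => by
    rw [boxAverage, abs_mul, abs_of_pos (by positivity : 0 < 1 / r), one_div_mul_eq_div,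
      div_le_one hr]
    have := intervalIntegral.norm_integral_le_of_norm_le_const (a := 0) (b := r) (C := 1)
      (f := fun t => V (x + t)) (fun t _ => hb _)
    simpa [abs_of_pos hr] using this
  have hbd : ∀ a b : ℝ, |∫ t in a..b, V t| ≤ |b - a| := fun a b => by
    simpa using intervalIntegral.norm_integral_le_of_norm_le_const (a := a) (b := b) (C := 1)
      (f := V) (fun t _ => hb _)
  have hD : ∀ x y, |boxAverage V r x - boxAverage V r y| ≤ 2 / r * min 1 |x - y| := fun x y => by
    rw [mul_min_of_nonneg _ _ (by positivity)]
    refine le_min ?_ ?_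
    · have := abs_sub (boxAverage V r x) (boxAverage V r y)
      have h2 : 2 ≤ 2 / r * 1 := by rw [mul_one, le_div_iff₀ hr]; linarith
      linarith [hB x, hB y]
    -- The two averaging windows cancel except for two intervals of length `|x - y|`, on which `|V|
    -- ≤ 1`; this gives the Lipschitz constant `2/r`.
    · have hII := fun a b => intervalIntegrable_of_bounded hV hb a b
      have e : boxAverage V r x - boxAverage V r y =
          (1 / r) * ((∫ t in (y + r)..(x + r), V t) - ∫ t in y..x, V t) := by
        rw [boxAverage, boxAverage, intervalIntegral.integral_comp_add_left (f := V),
          intervalIntegral.integral_comp_add_left (f := V), add_zero, add_zero, ← mul_sub,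
          intervalIntegral.integral_interval_sub_interval_comm (hII _ _) (hII _ _) (hII _ _)]
        congr 1
        rw [intervalIntegral.integral_symm x y, intervalIntegral.integral_symm (x + r) (y + r)]
        ring
      rw [e, abs_mul, abs_of_pos (by positivity : 0 < 1 / r), one_div_mul_eq_div,
        div_mul_eq_mul_div, div_le_div_iff_of_pos_right hr]
      have h1 := hbd (y + r) (x + r)
      have h2 := hbd y x
      rw [show x + r - (y + r) = x - y by ring] at h1
      have := abs_sub (∫ t in (y + r)..(x + r), V t) (∫ t in y..x, V t)
      linarith
  refine ⟨⟨by positivity, by positivity, fun x hx => ?_, fun x hx => ?_, hD⟩, hL, hR, hB⟩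
  · rw [hL x hx, hL _ le_rfl]
  · rw [hR x hx, hR _ le_rfl]

/-- Close points are handled by uniform continuity. Where `|a - b|` is not small, the quadratic term
already exceeds the maximum of `W` on `[-1,1]`. This turns `L²` bounds into bounds of the potential.
-/
lemma IsDoubleWell.le_add_sq {W : ℝ → ℝ} (hW : IsDoubleWell W) {d : ℝ} (hd : 0 < d) :
    ∃ C : ℝ, 0 ≤ C ∧ ∀ a b : ℝ, |a| ≤ 1 → |b| ≤ 1 → W a ≤ W b + d + C * |a - b| ^ 2 := by
  have hK := isCompact_Icc (a := (-1 : ℝ)) (b := 1)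
  obtain ⟨B, hB⟩ := hK.exists_bound_of_continuousOn hW.continuous.continuousOn
  obtain ⟨e, he, h⟩ := Metric.uniformContinuousOn_iff.1
    (hK.uniformContinuousOn_of_continuous hW.continuous.continuousOn) d hd
  refine ⟨|B| / e ^ 2, by positivity, fun a b ha hb => ?_⟩
  have hB' := (le_abs_self _).trans ((hB a (abs_le.1 ha)).trans (le_abs_self B))
  rcases lt_or_ge |a - b| e with h1 | h1
  · have := h a (abs_le.1 ha) b (abs_le.1 hb) (by rwa [Real.dist_eq])
    rw [Real.dist_eq, abs_lt] at this
    have : 0 ≤ |B| / e ^ 2 * |a - b| ^ 2 := by positivity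
    linarith
  · have h2 : |B| ≤ |B| / e ^ 2 * |a - b| ^ 2 := by
      rw [div_mul_eq_mul_div, le_div_iff₀ (by positivity)]
      exact mul_le_mul_of_nonneg_left (pow_le_pow_left₀ he.le h1 2) (abs_nonneg _)
    linarith [hW.nonneg b]

/-- A transition confined to an interval of fixed length can be made Lipschitz, at all exponents
close to `s₀`, with a small loss of energy. -/
lemma profileTension_le_energy_add {W : ℝ → ℝ} (hW : IsDoubleWell W) {s₀ : ℝ}
    (hs₀ : s₀ ∈ Ioo (1 / 2 : ℝ) 1) {M : ℝ} (hM : 0 < M) {K : ℝ≥0∞} (hK : K ≠ ⊤) {d : ℝ≥0∞}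
    (hd : d ≠ 0) :
    ∀ᶠ s in 𝓝 s₀, ∀ V : ℝ → ℝ, Measurable V → (∀ x, |V x| ≤ 1) → (∀ x ≤ 0, V x = -1) →
      (∀ x, M ≤ x → V x = 1) → energy W s univ V ≤ K →
      profileTension W s₀ ≤ energy W s univ V + d := by
  wlog hdt : d ≠ ⊤ generalizing d
  · exact Eventually.of_forall fun s V _ _ _ _ _ => by
      rw [not_ne_iff.1 hdt, add_top]; exact le_top
  obtain ⟨d', hd', rfl⟩ : ∃ d' : ℝ, 0 < d' ∧ d = ENNReal.ofReal d' :=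
    ⟨d.toReal, ENNReal.toReal_pos hd hdt, (ENNReal.ofReal_toReal hdt).symm⟩
  -- The loss is split into three thirds: the continuity error of `W` on `[-1,M]`, of length `M +
  -- 1`; the quadratic error, at most `C r K`; and the change of exponent in the kernel.
  obtain ⟨C, hC0, hC⟩ := hW.le_add_sq (d := d' / 3 / (M + 1)) (by positivity)
  obtain ⟨r, hr, hr1, hrC⟩ : ∃ r : ℝ, 0 < r ∧ r ≤ 1 ∧ C * (r * K.toReal) ≤ d' / 3 := by
    have h3 : 0 ≤ C * K.toReal := mul_nonneg hC0 ENNReal.toReal_nonneg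
    refine ⟨min 1 (d' / 3 / (C * K.toReal + 1)), by positivity, min_le_left _ _, ?_⟩
    calc C * (min 1 (d' / 3 / (C * K.toReal + 1)) * K.toReal)
        = C * K.toReal * min 1 (d' / 3 / (C * K.toReal + 1)) := by ring
      _ ≤ C * K.toReal * (d' / 3 / (C * K.toReal + 1)) := by gcongr; exact min_le_right _ _
      _ ≤ d' / 3 := by
        rw [mul_div_assoc', div_le_iff₀ (by positivity)]; nlinarith
  have hdef := tendsto_kernel_defect hs₀ (R := M + 1) (by positivity)
  have hdef2 := ENNReal.Tendsto.const_mul (a := ENNReal.ofReal ((2 / r) ^ 2)) hdef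
    (Or.inr ENNReal.ofReal_ne_top)
  rw [mul_zero] at hdef2
  filter_upwards [hdef2.eventually (eventually_le_nhds
    (show (0 : ℝ≥0∞) < ENNReal.ofReal (d' / 3) by simpa using by positivity)),
    eventually_gt_nhds hs₀.1] with s hs hs2 V hV hb hl hright hE
  have hprof := isProfile_boxAverage hV hb hr hr1 hM hl hright
  have hgK : gagliardoSq s univ V ≤ K := le_trans le_add_self hE
  have hgag : gagliardoSq s₀ univ (boxAverage V r) ≤
      gagliardoSq s univ V + ENNReal.ofReal (d' / 3) :=
    (hprof.step.gagliardoSq_le s s₀).trans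
      (add_le_add (gagliardoSq_boxAverage_le hV hb hr s) hs)
  have hpot : potentialEnergy W univ (boxAverage V r) ≤
      potentialEnergy W univ V + ENNReal.ofReal (d' / 3) + ENNReal.ofReal (d' / 3) := by
    have hpt : ∀ x, ENNReal.ofReal (W (boxAverage V r x)) ≤ ENNReal.ofReal (W (V x)) +
        (Icc (-1) M).indicator (fun _ => ENNReal.ofReal (d' / 3 / (M + 1))) x +
        ENNReal.ofReal C * sqDist (boxAverage V r x) (V x) := by
      intro x
      by_cases hx : x ∈ Icc (-1) M
      · rw [indicator_of_mem hx, sqDist, ← ENNReal.ofReal_mul hC0,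
          ← ENNReal.ofReal_add (hW.nonneg _) (by positivity),
          ← ENNReal.ofReal_add (add_nonneg (hW.nonneg _) (by positivity)) (by positivity)]
        exact ENNReal.ofReal_le_ofReal (hC _ _ (hprof.bound x) (hb x))
      · have : W (boxAverage V r x) = 0 := by
          rw [mem_Icc, not_and_or, not_le, not_le] at hx
          rcases hx with hx | hx
          · have e : ∫ t in (0 : ℝ)..r, V (x + t) = ∫ t in (0 : ℝ)..r, (-1 : ℝ) :=
              intervalIntegral.integral_congr fun t ht => by
                rw [uIcc_of_le hr.le] at ht
                exact hl _ (by linarith [ht.2])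
            rw [boxAverage, e, intervalIntegral.integral_const, sub_zero, smul_eq_mul, ← mul_assoc,
              one_div_mul_cancel hr.ne', one_mul, hW.neg_one]
          · have e : ∫ t in (0 : ℝ)..r, V (x + t) = ∫ t in (0 : ℝ)..r, (1 : ℝ) :=
              intervalIntegral.integral_congr fun t ht => by
                rw [uIcc_of_le hr.le] at ht
                exact hright _ (by linarith [ht.1])
            rw [boxAverage, e, intervalIntegral.integral_const, sub_zero, smul_eq_mul, ← mul_assoc,
              one_div_mul_cancel hr.ne', one_mul, hW.one]
        rw [this]; simp
    unfold potentialEnergy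
    simp only [setLIntegral_univ]
    refine (lintegral_mono hpt).trans ?_
    have hmW : Measurable fun x => ENNReal.ofReal (W (V x)) :=
      (hW.measurable.comp hV).ennreal_ofReal
    rw [lintegral_add_left (by exact hmW.add (measurable_const.indicator measurableSet_Icc)),
      lintegral_add_left hmW, lintegral_indicator measurableSet_Icc, setLIntegral_const,
      Real.volume_Icc, lintegral_const_mul' _ _ ENNReal.ofReal_ne_top,
      ← ENNReal.ofReal_mul (by positivity)]
    gcongr
    · apply le_of_eq; field_simp; ring
    · calc _ ≤ ENNReal.ofReal C * (ENNReal.ofReal r * K) := by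
            gcongr
            exact (lintegral_sqDist_boxAverage_self_le hV hb hr hr1 hs2.le).trans (by gcongr)
        _ ≤ _ := by
            rw [← ENNReal.ofReal_toReal hK, ← ENNReal.ofReal_mul hr.le, ← ENNReal.ofReal_mul hC0]
            exact ENNReal.ofReal_le_ofReal hrC
  refine (profileTension_le hprof).trans ?_
  calc energy W s₀ univ (boxAverage V r)
      ≤ (potentialEnergy W univ V + ENNReal.ofReal (d' / 3) + ENNReal.ofReal (d' / 3)) +
        (gagliardoSq s univ V + ENNReal.ofReal (d' / 3)) := add_le_add hpot hgag
    _ = energy W s univ V +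
        (ENNReal.ofReal (d' / 3) + ENNReal.ofReal (d' / 3) + ENNReal.ofReal (d' / 3)) := by
        rw [energy]; ring
    _ = _ := by
        rw [← ENNReal.ofReal_add (by positivity) (by positivity),
          ← ENNReal.ofReal_add (by positivity) (by positivity)]
        congr 2; ring

/-! ### Gluing with the constants `-1` and `1` -/

/-- The cutoff equal to `0` on `(-∞,0]`, to `1` on `[1,∞)`, and linear in between. -/
def ramp (x : ℝ) : ℝ := max 0 (min 1 x)

lemma ramp_of_nonpos {x : ℝ} (h : x ≤ 0) : ramp x = 0 := by unfold ramp; grind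
lemma ramp_of_one_le {x : ℝ} (h : 1 ≤ x) : ramp x = 1 := by unfold ramp; grind
lemma ramp_nonneg (x : ℝ) : 0 ≤ ramp x := le_max_left _ _
lemma ramp_le_one (x : ℝ) : ramp x ≤ 1 := max_le zero_le_one (min_le_left _ _)

lemma isStep_ramp : IsStep ramp 1 1 := by
  refine ⟨one_pos, zero_le_one, fun x hx => ?_, fun x hx => ?_, fun x y => ?_⟩
  · rw [ramp_of_nonpos (by linarith), ramp_of_nonpos (by norm_num)]
  · rw [ramp_of_one_le hx, ramp_of_one_le le_rfl]
  · rw [one_mul]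
    refine le_min ?_ ?_
    · rw [abs_le]
      constructor <;> linarith [ramp_nonneg x, ramp_nonneg y, ramp_le_one x, ramp_le_one y]
    · unfold ramp; grind

lemma measurable_ramp : Measurable ramp := isStep_ramp.continuous.measurable

/-- The density of the Gagliardo energy of the cutoff, for two exponents together. -/
def rampEnergy (s₁ s₂ x : ℝ) : ℝ≥0∞ :=
  ∫⁻ y, sqDist (ramp x) (ramp y) * (fracKernel s₁ (x - y) + fracKernel s₂ (x - y))

lemma lintegral_rampEnergy (s₁ s₂ : ℝ) :
    ∫⁻ x, rampEnergy s₁ s₂ x = gagliardoSq s₁ univ ramp + gagliardoSq s₂ univ ramp := by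
  have h1 := measurable_gagliardo_integrand measurable_ramp s₁
  have h2 : Measurable fun x =>
      ∫⁻ y, sqDist (ramp x) (ramp y) * fracKernel s₁ (x - y) := h1.lintegral_prod_right'
  have h3 : ∀ x, Measurable fun y => sqDist (ramp x) (ramp y) * fracKernel s₁ (x - y) := fun x =>
    (measurable_sqDist measurable_const measurable_ramp).mul
      (measurable_fracKernel_comp s₁ (measurable_id.const_sub x))
  rw [gagliardoSq_eq, gagliardoSq_eq]
  simp only [Measure.restrict_univ]
  rw [← lintegral_add_left h2]
  refine lintegral_congr fun x => ?_
  rw [← lintegral_add_left (h3 x)]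
  refine lintegral_congr fun y => ?_
  rw [mul_add]

lemma measurable_rampEnergy (s₁ s₂ : ℝ) : Measurable (rampEnergy s₁ s₂) := by
  have : Measurable fun p : ℝ × ℝ => sqDist (ramp p.1) (ramp p.2) *
      (fracKernel s₁ (p.1 - p.2) + fracKernel s₂ (p.1 - p.2)) := by
    simp only [mul_add]
    exact (measurable_gagliardo_integrand measurable_ramp s₁).add
      (measurable_gagliardo_integrand measurable_ramp s₂)
  exact this.lintegral_prod_right'

/-- After the change of variable `y = x + h`, the increment is bounded by `min(1,|h|)` independently
of `x`, so the integrable weight of step functions gives a uniform bound. -/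
lemma exists_rampEnergy_le {s₁ s₂ : ℝ} (h₁ : s₁ ∈ Ioo (1 / 2 : ℝ) 1) (h₂ : s₂ ∈ Ioo (1 / 2 : ℝ) 1) :
    ∃ c : ℝ, 0 ≤ c ∧ ∀ x, rampEnergy s₁ s₂ x ≤ ENNReal.ofReal c := by
  have hfin : ∫⁻ h, (stepWeight 1 h * fracKernel s₁ h + stepWeight 1 h * fracKernel s₂ h) ≠ ⊤ := by
    rw [lintegral_add_left (by exact (measurable_stepWeight 1).mul (measurable_fracKernel s₁))]
    exact (ENNReal.add_lt_top.2
      ⟨lintegral_stepWeight_mul_fracKernel_lt_top h₁ zero_le_one,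
        lintegral_stepWeight_mul_fracKernel_lt_top h₂ zero_le_one⟩).ne
  refine ⟨(∫⁻ h, (stepWeight 1 h * fracKernel s₁ h + stepWeight 1 h * fracKernel s₂ h)).toReal,
    ENNReal.toReal_nonneg, fun x => ?_⟩
  rw [ENNReal.ofReal_toReal hfin, rampEnergy,
    ← lintegral_add_left_eq_self (μ := volume) _ x]
  refine lintegral_mono fun h => ?_
  rw [← mul_add, show x - (x + h) = -h by ring, fracKernel_neg, fracKernel_neg]
  gcongr
  have h1 := isStep_ramp.incr x (x + h)
  rw [show x - (x + h) = -h by ring, abs_neg, one_mul] at h1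
  refine (sqDist_le h1).trans (ENNReal.ofReal_le_ofReal ?_)
  have h2 : (min 1 |h|) ^ 2 ≤ min 1 (h ^ 2) := by
    have h3 : 0 ≤ min 1 |h| := le_min zero_le_one (abs_nonneg h)
    refine le_min (pow_le_one₀ h3 (min_le_left _ _)) ?_
    rw [← sq_abs h]
    exact pow_le_pow_left₀ h3 (min_le_right _ _) 2
  have h4 : 0 ≤ min 1 (h ^ 2) := le_min zero_le_one (sq_nonneg h)
  nlinarith [abs_nonneg h, mul_nonneg h4 (abs_nonneg h)]

/-- The total energy of the cutoff is finite, so the measure with this density is continuous along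
the complements of growing intervals, which decrease to the empty set. -/
lemma exists_tail_rampEnergy_le {s₁ s₂ : ℝ} (h₁ : s₁ ∈ Ioo (1 / 2 : ℝ) 1)
    (h₂ : s₂ ∈ Ioo (1 / 2 : ℝ) 1) {d : ℝ≥0∞} (hd : d ≠ 0) :
    ∃ L : ℝ, 1 ≤ L ∧ ∫⁻ x in (Ioo (-L) L)ᶜ, rampEnergy s₁ s₂ x ≤ d := by
  have hfin : ∫⁻ x, rampEnergy s₁ s₂ x ≠ ⊤ := by
    rw [lintegral_rampEnergy]
    exact (ENNReal.add_lt_top.2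
      ⟨isStep_ramp.gagliardoSq_lt_top h₁, isStep_ramp.gagliardoSq_lt_top h₂⟩).ne
  have hm : ∀ n : ℕ, MeasurableSet (Ioo (-(n : ℝ)) n)ᶜ := fun n => measurableSet_Ioo.compl
  have hanti : Antitone fun n : ℕ => (Ioo (-(n : ℝ)) n)ᶜ := fun m n hmn => by
    have : (m : ℝ) ≤ n := by exact_mod_cast hmn
    exact compl_subset_compl.2 (Ioo_subset_Ioo (by linarith) this)
  have hlim := tendsto_measure_iInter_atTop (μ := volume.withDensity (rampEnergy s₁ s₂))
    (fun n => (hm n).nullMeasurableSet) hanti ⟨0, by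
      refine ne_top_of_le_ne_top ?_ (measure_mono (subset_univ _))
      rwa [withDensity_apply _ MeasurableSet.univ, setLIntegral_univ]⟩
  have hempty : ⋂ n : ℕ, (Ioo (-(n : ℝ)) n)ᶜ = ∅ := by
    refine eq_empty_iff_forall_notMem.2 fun x hx => ?_
    obtain ⟨n, hn⟩ := exists_nat_gt |x|
    exact mem_iInter.1 hx n (abs_lt.1 hn)
  rw [hempty, measure_empty] at hlim
  obtain ⟨n, hn, hn1⟩ := ((hlim.eventually (eventually_le_nhds (pos_iff_ne_zero.2 hd))).and
    (eventually_ge_atTop 1)).exists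
  refine ⟨n, by exact_mod_cast hn1, ?_⟩
  rwa [Function.comp_apply, withDensity_apply _ (hm n)] at hn

lemma lintegral_ramp_sub_le {s s₁ s₂ : ℝ} (hs : 0 ≤ s) (h₁ : s₁ ≤ s) (h₂ : s ≤ s₂) (c x : ℝ) :
    ∫⁻ y, sqDist (ramp (x - c)) (ramp (y - c)) * fracKernel s (x - y) ≤
      rampEnergy s₁ s₂ (x - c) := by
  rw [rampEnergy, ← lintegral_sub_right_eq_self (μ := volume)
    (fun y => sqDist (ramp (x - c)) (ramp y) * (fracKernel s₁ (x - c - y) +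
      fracKernel s₂ (x - c - y))) c]
  refine lintegral_mono fun y => ?_
  rw [sub_sub_sub_cancel_right]
  exact mul_le_mul_right (fracKernel_le_add hs h₁ h₂ _) _

lemma lintegral_ramp_reflect_le {s s₁ s₂ : ℝ} (hs : 0 ≤ s) (h₁ : s₁ ≤ s) (h₂ : s ≤ s₂) (c x : ℝ) :
    ∫⁻ y, sqDist (ramp (c - x)) (ramp (c - y)) * fracKernel s (x - y) ≤
      rampEnergy s₁ s₂ (c - x) := by
  rw [rampEnergy, ← lintegral_sub_left_eq_self (μ := volume)
    (fun y => sqDist (ramp (c - x)) (ramp y) * (fracKernel s₁ (c - x - y) +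
      fracKernel s₂ (c - x - y))) c]
  refine lintegral_mono fun y => ?_
  rw [sub_sub_sub_cancel_left, fracKernel_sub_comm s₁ y x, fracKernel_sub_comm s₂ y x]
  exact mul_le_mul_right (fracKernel_le_add hs h₁ h₂ _) _

/-- The function equal to `U` on `[a+1,b-1]`, to `-1` on `(-∞,a]` and to `1` on `[b,∞)`. -/
def glue (U : ℝ → ℝ) (a b x : ℝ) : ℝ :=
  ramp (x - a) * (U x + 1) + ramp (b - x) * (U x - 1) - U x

lemma measurable_glue {U : ℝ → ℝ} (hU : Measurable U) (a b : ℝ) : Measurable (glue U a b) := by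
  have h1 : Measurable fun x => ramp (x - a) := measurable_ramp.comp (measurable_id.sub_const a)
  have h2 : Measurable fun x => ramp (b - x) := measurable_ramp.comp (measurable_id.const_sub b)
  exact ((h1.mul (hU.add_const 1)).add (h2.mul (hU.sub_const 1))).sub hU

lemma glue_of_le {U : ℝ → ℝ} {a b x : ℝ} (hab : a + 1 ≤ b) (h : x ≤ a) : glue U a b x = -1 := by
  rw [glue, ramp_of_nonpos (by linarith), ramp_of_one_le (by linarith)]; ring

lemma glue_of_ge {U : ℝ → ℝ} {a b x : ℝ} (hab : a + 1 ≤ b) (h : b ≤ x) : glue U a b x = 1 := by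
  rw [glue, ramp_of_nonpos (x := b - x) (by linarith), ramp_of_one_le (by linarith)]; ring

lemma glue_of_mem {U : ℝ → ℝ} {a b x : ℝ} (h1 : a + 1 ≤ x) (h2 : x ≤ b - 1) :
    glue U a b x = U x := by
  rw [glue, ramp_of_one_le (by linarith), ramp_of_one_le (by linarith)]; ring

lemma ramp_or {a b : ℝ} (hab : a + 2 ≤ b) (x : ℝ) : ramp (x - a) = 1 ∨ ramp (b - x) = 1 := by
  rcases le_total (a + 1) x with h | h
  · exact Or.inl (ramp_of_one_le (by linarith))
  · exact Or.inr (ramp_of_one_le (by linarith))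

lemma abs_glue_le {U : ℝ → ℝ} (hU : ∀ x, |U x| ≤ 1) {a b : ℝ} (hab : a + 2 ≤ b) (x : ℝ) :
    |glue U a b x| ≤ 1 := by
  obtain ⟨h1, h2⟩ := abs_le.1 (hU x)
  have h3 := ramp_nonneg (x - a)
  have h4 := ramp_nonneg (b - x)
  have h5 := ramp_le_one (x - a)
  have h6 := ramp_le_one (b - x)
  rw [glue, abs_le]
  rcases ramp_or hab x with h | h <;> rw [h] <;> constructor <;> nlinarith

/-- In the product expansion the increment of `U` has coefficient `ramp (y - a) + ramp (b - y) - 1`.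
It lies in `[0,1]` because `a + 2 ≤ b` forces one of the two ramps to equal `1`. -/
lemma abs_glue_sub_le {U : ℝ → ℝ} {a b : ℝ} (hab : a + 2 ≤ b) (x y : ℝ) :
    |glue U a b x - glue U a b y| ≤ |U x - U y| + |ramp (x - a) - ramp (y - a)| * |U x - (-1)| +
      |ramp (b - x) - ramp (b - y)| * |U x - 1| := by
  have e : glue U a b x - glue U a b y = (ramp (y - a) + ramp (b - y) - 1) * (U x - U y) +
      (ramp (x - a) - ramp (y - a)) * (U x - (-1)) + (ramp (b - x) - ramp (b - y)) * (U x - 1) := by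
    unfold glue; ring
  have h3 := ramp_nonneg (y - a)
  have h4 := ramp_nonneg (b - y)
  have h5 := ramp_le_one (y - a)
  have h6 := ramp_le_one (b - y)
  have h0 : |ramp (y - a) + ramp (b - y) - 1| ≤ 1 := by
    rw [abs_le]
    rcases ramp_or hab y with h | h <;> rw [h] <;> constructor <;> linarith
  rw [e]
  refine (abs_add_three _ _ _).trans ?_
  rw [abs_mul, abs_mul, abs_mul]
  gcongr
  exact mul_le_of_le_one_left (abs_nonneg _) h0

/-- Young's inequality with weight `d` keeps the coefficient of the energy of `U` at `1 + d`. The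
large constant falls on terms where an increment of a cutoff multiplies the distance of `U x` to a
well, and these are small after integration. -/
lemma sqDist_glue_le {U : ℝ → ℝ} {a b : ℝ} (hab : a + 2 ≤ b) {d : ℝ} (hd : 0 < d) (x y : ℝ) :
    sqDist (glue U a b x) (glue U a b y) ≤ ENNReal.ofReal (1 + d) * sqDist (U x) (U y) +
      ENNReal.ofReal (2 * (1 + 1 / d)) *
        (sqDist (U x) (-1) * sqDist (ramp (x - a)) (ramp (y - a)) +
          sqDist (U x) 1 * sqDist (ramp (b - x)) (ramp (b - y))) := by
  unfold sqDist
  rw [← ENNReal.ofReal_mul (by positivity), ← ENNReal.ofReal_mul (by positivity),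
    ← ENNReal.ofReal_mul (by positivity), ← ENNReal.ofReal_add (by positivity) (by positivity),
    ← ENNReal.ofReal_mul (by positivity), ← ENNReal.ofReal_add (by positivity) (by positivity)]
  refine ENNReal.ofReal_le_ofReal ?_
  refine (pow_le_pow_left₀ (abs_nonneg _) (abs_glue_sub_le hab x y) 2).trans ?_
  set p := |U x - U y|
  set q := |ramp (x - a) - ramp (y - a)| * |U x - (-1)| with hq
  set r := |ramp (b - x) - ramp (b - y)| * |U x - 1| with hr
  have e1 : |U x - (-1)| ^ 2 * |ramp (x - a) - ramp (y - a)| ^ 2 = q ^ 2 := by rw [hq]; ring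
  have e2 : |U x - 1| ^ 2 * |ramp (b - x) - ramp (b - y)| ^ 2 = r ^ 2 := by rw [hr]; ring
  rw [e1, e2]
  have h1 : 2 * p * (q + r) ≤ d * p ^ 2 + 1 / d * (q + r) ^ 2 := by
    have : 0 ≤ (d * p - (q + r)) ^ 2 / d := by positivity
    have e : (d * p - (q + r)) ^ 2 / d = d * p ^ 2 - 2 * p * (q + r) + 1 / d * (q + r) ^ 2 := by
      field_simp; ring
    linarith
  have h2 : (1 + 1 / d) * (q + r) ^ 2 ≤ (1 + 1 / d) * (2 * (q ^ 2 + r ^ 2)) := by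
    gcongr; nlinarith [sq_nonneg (q - r)]
  nlinarith

/-- A pair outside `J × J` has at least one point in `Jᶜ`; by symmetry of the integrand, doubling
the integral over `Jᶜ × ℝ` covers all such pairs. -/
lemma gagliardoSq_univ_le {V : ℝ → ℝ} (hV : Measurable V) (s : ℝ) {J : Set ℝ}
    (hJ : MeasurableSet J) :
    gagliardoSq s univ V ≤ gagliardoSq s J V +
      2 * ∫⁻ x in Jᶜ, ∫⁻ y, sqDist (V x) (V y) * fracKernel s (x - y) := by
  have hm := measurable_gagliardo_integrand hV s
  rw [gagliardoSq_eq, gagliardoSq_eq]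
  simp only [Measure.restrict_univ]
  rw [← lintegral_add_compl _ hJ]
  have h1 : ∀ x, ∫⁻ y, sqDist (V x) (V y) * fracKernel s (x - y) =
      (∫⁻ y in J, sqDist (V x) (V y) * fracKernel s (x - y)) +
        ∫⁻ y in Jᶜ, sqDist (V x) (V y) * fracKernel s (x - y) :=
    fun x => (lintegral_add_compl _ hJ).symm
  have h2 : ∫⁻ x in J, ∫⁻ y, sqDist (V x) (V y) * fracKernel s (x - y) =
      (∫⁻ x in J, ∫⁻ y in J, sqDist (V x) (V y) * fracKernel s (x - y)) +
        ∫⁻ x in J, ∫⁻ y in Jᶜ, sqDist (V x) (V y) * fracKernel s (x - y) := by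
    simp_rw [h1]
    exact lintegral_add_left hm.lintegral_prod_right' _
  have h3 : ∫⁻ x in J, ∫⁻ y in Jᶜ, sqDist (V x) (V y) * fracKernel s (x - y) ≤
      ∫⁻ x in Jᶜ, ∫⁻ y, sqDist (V x) (V y) * fracKernel s (x - y) := by
    rw [lintegral_lintegral_swap (by exact hm.aemeasurable)]
    refine lintegral_mono fun y => ?_
    refine (setLIntegral_le_lintegral _ _).trans (le_of_eq ?_)
    refine lintegral_congr fun x => ?_
    rw [sqDist_comm, fracKernel_sub_comm]
  rw [h2, two_mul, add_assoc]
  gcongr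

/-- On `I` the cutoff density is bounded and `U` is close to `z`; off `I` the squared distance is at
most `4` and only the tail of the cutoff energy is left. -/
lemma lintegral_mul_rampEnergy_le {s₁ s₂ : ℝ} {U : ℝ → ℝ} (hb : ∀ x, |U x| ≤ 1) {c : ℝ}
    (hc : ∀ x, rampEnergy s₁ s₂ x ≤ ENNReal.ofReal c) {z : ℝ} (hz : |z| ≤ 1) {e t : ℝ≥0∞}
    {g : ℝ → ℝ} {I : Set ℝ} (hI : MeasurableSet I)
    (hg : ∫⁻ x in Iᶜ, rampEnergy s₁ s₂ (g x) ≤ t)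
    (hclose : ∫⁻ x in I, sqDist (U x) z ≤ e) (J : Set ℝ) :
    ∫⁻ x in J, sqDist (U x) z * rampEnergy s₁ s₂ (g x) ≤ ENNReal.ofReal c * e + 4 * t := by
  refine (setLIntegral_le_lintegral _ _).trans ?_
  rw [← lintegral_add_compl _ hI]
  refine add_le_add ?_ ?_
  · calc _ ≤ ∫⁻ x in I, ENNReal.ofReal c * sqDist (U x) z :=
          lintegral_mono fun x => by rw [mul_comm]; exact mul_le_mul_left (hc _) _
      _ ≤ _ := by
          rw [lintegral_const_mul' _ _ ENNReal.ofReal_ne_top]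
          exact mul_le_mul_right hclose _
  · calc _ ≤ ∫⁻ x in Iᶜ, 4 * rampEnergy s₁ s₂ (g x) := by
          refine lintegral_mono fun x => mul_le_mul_left ?_ _
          have : |U x - z| ≤ 2 := by
            have := abs_sub (U x) z
            linarith [hb x]
          refine (sqDist_le this).trans ?_
          norm_num
      _ ≤ _ := by
          rw [lintegral_const_mul' _ _ (by simp)]
          exact mul_le_mul_right hg _

lemma lintegral_tail_shift {f : ℝ → ℝ≥0∞} {T : ℝ} {t : ℝ≥0∞}
    (hT : ∫⁻ x in (Ioo (-T) T)ᶜ, f x ≤ t) (c : ℝ) {S : Set ℝ} (hS : MeasurableSet S)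
    (h : ∀ x ∈ S, T ≤ |x - c|) : ∫⁻ x in S, f (x - c) ≤ t := by
  refine le_trans ?_ hT
  rw [← lintegral_indicator hS, ← lintegral_indicator measurableSet_Ioo.compl,
    ← lintegral_sub_right_eq_self (μ := volume) ((Ioo (-T) T)ᶜ.indicator f) c]
  refine lintegral_mono fun x => ?_
  by_cases hx : x ∈ S
  · rw [indicator_of_mem hx, indicator_of_mem]
    rw [mem_compl_iff, mem_Ioo, ← abs_lt, not_lt]
    exact h x hx
  · rw [indicator_of_notMem hx]; exact bot_le

lemma lintegral_tail_reflect {f : ℝ → ℝ≥0∞} {T : ℝ} {t : ℝ≥0∞}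
    (hT : ∫⁻ x in (Ioo (-T) T)ᶜ, f x ≤ t) (c : ℝ) {S : Set ℝ} (hS : MeasurableSet S)
    (h : ∀ x ∈ S, T ≤ |c - x|) : ∫⁻ x in S, f (c - x) ≤ t := by
  refine le_trans ?_ hT
  rw [← lintegral_indicator hS, ← lintegral_indicator measurableSet_Ioo.compl,
    ← lintegral_sub_left_eq_self (μ := volume) ((Ioo (-T) T)ᶜ.indicator f) c]
  refine lintegral_mono fun x => ?_
  by_cases hx : x ∈ S
  · rw [indicator_of_mem hx, indicator_of_mem]
    rw [mem_compl_iff, mem_Ioo, ← abs_lt, not_lt]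
    exact h x hx
  · rw [indicator_of_notMem hx]; exact bot_le

/-- Energy estimate for the glued function, inside the interval where `U` is given. -/
lemma gagliardoSq_glue_le {s s₁ s₂ : ℝ} (hs : 0 ≤ s) (h₁ : s₁ ≤ s) (h₂ : s ≤ s₂)
    {U : ℝ → ℝ} (hU : Measurable U) (hb : ∀ x, |U x| ≤ 1) {c : ℝ}
    (hc : ∀ x, rampEnergy s₁ s₂ x ≤ ENNReal.ofReal c) {T : ℝ} {t e : ℝ≥0∞}
    (hT : ∫⁻ x in (Ioo (-T) T)ᶜ, rampEnergy s₁ s₂ x ≤ t) {a b : ℝ} (hab : a + 2 ≤ b)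
    (hA : ∫⁻ x in Ioo (a - T) (a + T), sqDist (U x) (-1) ≤ e)
    (hB : ∫⁻ x in Ioo (b - T) (b + T), sqDist (U x) 1 ≤ e) {d : ℝ} (hd : 0 < d) (J : Set ℝ) :
    gagliardoSq s J (glue U a b) ≤ ENNReal.ofReal (1 + d) * gagliardoSq s J U +
      ENNReal.ofReal (2 * (1 + 1 / d)) * (2 * (ENNReal.ofReal c * e + 4 * t)) := by
  have hmU := measurable_gagliardo_integrand hU s
  have hmU1 : ∀ x, Measurable fun y =>
      ENNReal.ofReal (1 + d) * (sqDist (U x) (U y) * fracKernel s (x - y)) := fun x =>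
    (hmU.comp measurable_prodMk_left).const_mul _
  have hmU2 : Measurable fun x => ENNReal.ofReal (1 + d) *
      ∫⁻ y in J, sqDist (U x) (U y) * fracKernel s (x - y) :=
    (hmU.lintegral_prod_right' (ν := volume.restrict J)).const_mul _
  have hpt : ∀ x, ∫⁻ y in J, sqDist (glue U a b x) (glue U a b y) * fracKernel s (x - y) ≤
      (ENNReal.ofReal (1 + d) * ∫⁻ y in J, sqDist (U x) (U y) * fracKernel s (x - y)) +
      ENNReal.ofReal (2 * (1 + 1 / d)) * (sqDist (U x) (-1) * rampEnergy s₁ s₂ (x - a) +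
          sqDist (U x) 1 * rampEnergy s₁ s₂ (b - x)) := by
    intro x
    have m1 : Measurable fun y => sqDist (U x) (-1) *
        (sqDist (ramp (x - a)) (ramp (y - a)) * fracKernel s (x - y)) :=
      ((measurable_sqDist measurable_const
        (measurable_ramp.comp (measurable_id.sub_const a))).mul
        (measurable_fracKernel_comp s (measurable_id.const_sub x))).const_mul _
    calc _ ≤ ∫⁻ y in J, (ENNReal.ofReal (1 + d) * (sqDist (U x) (U y) * fracKernel s (x - y)) +
          ENNReal.ofReal (2 * (1 + 1 / d)) *
          (sqDist (U x) (-1) * (sqDist (ramp (x - a)) (ramp (y - a)) * fracKernel s (x - y)) +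
            sqDist (U x) 1 * (sqDist (ramp (b - x)) (ramp (b - y)) * fracKernel s (x - y)))) := by
          refine lintegral_mono fun y => ?_
          refine (mul_le_mul_left (sqDist_glue_le hab hd x y) _).trans (le_of_eq ?_)
          ring
      _ ≤ _ := by
          have hn1 : sqDist (U x) (-1) ≠ ⊤ := ENNReal.ofReal_ne_top
          have hn2 : sqDist (U x) 1 ≠ ⊤ := ENNReal.ofReal_ne_top
          rw [lintegral_add_left (hmU1 x), lintegral_const_mul' _ _ ENNReal.ofReal_ne_top,
            lintegral_const_mul' _ _ ENNReal.ofReal_ne_top, lintegral_add_left m1,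
            lintegral_const_mul' _ _ hn1, lintegral_const_mul' _ _ hn2]
          refine add_le_add le_rfl (mul_le_mul_right (add_le_add (mul_le_mul_right ?_ _)
            (mul_le_mul_right ?_ _)) _)
          · exact (setLIntegral_le_lintegral _ _).trans (lintegral_ramp_sub_le hs h₁ h₂ a x)
          · exact (setLIntegral_le_lintegral _ _).trans (lintegral_ramp_reflect_le hs h₁ h₂ b x)
  rw [gagliardoSq_eq, gagliardoSq_eq]
  refine (lintegral_mono hpt).trans ?_
  have m2 : Measurable fun x => sqDist (U x) (-1) * rampEnergy s₁ s₂ (x - a) :=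
    (measurable_sqDist hU measurable_const).mul
      ((measurable_rampEnergy s₁ s₂).comp (measurable_id.sub_const a))
  rw [lintegral_add_left hmU2, lintegral_const_mul' _ _ ENNReal.ofReal_ne_top,
    lintegral_const_mul' _ _ ENNReal.ofReal_ne_top, lintegral_add_left m2, two_mul (ENNReal.ofReal c * e + 4 * t)]
  refine add_le_add le_rfl (mul_le_mul_right (add_le_add ?_ ?_) _)
  · refine lintegral_mul_rampEnergy_le hb hc (by simp) measurableSet_Ioo ?_ hA J
    refine lintegral_tail_shift hT a measurableSet_Ioo.compl fun x hx => ?_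
    by_contra h
    rw [not_le, abs_lt] at h
    exact hx ⟨by linarith, by linarith⟩
  · refine lintegral_mul_rampEnergy_le hb hc (by simp) measurableSet_Ioo ?_ hB J
    refine lintegral_tail_reflect hT b measurableSet_Ioo.compl fun x hx => ?_
    by_contra h
    rw [not_le, abs_lt] at h
    exact hx ⟨by linarith, by linarith⟩

/-- Energy of the interaction of the glued function with the constant exteriors. -/
lemma lintegral_compl_glue_le {s s₁ s₂ : ℝ} (hs : 0 ≤ s) (h₁ : s₁ ≤ s) (h₂ : s ≤ s₂)
    {U : ℝ → ℝ} (hb : ∀ x, |U x| ≤ 1) {T : ℝ} (hT1 : 1 ≤ T) {t : ℝ≥0∞}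
    (hT : ∫⁻ x in (Ioo (-T) T)ᶜ, rampEnergy s₁ s₂ x ≤ t) {a b : ℝ} (hab : a + 2 ≤ b) {L : ℝ}
    (hL : T + 1 ≤ L) :
    ∫⁻ x in (Ioo (a - L) (b + L))ᶜ, ∫⁻ y,
      sqDist (glue U a b x) (glue U a b y) * fracKernel s (x - y) ≤ 8 * t := by
  have hcompl : (Ioo (a - L) (b + L))ᶜ = Iic (a - L) ∪ Ici (b + L) := by
    rw [← Ioi_inter_Iio, compl_inter, compl_Ioi, compl_Iio]
  have h4 : ∀ x y : ℝ, |x| ≤ 1 → |y| ≤ 1 → sqDist x y ≤ 4 := fun x y hx hy => by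
    have h2 : |x - y| ≤ 2 := by have := abs_sub x y; linarith
    refine (sqDist_le h2).trans ?_
    norm_num
  have h01 : sqDist 0 1 = 1 := by simp [sqDist]
  rw [hcompl]
  refine (lintegral_union_le _ _ _).trans ?_
  rw [show (8 : ℝ≥0∞) * t = 4 * t + 4 * t by rw [← add_mul]; norm_num]
  refine add_le_add ?_ ?_
  -- The cutoff based at `a - 1` vanishes at `x` and equals `1` for `y ≥ a`, while the glued
  -- function is constant on `(-∞,a]`. Its squared increments are therefore at most `4` times those
  -- of this cutoff, and `x` lies in the tail region.
  · calc _ ≤ ∫⁻ x in Iic (a - L), 4 * rampEnergy s₁ s₂ (x - (a - 1)) := by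
          refine setLIntegral_mono' measurableSet_Iic fun x (hx : x ≤ a - L) => ?_
          refine le_trans ?_ (mul_le_mul_right (lintegral_ramp_sub_le hs h₁ h₂ (a - 1) x) 4)
          rw [← lintegral_const_mul' _ _ (by simp)]
          refine lintegral_mono fun y => ?_
          rw [← mul_assoc]
          refine mul_le_mul_left ?_ _
          rw [ramp_of_nonpos (x := x - (a - 1)) (by linarith)]
          rcases le_total y a with hy | hy
          · rw [glue_of_le (by linarith) (by linarith), glue_of_le (by linarith) hy, sqDist_self]
            exact bot_le
          · rw [ramp_of_one_le (by linarith), h01, mul_one]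
            exact h4 _ _ (abs_glue_le hb hab x) (abs_glue_le hb hab y)
      _ ≤ _ := by
          rw [lintegral_const_mul' _ _ (by simp)]
          refine mul_le_mul_right (lintegral_tail_shift hT _ measurableSet_Iic
            fun x (hx : x ≤ a - L) => ?_) _
          rw [abs_of_nonpos (by linarith)]; linarith
  · calc _ ≤ ∫⁻ x in Ici (b + L), 4 * rampEnergy s₁ s₂ (b + 1 - x) := by
          refine setLIntegral_mono' measurableSet_Ici fun x (hx : b + L ≤ x) => ?_
          refine le_trans ?_ (mul_le_mul_right (lintegral_ramp_reflect_le hs h₁ h₂ (b + 1) x) 4)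
          rw [← lintegral_const_mul' _ _ (by simp)]
          refine lintegral_mono fun y => ?_
          rw [← mul_assoc]
          refine mul_le_mul_left ?_ _
          rw [ramp_of_nonpos (x := b + 1 - x) (by linarith)]
          rcases le_total b y with hy | hy
          · rw [glue_of_ge (by linarith) (by linarith), glue_of_ge (by linarith) hy, sqDist_self]
            exact bot_le
          · rw [ramp_of_one_le (by linarith), h01, mul_one]
            exact h4 _ _ (abs_glue_le hb hab x) (abs_glue_le hb hab y)
      _ ≤ _ := by
          rw [lintegral_const_mul' _ _ (by simp)]
          refine mul_le_mul_right (lintegral_tail_reflect hT _ measurableSet_Ici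
            fun x (hx : b + L ≤ x) => ?_) _
          rw [abs_of_nonpos (by linarith)]; linarith

lemma potentialEnergy_glue_le {W : ℝ → ℝ} (hW : IsDoubleWell W) {U : ℝ → ℝ} (hU : Measurable U)
    (hb : ∀ x, |U x| ≤ 1) {d C : ℝ} (hd : 0 ≤ d) (hC0 : 0 ≤ C)
    (hC : ∀ a b : ℝ, |a| ≤ 1 → |b| ≤ 1 → W a ≤ W b + d + C * |a - b| ^ 2) {T : ℝ} (hT : 1 ≤ T)
    {a b : ℝ} (hab : a + 2 ≤ b) {e : ℝ≥0∞}
    (hA : ∫⁻ x in Ioo (a - T) (a + T), sqDist (U x) (-1) ≤ e)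
    (hB : ∫⁻ x in Ioo (b - T) (b + T), sqDist (U x) 1 ≤ e) {L : ℝ} (hL : 0 ≤ L) :
    potentialEnergy W univ (glue U a b) ≤ potentialEnergy W (Ioo (a - L) (b + L)) U +
      2 * (ENNReal.ofReal d + ENNReal.ofReal C * e) := by
  have hgm := hW.measurable.comp hU
  have key : ∀ z p : ℝ, |z| ≤ 1 → |p| ≤ 1 → W p = 0 →
      ENNReal.ofReal (W z) ≤ ENNReal.ofReal d + ENNReal.ofReal C * sqDist z p := by
    intro z p hz hp h0
    rw [sqDist, ← ENNReal.ofReal_mul hC0, ← ENNReal.ofReal_add hd (by positivity)]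
    refine ENNReal.ofReal_le_ofReal ?_
    have := hC z p hz hp
    linarith
  have hpt : ∀ x, ENNReal.ofReal (W (glue U a b x)) ≤
      (Ioo (a - L) (b + L)).indicator (fun x => ENNReal.ofReal (W (U x))) x +
      ((Ioo a (a + 1)).indicator (fun x => ENNReal.ofReal d + ENNReal.ofReal C * sqDist (U x) (-1)) x
      + (Ioo (b - 1) b).indicator (fun x => ENNReal.ofReal d + ENNReal.ofReal C * sqDist (U x) 1) x)
      := by
    intro x
    rcases le_or_gt x a with h1 | h1
    · rw [glue_of_le (by linarith) h1, hW.neg_one]; simp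
    rcases le_or_gt b x with h2 | h2
    · rw [glue_of_ge (by linarith) h2, hW.one]; simp
    rcases lt_or_ge x (a + 1) with h3 | h3
    · refine le_add_left (le_add_right ?_)
      rw [indicator_of_mem (show x ∈ Ioo a (a + 1) from ⟨h1, h3⟩)]
      refine (key _ (-1) (abs_glue_le hb hab x) (by simp) hW.neg_one).trans ?_
      gcongr
      refine sqDist_mono ?_
      rw [glue, ramp_of_one_le (x := b - x) (by linarith),
        show ramp (x - a) * (U x + 1) + 1 * (U x - 1) - U x - (-1) = ramp (x - a) * (U x - (-1)) by
          ring, abs_mul, abs_of_nonneg (ramp_nonneg _)]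
      exact mul_le_of_le_one_left (abs_nonneg _) (ramp_le_one _)
    rcases lt_or_ge (b - 1) x with h4 | h4
    · refine le_add_left (le_add_left ?_)
      rw [indicator_of_mem (show x ∈ Ioo (b - 1) b from ⟨h4, h2⟩)]
      refine (key _ 1 (abs_glue_le hb hab x) (by simp) hW.one).trans ?_
      gcongr
      refine sqDist_mono ?_
      rw [glue, ramp_of_one_le (x := x - a) (by linarith),
        show 1 * (U x + 1) + ramp (b - x) * (U x - 1) - U x - 1 = ramp (b - x) * (U x - 1) by
          ring, abs_mul, abs_of_nonneg (ramp_nonneg _)]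
      exact mul_le_of_le_one_left (abs_nonneg _) (ramp_le_one _)
    · rw [glue_of_mem h3 h4, indicator_of_mem
        (show x ∈ Ioo (a - L) (b + L) from ⟨by linarith, by linarith⟩)]
      exact le_add_right le_rfl
  have hunit : ∀ (p z : ℝ) (S : Set ℝ), Ioo p (p + 1) ⊆ S → ∫⁻ x in S, sqDist (U x) z ≤ e →
      ∫⁻ x in Ioo p (p + 1), (ENNReal.ofReal d + ENNReal.ofReal C * sqDist (U x) z) ≤
        ENNReal.ofReal d + ENNReal.ofReal C * e := by
    intro p z S hS h
    rw [lintegral_add_left measurable_const, setLIntegral_const, Real.volume_Ioo,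
      lintegral_const_mul' _ _ ENNReal.ofReal_ne_top, add_sub_cancel_left, ENNReal.ofReal_one,
      mul_one]
    gcongr
    exact (lintegral_mono_set hS).trans h
  unfold potentialEnergy
  rw [setLIntegral_univ]
  refine (lintegral_mono hpt).trans ?_
  rw [lintegral_add_left (by exact hgm.ennreal_ofReal.indicator measurableSet_Ioo),
    lintegral_add_left (by exact Measurable.indicator (measurable_const.add
      ((measurable_sqDist hU measurable_const).const_mul _)) measurableSet_Ioo),
    lintegral_indicator measurableSet_Ioo, lintegral_indicator measurableSet_Ioo,
    lintegral_indicator measurableSet_Ioo, two_mul]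
  refine add_le_add le_rfl (add_le_add ?_ ?_)
  · exact hunit a (-1) _ (Ioo_subset_Ioo (by linarith) (by linarith)) hA
  · have := hunit (b - 1) 1 (Ioo (b - T) (b + T)) (Ioo_subset_Ioo (by linarith) (by linarith)) hB
    rwa [sub_add_cancel] at this

/-- A function that is close to `-1` around `a` and to `1` around `b` can be replaced by the
constants outside `(a,b)` with a small relative increase of the energy. -/
lemma exists_glue {W : ℝ → ℝ} (hW : IsDoubleWell W) {s₁ s₂ : ℝ} (h₁ : s₁ ∈ Ioo (1 / 2 : ℝ) 1)
    (h₂ : s₂ ∈ Ioo (1 / 2 : ℝ) 1) {d : ℝ} (hd : 0 < d) :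
    ∃ L e : ℝ, 2 ≤ L ∧ 0 < e ∧ ∀ s ∈ Icc s₁ s₂, ∀ U : ℝ → ℝ, Measurable U → (∀ x, |U x| ≤ 1) →
      ∀ a b : ℝ, a + 2 ≤ b →
      ∫⁻ x in Ioo (a - L) (a + L), sqDist (U x) (-1) ≤ ENNReal.ofReal e →
      ∫⁻ x in Ioo (b - L) (b + L), sqDist (U x) 1 ≤ ENNReal.ofReal e →
      ∃ V : ℝ → ℝ, Measurable V ∧ (∀ x, |V x| ≤ 1) ∧ (∀ x ≤ a, V x = -1) ∧ (∀ x, b ≤ x → V x = 1) ∧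
        energy W s univ V ≤
          ENNReal.ofReal (1 + d) * energy W s (Ioo (a - L) (b + L)) U + ENNReal.ofReal d := by
  obtain ⟨c, hc0, hc⟩ := exists_rampEnergy_le h₁ h₂
  obtain ⟨C, hC0, hC⟩ := hW.le_add_sq (d := d / 8) (by positivity)
  set k := 2 * (1 + 1 / d) with hk
  have hk0 : 0 < k := by positivity
  -- The total error is `2(d/8 + C e) + 2k(c e + 4t) + 16t`. The choices of `t` and `e` make its
  -- `t`-part equal to `d/4` and its `e`-part at most `d/4`; the added `1` in the definition of `e`
  -- keeps the denominator positive.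
  set t := d / (4 * (8 * k + 16)) with ht
  have ht0 : 0 < t := by positivity
  obtain ⟨T, hT1, hT⟩ := exists_tail_rampEnergy_le h₁ h₂ (d := ENNReal.ofReal t) (by simpa using ht0)
  set e := d / (4 * (2 * k * c + 2 * C + 1)) with he
  have he0 : 0 < e := by positivity
  refine ⟨T + 1, e, by linarith, he0, fun s hs U hU hb a b hab hA hB => ?_⟩
  have hs0 : 0 ≤ s := by linarith [hs.1, h₁.1]
  have hA' := (lintegral_mono_set (Ioo_subset_Ioo (by linarith) (by linarith) :
    Ioo (a - T) (a + T) ⊆ Ioo (a - (T + 1)) (a + (T + 1)))).trans hA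
  have hB' := (lintegral_mono_set (Ioo_subset_Ioo (by linarith) (by linarith) :
    Ioo (b - T) (b + T) ⊆ Ioo (b - (T + 1)) (b + (T + 1)))).trans hB
  refine ⟨glue U a b, measurable_glue hU a b, abs_glue_le hb hab,
    fun x hx => glue_of_le (by linarith) hx, fun x hx => glue_of_ge (by linarith) hx, ?_⟩
  set J := Ioo (a - (T + 1)) (b + (T + 1))
  have e1 := potentialEnergy_glue_le hW hU hb (by positivity) hC0 hC hT1 hab hA' hB'
    (L := T + 1) (by linarith)
  have e2 := gagliardoSq_univ_le (measurable_glue hU a b) s (J := J) measurableSet_Ioo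
  have e3 := gagliardoSq_glue_le hs0 hs.1 hs.2 hU hb hc hT hab hA' hB' hd J
  have e4 := lintegral_compl_glue_le hs0 hs.1 hs.2 hb hT1 hT hab (L := T + 1) le_rfl
  have hsum : 2 * (ENNReal.ofReal (d / 8) + ENNReal.ofReal C * ENNReal.ofReal e) +
      (ENNReal.ofReal k * (2 * (ENNReal.ofReal c * ENNReal.ofReal e + 4 * ENNReal.ofReal t)) +
        2 * (8 * ENNReal.ofReal t)) ≤ ENNReal.ofReal d := by
    have r2 : (2 : ℝ≥0∞) = ENNReal.ofReal 2 := by simp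
    have r4 : (4 : ℝ≥0∞) = ENNReal.ofReal 4 := by simp
    have r8 : (8 : ℝ≥0∞) = ENNReal.ofReal 8 := by simp
    rw [r2, r4, r8]
    simp only [← ENNReal.ofReal_mul, hC0, hc0, Nat.ofNat_nonneg]
    rw [← ENNReal.ofReal_add, ← ENNReal.ofReal_mul, ← ENNReal.ofReal_add, ← ENNReal.ofReal_mul,
      ← ENNReal.ofReal_mul, ← ENNReal.ofReal_add, ← ENNReal.ofReal_add]
    any_goals positivity
    refine ENNReal.ofReal_le_ofReal ?_
    have f1 : (8 * k + 16) * t = d / 4 := by rw [ht]; field_simp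
    have f2 : (2 * k * c + 2 * C + 1) * e = d / 4 := by rw [he]; field_simp
    nlinarith
  calc energy W s univ (glue U a b)
      ≤ (potentialEnergy W J U +
          2 * (ENNReal.ofReal (d / 8) + ENNReal.ofReal C * ENNReal.ofReal e)) +
        ((ENNReal.ofReal (1 + d) * gagliardoSq s J U + ENNReal.ofReal k *
          (2 * (ENNReal.ofReal c * ENNReal.ofReal e + 4 * ENNReal.ofReal t))) +
          2 * (8 * ENNReal.ofReal t)) :=
        add_le_add e1 (e2.trans (add_le_add e3 (mul_le_mul_right e4 2)))
    _ = potentialEnergy W J U + ENNReal.ofReal (1 + d) * gagliardoSq s J U +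
        (2 * (ENNReal.ofReal (d / 8) + ENNReal.ofReal C * ENNReal.ofReal e) +
      (ENNReal.ofReal k * (2 * (ENNReal.ofReal c * ENNReal.ofReal e + 4 * ENNReal.ofReal t)) +
        2 * (8 * ENNReal.ofReal t))) := by ring
    _ ≤ _ := by
        rw [energy, mul_add (ENNReal.ofReal (1 + d))]
        have h1 : (1 : ℝ≥0∞) ≤ ENNReal.ofReal (1 + d) := by
          rw [← ENNReal.ofReal_one]; exact ENNReal.ofReal_le_ofReal (by linarith)
        exact add_le_add (add_le_add (le_mul_of_one_le_left' h1) le_rfl) hsum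

/-! ### Blocks on which a function is close to a constant -/

/-- `U` is `θ`-close to `z` on `I` outside a set of measure at most `θ`. -/
def NearConst (U : ℝ → ℝ) (I : Set ℝ) (z θ : ℝ) : Prop :=
  volume (I ∩ {x | θ < |U x - z|}) ≤ ENNReal.ofReal θ

lemma measurableSet_far {U : ℝ → ℝ} (hU : Measurable U) (z θ : ℝ) :
    MeasurableSet {x | θ < |U x - z|} :=
  measurableSet_lt measurable_const (_root_.continuous_abs.measurable.comp (hU.sub_const z))

lemma NearConst.lintegral_le {U : ℝ → ℝ} (hU : Measurable U) (hb : ∀ x, |U x| ≤ 1) {p q z θ : ℝ}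
    (hz : |z| ≤ 1) (hθ : 0 ≤ θ) (hpq : p ≤ q) (h : NearConst U (Ioo p q) z θ) :
    ∫⁻ x in Ioo p q, sqDist (U x) z ≤ ENNReal.ofReal (θ ^ 2 * (q - p) + 4 * θ) := by
  have hpt : ∀ x, sqDist (U x) z ≤
      ENNReal.ofReal (θ ^ 2) + {x | θ < |U x - z|}.indicator (fun _ => (4 : ℝ≥0∞)) x := by
    intro x
    by_cases hx : θ < |U x - z|
    · rw [indicator_of_mem (show x ∈ {x | θ < |U x - z|} from hx)]
      refine le_add_left ?_
      have : |U x - z| ≤ 2 := by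
        have := abs_sub (U x) z
        linarith [hb x]
      refine (sqDist_le this).trans ?_
      norm_num
    · exact le_add_right (sqDist_le (not_lt.1 hx))
  refine (lintegral_mono hpt).trans ?_
  rw [lintegral_add_left measurable_const, setLIntegral_const, Real.volume_Ioo,
    lintegral_indicator (measurableSet_far hU z θ), setLIntegral_const,
    Measure.restrict_apply (measurableSet_far hU z θ), inter_comm,
    ← ENNReal.ofReal_mul (by positivity),
    ENNReal.ofReal_add (mul_nonneg (sq_nonneg _) (sub_nonneg.2 hpq)) (by positivity),
    ENNReal.ofReal_mul (by norm_num : (0 : ℝ) ≤ 4)]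
  refine add_le_add le_rfl ?_
  rw [show ENNReal.ofReal 4 = 4 by simp]
  exact mul_le_mul_right h 4

lemma IsDoubleWell.exists_pos_le {W : ℝ → ℝ} (hW : IsDoubleWell W) {θ : ℝ} (hθ : 0 < θ) :
    ∃ c : ℝ, 0 < c ∧ ∀ z, |z| ≤ 1 → θ ≤ |z - 1| → θ ≤ |z - (-1)| → c ≤ W z := by
  have hK : IsCompact ({z : ℝ | |z| ≤ 1} ∩ ({z | θ ≤ |z - 1|} ∩ {z | θ ≤ |z - (-1)|})) := by
    have h1 : IsCompact {z : ℝ | |z| ≤ 1} := by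
      have : {z : ℝ | |z| ≤ 1} = Icc (-1) 1 := by ext; simp [abs_le]
      rw [this]; exact isCompact_Icc
    refine h1.inter_right (IsClosed.inter ?_ ?_)
    · exact isClosed_le continuous_const (by fun_prop)
    · exact isClosed_le continuous_const (by fun_prop)
  rcases Set.eq_empty_or_nonempty ({z : ℝ | |z| ≤ 1} ∩ ({z | θ ≤ |z - 1|} ∩ {z | θ ≤ |z - (-1)|}))
    with he | hne
  · refine ⟨1, one_pos, fun z h1 h2 h3 => ?_⟩
    have : z ∈ (∅ : Set ℝ) := he ▸ ⟨h1, h2, h3⟩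
    exact absurd this (by simp)
  · obtain ⟨z₀, hz₀, hmin⟩ := hK.exists_isMinOn hne hW.continuous.continuousOn
    refine ⟨W z₀, ?_, fun z h1 h2 h3 => hmin ⟨h1, h2, h3⟩⟩
    refine lt_of_le_of_ne (hW.nonneg _) fun h0 => ?_
    obtain ⟨-, h2, h3⟩ := hz₀
    rcases (hW.zero_iff z₀).1 h0.symm with rfl | rfl
    · simp at h2; linarith
    · simp at h3; linarith

/-- If the points far from both wells have measure at least `θ/2`, the potential pays. Otherwise
points near `1` and points near `-1` each fill measure at least `θ/2`, and their mutual distance is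
at most `l`, so the seminorm pays. The bound `1 + 2s ≤ 3` makes the cost independent of `s`. -/
lemma IsDoubleWell.exists_bad_cost {W : ℝ → ℝ} (hW : IsDoubleWell W) {θ l : ℝ} (hθ : 0 < θ)
    (hθ1 : θ ≤ 1 / 2) (hl : 1 ≤ l) :
    ∃ k : ℝ≥0∞, k ≠ 0 ∧ ∀ s ∈ Icc (1 / 2 : ℝ) 1, ∀ U : ℝ → ℝ, Measurable U → (∀ x, |U x| ≤ 1) →
      ∀ p : ℝ, ¬ NearConst U (Ioo p (p + l)) (-1) θ → ¬ NearConst U (Ioo p (p + l)) 1 θ →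
      k ≤ energy W s (Ioo p (p + l)) U := by
  obtain ⟨c, hc, hcW⟩ := hW.exists_pos_le hθ
  refine ⟨min (ENNReal.ofReal c * ENNReal.ofReal (θ / 2))
    (ENNReal.ofReal (1 / l ^ 3) * ENNReal.ofReal (θ / 2) * ENNReal.ofReal (θ / 2)), ?_, ?_⟩
  · have h1 : 0 < 1 / l ^ 3 := by positivity
    have h2 : 0 < θ / 2 := by positivity
    refine (lt_min ?_ ?_).ne'
    · exact ENNReal.mul_pos (by simpa using hc) (by simpa using h2)
    · exact ENNReal.mul_pos (ENNReal.mul_pos (by simpa using h1) (by simpa using h2)).ne'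
        (by simpa using h2)
  intro s hs U hU hb p hA hB
  set I := Ioo p (p + l) with hI
  have hmI : MeasurableSet I := measurableSet_Ioo
  rw [NearConst, not_le] at hA hB
  have hmF := measurableSet_far hU
  set FA := I ∩ {x | θ < |U x - (-1)|} with hFA
  set FB := I ∩ {x | θ < |U x - 1|} with hFB
  have hmFA : MeasurableSet FA := hmI.inter (hmF _ _)
  have hmFB : MeasurableSet FB := hmI.inter (hmF _ _)
  rcases le_or_gt (ENNReal.ofReal (θ / 2)) (volume (FA ∩ FB)) with hmid | hmid
  · refine (min_le_left _ _).trans (le_add_right ?_)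
    calc _ ≤ ENNReal.ofReal c * volume (FA ∩ FB) := mul_le_mul_right hmid _
      _ = ∫⁻ _ in FA ∩ FB, ENNReal.ofReal c := (setLIntegral_const _ _).symm
      _ ≤ ∫⁻ x in FA ∩ FB, ENNReal.ofReal (W (U x)) :=
          setLIntegral_mono' (hmFA.inter hmFB) fun x hx => ENNReal.ofReal_le_ofReal
            (hcW _ (hb x) hx.2.2.le hx.1.2.le)
      _ ≤ _ := lintegral_mono_set fun x hx => hx.1.1
  · refine (min_le_right _ _).trans (le_add_left ?_)
    have hdiff : ∀ F G : Set ℝ, MeasurableSet F → MeasurableSet G → volume (F ∩ G) < ENNReal.ofReal (θ / 2) →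
        ENNReal.ofReal θ < volume F → ENNReal.ofReal (θ / 2) ≤ volume (F \ G) := by
      intro F G hF hG h1 h2
      by_contra h3
      rw [not_le] at h3
      have h4 := measure_inter_add_sdiff (μ := volume) F hG
      have h5 : volume F ≤ ENNReal.ofReal (θ / 2) + ENNReal.ofReal (θ / 2) := by
        rw [← h4]; exact add_le_add h1.le h3.le
      rw [← ENNReal.ofReal_add (by positivity) (by positivity), add_halves] at h5
      exact absurd h2 (not_lt.2 h5)
    have hb1 := hdiff FA FB hmFA hmFB hmid hA
    have hb2 := hdiff FB FA hmFB hmFA (by rwa [inter_comm]) hB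
    rw [gagliardoSq_eq]
    calc _ ≤ ENNReal.ofReal (1 / l ^ 3) * volume (FB \ FA) * volume (FA \ FB) := by gcongr
      _ = ∫⁻ _ in FA \ FB, ∫⁻ _ in FB \ FA, ENNReal.ofReal (1 / l ^ 3) := by
          rw [setLIntegral_const, setLIntegral_const]
      _ ≤ ∫⁻ x in FA \ FB, ∫⁻ y in FB \ FA, sqDist (U x) (U y) * fracKernel s (x - y) := by
          refine setLIntegral_mono' (hmFA.diff hmFB) fun x hx =>
            setLIntegral_mono' (hmFB.diff hmFA) fun y hy => ?_
          have hxI := hx.1.1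
          have hyI := hy.1.1
          have hx1 : |U x - 1| ≤ θ := not_lt.1 fun h => hx.2 ⟨hxI, h⟩
          have hy1 : |U y - (-1)| ≤ θ := not_lt.1 fun h => hy.2 ⟨hyI, h⟩
          rw [abs_le] at hx1 hy1
          have h1 : 1 ≤ |U x - U y| := by
            rw [abs_of_nonneg] <;> linarith
          have h2 : x ≠ y := by rintro rfl; norm_num at h1
          have h3 : 0 < |x - y| := abs_pos.2 (sub_ne_zero.2 h2)
          have h4 : |x - y| ≤ l := by
            rw [abs_le]; constructor <;> linarith [hxI.1, hxI.2, hyI.1, hyI.2]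
          have h5 : |x - y| ^ (1 + 2 * s) ≤ l ^ 3 := by
            rw [← Real.rpow_natCast l 3]
            refine (Real.rpow_le_rpow h3.le h4 (by linarith [hs.1])).trans ?_
            exact Real.rpow_le_rpow_of_exponent_le hl (by push_cast; linarith [hs.2])
          refine le_trans ?_ (mul_le_mul_left (le_sqDist zero_le_one h1) _)
          rw [one_pow, ENNReal.ofReal_one, one_mul, fracKernel]
          exact ENNReal.ofReal_le_ofReal
            (one_div_le_one_div_of_le (Real.rpow_pos_of_pos h3 _) h5)
      _ ≤ _ := (lintegral_mono_set fun x hx => hx.1.1).trans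
          (lintegral_mono fun x => lintegral_mono_set fun y hy => hy.1.1)

/-- Two labels on a row, with at most `N` unlabelled places: the two labels occur at distance at most
`N + 1`. -/
lemma exists_close_labels {P Q : ℕ → Prop} {n N i j : ℕ} (hi : i < n) (hj : j < n) (hPi : P i)
    (hQj : Q j) (hPQ : ∀ k, ¬ (P k ∧ Q k))
    (hN : ∀ S : Finset ℕ, (∀ k ∈ S, k < n ∧ ¬ P k ∧ ¬ Q k) → S.card ≤ N) :
    ∃ i' j', i' < n ∧ j' < n ∧ P i' ∧ Q j' ∧
      ((i' < j' ∧ j' ≤ i' + (N + 1)) ∨ (j' < i' ∧ i' ≤ j' + (N + 1))) := by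
  classical
  -- A closest pair of opposite labels has only unlabelled places strictly in between, since a
  -- labelled one would give a closer pair.
  have hex : ∃ d, ∃ i j, i < n ∧ j < n ∧ P i ∧ Q j ∧ (i - j) + (j - i) = d :=
    ⟨_, i, j, hi, hj, hPi, hQj, rfl⟩
  obtain ⟨i', j', hi', hj', hPi', hQj', hd⟩ := Nat.find_spec hex
  have hmin : ∀ a b, a < n → b < n → P a → Q b → (i' - j') + (j' - i') ≤ (a - b) + (b - a) :=
    fun a b ha hb hPa hQb => hd ▸ Nat.find_min' hex ⟨a, b, ha, hb, hPa, hQb, rfl⟩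
  refine ⟨i', j', hi', hj', hPi', hQj', ?_⟩
  rcases lt_trichotomy i' j' with h | h | h
  · left
    have := hN (Finset.Ioo i' j') fun k hk => by
      rw [Finset.mem_Ioo] at hk
      refine ⟨by omega, fun hP => ?_, fun hQ => ?_⟩
      · have := hmin k j' (by omega) hj' hP hQj'; omega
      · have := hmin i' k hi' (by omega) hPi' hQ; omega
    rw [Nat.card_Ioo] at this
    omega
  · subst h; exact absurd ⟨hPi', hQj'⟩ (hPQ i')
  · right
    have := hN (Finset.Ioo j' i') fun k hk => by
      rw [Finset.mem_Ioo] at hk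
      refine ⟨by omega, fun hP => ?_, fun hQ => ?_⟩
      · have := hmin k j' (by omega) hj' hP hQj'; omega
      · have := hmin i' k hi' (by omega) hPi' hQ; omega
    rw [Nat.card_Ioo] at this
    omega

lemma lintegral_sqDist_reflect {U : ℝ → ℝ} (z a L : ℝ) :
    ∫⁻ x in Ioo (-a - L) (-a + L), sqDist (U (-x)) z = ∫⁻ x in Ioo (a - L) (a + L), sqDist (U x) z := by
  have := setLIntegral_affine (E := Ioo (a - L) (a + L)) measurableSet_Ioo (fun x => sqDist (U x) z) 0
    (e := -1) (by norm_num)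
  simp only [abs_neg, abs_one, ENNReal.ofReal_one, zero_add, neg_mul, one_mul] at this
  rw [this]
  congr 2
  ext x
  simp only [mem_preimage, mem_Ioo]
  constructor <;> rintro ⟨h1, h2⟩ <;> constructor <;> linarith

/-- If `U` is close to `-1` around `a` and close to `1` around `b`, then its energy on the interval
spanned by the two neighbourhoods almost bounds the tension of profiles. -/
lemma exists_profileTension_le {W : ℝ → ℝ} (hW : IsDoubleWell W) {s₀ : ℝ}
    (hs₀ : s₀ ∈ Ioo (1 / 2 : ℝ) 1) {K d : ℝ} (hK : 0 ≤ K) (hd : 0 < d) :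
    ∃ L e : ℝ, 2 ≤ L ∧ 0 < e ∧ ∀ M : ℝ, 2 ≤ M → ∀ᶠ s in 𝓝 s₀, ∀ U : ℝ → ℝ, Measurable U →
      (∀ x, |U x| ≤ 1) → ∀ a b : ℝ, 2 ≤ |b - a| → |b - a| ≤ M →
      ∫⁻ x in Ioo (a - L) (a + L), sqDist (U x) (-1) ≤ ENNReal.ofReal e →
      ∫⁻ x in Ioo (b - L) (b + L), sqDist (U x) 1 ≤ ENNReal.ofReal e →
      energy W s (Ioo (min a b - L) (max a b + L)) U ≤ ENNReal.ofReal K →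
      profileTension W s₀ ≤ energy W s (Ioo (min a b - L) (max a b + L)) U + ENNReal.ofReal d := by
  obtain ⟨s₁, h₁, h₁'⟩ := exists_between hs₀.1
  obtain ⟨s₂, h₂, h₂'⟩ := exists_between hs₀.2
  -- Gluing loses a relative amount `d'` and an absolute amount `d'`. Since the energy is at most
  -- `K`, together they cost at most `d' K + d' = d/2`, and the remaining `d/2` pays for the
  -- Lipschitz regularization.
  set d' := d / 2 / (K + 1) with hd'
  have hd'0 : 0 < d' := by positivity
  have hd'K : d' * K + d' = d / 2 := by rw [hd']; field_simp
  obtain ⟨L, e, hL, he, H⟩ := exists_glue hW (s₁ := s₁) (s₂ := s₂) ⟨h₁, h₁'.trans hs₀.2⟩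
    ⟨hs₀.1.trans h₂, h₂'⟩ hd'0
  refine ⟨L, e, hL, he, fun M hM => ?_⟩
  filter_upwards [Ioo_mem_nhds h₁' h₂, profileTension_le_energy_add hW hs₀ (M := M) (by linarith)
    (K := ENNReal.ofReal (K + d / 2)) ENNReal.ofReal_ne_top (d := ENNReal.ofReal (d / 2))
    (by simpa using hd)] with s hs hprof
  have main : ∀ U : ℝ → ℝ, Measurable U → (∀ x, |U x| ≤ 1) → ∀ a b : ℝ, a + 2 ≤ b → b - a ≤ M →
      ∫⁻ x in Ioo (a - L) (a + L), sqDist (U x) (-1) ≤ ENNReal.ofReal e →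
      ∫⁻ x in Ioo (b - L) (b + L), sqDist (U x) 1 ≤ ENNReal.ofReal e →
      energy W s (Ioo (a - L) (b + L)) U ≤ ENNReal.ofReal K →
      profileTension W s₀ ≤ energy W s (Ioo (a - L) (b + L)) U + ENNReal.ofReal d := by
    intro U hU hb a b hab hM' hA hB hE
    obtain ⟨V, hV, hVb, hVl, hVr, hVE⟩ := H s ⟨hs.1.le, hs.2.le⟩ U hU hb a b hab hA hB
    have hVE' : energy W s univ V ≤ energy W s (Ioo (a - L) (b + L)) U + ENNReal.ofReal (d / 2) := by
      refine hVE.trans ?_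
      rw [ENNReal.ofReal_add zero_le_one hd'0.le, ENNReal.ofReal_one, add_mul, one_mul, add_assoc]
      refine add_le_add le_rfl ?_
      calc _ ≤ ENNReal.ofReal d' * ENNReal.ofReal K + ENNReal.ofReal d' :=
            add_le_add (mul_le_mul_right hE _) le_rfl
        _ = _ := by
            rw [← ENNReal.ofReal_mul hd'0.le, ← ENNReal.ofReal_add (by positivity) hd'0.le, hd'K]
    have ht := energy_translate W s MeasurableSet.univ V a
    rw [preimage_univ] at ht
    have := hprof (fun x => V (a + x)) (hV.comp (measurable_const_add a)) (fun x => hVb _)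
      (fun x hx => hVl _ (by linarith)) (fun x hx => hVr _ (by linarith)) (by
        rw [← ht]
        refine hVE'.trans ?_
        rw [ENNReal.ofReal_add hK (by positivity)]
        exact add_le_add hE le_rfl)
    rw [← ht] at this
    refine this.trans ?_
    refine (add_le_add hVE' le_rfl).trans (le_of_eq ?_)
    rw [add_assoc, ← ENNReal.ofReal_add (by positivity) (by positivity), add_halves]
  intro U hU hb a b hab2 habM hA hB hE
  rcases le_total a b with hab | hab
  · rw [abs_of_nonneg (by linarith)] at hab2 habM
    rw [min_eq_left hab, max_eq_right hab] at hE ⊢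
    exact main U hU hb a b (by linarith) habM hA hB hE
  · rw [abs_of_nonpos (by linarith)] at hab2 habM
    rw [min_eq_right hab, max_eq_left hab] at hE ⊢
    have hr := energy_reflect W s (E := Ioo (b - L) (a + L)) measurableSet_Ioo U 0
    have hpre : (fun z : ℝ => 0 - z) ⁻¹' Ioo (b - L) (a + L) = Ioo (-a - L) (-b + L) := by
      ext x
      simp only [mem_preimage, mem_Ioo]
      constructor <;> rintro ⟨h1, h2⟩ <;> constructor <;> linarith
    rw [hpre] at hr
    simp only [zero_sub] at hr
    rw [hr] at hE ⊢
    exact main (fun x => U (-x)) (hU.comp measurable_neg) (fun x => hb _) (-a) (-b) (by linarith)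
      (by linarith) (by rwa [lintegral_sqDist_reflect]) (by rwa [lintegral_sqDist_reflect]) hE

/-- The `k`-th block of length `l`. -/
def block (l : ℝ) (k : ℕ) : Set ℝ := Ioo (k * l) (k * l + l)

lemma block_subset {l : ℝ} (hl : 0 ≤ l) {k n : ℕ} (h : k < n) : block l k ⊆ Ioo 0 (n * l) := by
  have h1 : ((k : ℝ) + 1) ≤ n := by exact_mod_cast h
  refine Ioo_subset_Ioo (by positivity) ?_
  nlinarith

lemma pairwise_disjoint_block {l : ℝ} (hl : 0 ≤ l) : Pairwise (Function.onFun Disjoint (block l)) := by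
  have key : ∀ i j : ℕ, i < j → Disjoint (block l i) (block l j) := by
    intro i j hij
    have h1 : ((i : ℝ) + 1) ≤ j := by exact_mod_cast hij
    refine Set.disjoint_left.2 fun x hx hx' => ?_
    have := hx.2
    have := hx'.1
    nlinarith
  intro i j hij
  rcases lt_or_gt_of_ne hij with h | h
  · exact key i j h
  · exact (key j i h).symm

/-- Rows of blocks: few blocks are bad, and the presence of blocks of both signs costs the tension. -/
lemma exists_block_estimate {W : ℝ → ℝ} (hW : IsDoubleWell W) {s₀ : ℝ}
    (hs₀ : s₀ ∈ Ioo (1 / 2 : ℝ) 1) {K d θ₀ : ℝ} (hK : 0 ≤ K) (hd : 0 < d) (hθ₀ : 0 < θ₀) :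
    ∃ (l θ : ℝ) (N : ℕ), 1 ≤ l ∧ 0 < θ ∧ θ ≤ 1 / 2 ∧ θ ≤ θ₀ ∧ ∀ᶠ s in 𝓝 s₀, ∀ U : ℝ → ℝ,
      Measurable U → (∀ x, |U x| ≤ 1) → ∀ n : ℕ, energy W s (Ioo 0 (n * l)) U ≤ ENNReal.ofReal K →
      (∀ S : Finset ℕ, (∀ k ∈ S, k < n ∧ ¬ NearConst U (block l k) (-1) θ ∧
        ¬ NearConst U (block l k) 1 θ) → S.card ≤ N) ∧
      ∀ i j : ℕ, i < n → j < n → NearConst U (block l i) (-1) θ → NearConst U (block l j) 1 θ →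
        profileTension W s₀ ≤ energy W s (Ioo 0 (n * l)) U + ENNReal.ofReal d := by
  obtain ⟨L, e, hL, he, H⟩ := exists_profileTension_le hW hs₀ hK hd
  -- With this length, each block is exactly the neighbourhood of radius `L` of its midpoint, as the
  -- closeness hypotheses at `a` and `b` require.
  set l := 2 * L with hl
  have hl1 : 1 ≤ l := by linarith
  set θ := min (min (1 / 2) θ₀) (e / (l + 4)) with hθ
  have hθ0 : 0 < θ := by positivity
  have hθh : θ ≤ 1 / 2 := (min_le_left _ _).trans (min_le_left _ _)
  have hθe : θ ^ 2 * l + 4 * θ ≤ e := by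
    have h1 : θ * (l + 4) ≤ e := by
      rw [← le_div_iff₀ (by positivity)]; exact min_le_right _ _
    have h2 : θ ^ 2 * l ≤ θ * l := by
      refine mul_le_mul_of_nonneg_right ?_ (by linarith)
      nlinarith
    linarith
  obtain ⟨k, hk0, hk⟩ := hW.exists_bad_cost hθ0 hθh hl1
  -- `N` bounds the number of bad blocks by the energy budget divided by the cost of one. It does
  -- not depend on the number `n` of blocks, so neither does the distance `(N + 1) l` between the
  -- two selected blocks.
  obtain ⟨N, hN⟩ := ENNReal.exists_nat_gt (ENNReal.div_ne_top (ENNReal.ofReal_ne_top (r := K)) hk0)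
  refine ⟨l, θ, N, hl1, hθ0, hθh, (min_le_left _ _).trans (min_le_right _ _), ?_⟩
  have hMM : 2 ≤ ((N : ℝ) + 1) * l := by nlinarith [(Nat.cast_nonneg N : (0 : ℝ) ≤ N)]
  filter_upwards [H (((N : ℝ) + 1) * l) hMM, Ioo_mem_nhds hs₀.1 hs₀.2] with s hs hsI U hU hb n hE
  have hbad : ∀ S : Finset ℕ, (∀ k ∈ S, k < n ∧ ¬ NearConst U (block l k) (-1) θ ∧
        ¬ NearConst U (block l k) 1 θ) → S.card ≤ N := by
    intro S hS
    have h1 : (S.card : ℝ≥0∞) * k ≤ ENNReal.ofReal K := by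
      calc (S.card : ℝ≥0∞) * k = ∑ i ∈ S, k := by rw [Finset.sum_const, nsmul_eq_mul]
        _ ≤ ∑ i ∈ S, energy W s (block l i) U := Finset.sum_le_sum fun i hi =>
            hk s ⟨hsI.1.le, hsI.2.le⟩ U hU hb (i * l) (hS i hi).2.1 (hS i hi).2.2
        _ ≤ energy W s (Ioo 0 (n * l)) U :=
            sum_energy_le W S (block l) _ (fun i _ => measurableSet_Ioo)
              (fun i _ j _ hij => pairwise_disjoint_block (by linarith) hij)
              (fun i hi => block_subset (by linarith) (hS i hi).1) s U
        _ ≤ _ := hE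
    have h2 : (S.card : ℝ≥0∞) ≤ ENNReal.ofReal K / k :=
      ENNReal.le_div_iff_mul_le (Or.inl hk0) (Or.inr ENNReal.ofReal_ne_top) |>.2 h1
    have h3 := h2.trans_lt hN
    exact_mod_cast h3.le
  refine ⟨hbad, fun i j hi hj hA hB => ?_⟩
  -- Since `θ ≤ 1/2`, no value is `θ`-close to both wells. A block near both would be covered by two
  -- exceptional sets of total measure at most `2θ ≤ 1`, less than its length.
  have hnot : ∀ k, ¬ (NearConst U (block l k) (-1) θ ∧ NearConst U (block l k) 1 θ) := by
    rintro k ⟨h1, h2⟩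
    have hcov : block l k ⊆ (block l k ∩ {x | θ < |U x - (-1)|}) ∪
        (block l k ∩ {x | θ < |U x - 1|}) := by
      intro x hx
      by_contra hcon
      simp only [mem_union, mem_inter_iff, Set.mem_ofPred_eq, hx, true_and, not_or, not_lt] at hcon
      have h3 := abs_le.1 hcon.1
      have h4 := abs_le.1 hcon.2
      have h5 : |U x| ≤ 1 := hb x
      rcases eq_or_lt_of_le hθh with h6 | h6
      · linarith [h3.2, h4.1]
      · linarith [h3.2, h4.1]
    have h3 := (measure_mono hcov).trans ((measure_union_le _ _).trans (add_le_add h1 h2))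
    rw [block, Real.volume_Ioo, ← ENNReal.ofReal_add hθ0.le hθ0.le,
      ENNReal.ofReal_le_ofReal_iff (by positivity)] at h3
    linarith
  obtain ⟨i', j', hi', hj', hPi, hQj, hij⟩ := exists_close_labels hi hj hA hB hnot hbad
  have hblock : ∀ k : ℕ, Ioo ((k : ℝ) * l + L - L) (k * l + L + L) = block l k := fun k => by
    rw [block]; congr 1 <;> ring
  have hclose : ∀ k z, |z| ≤ 1 → NearConst U (block l k) z θ →
      ∫⁻ x in Ioo ((k : ℝ) * l + L - L) (k * l + L + L), sqDist (U x) z ≤ ENNReal.ofReal e := by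
    intro k z hz h
    rw [hblock]
    refine (h.lintegral_le hU hb hz hθ0.le (by linarith)).trans (ENNReal.ofReal_le_ofReal ?_)
    rwa [add_sub_cancel_left]
  have hdist : ((j' : ℝ) * l + L) - (i' * l + L) = (j' - i') * l := by ring
  have habs : |((j' : ℝ) * l + L) - (i' * l + L)| = |(j' : ℝ) - i'| * l := by
    rw [hdist, abs_mul, abs_of_pos (by linarith : 0 < l)]
  have h1 : 1 ≤ |(j' : ℝ) - i'| ∧ |(j' : ℝ) - i'| ≤ N + 1 := by
    rcases hij with ⟨h1, h2⟩ | ⟨h1, h2⟩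
    · have h1' : (i' : ℝ) + 1 ≤ j' := by exact_mod_cast h1
      have h2' : (j' : ℝ) ≤ i' + (N + 1) := by exact_mod_cast h2
      rw [abs_of_nonneg (by linarith)]; constructor <;> linarith
    · have h1' : (j' : ℝ) + 1 ≤ i' := by exact_mod_cast h1
      have h2' : (i' : ℝ) ≤ j' + (N + 1) := by exact_mod_cast h2
      rw [abs_of_nonpos (by linarith)]; constructor <;> linarith
  have hsub : Ioo (min ((i' : ℝ) * l + L) (j' * l + L) - L) (max ((i' : ℝ) * l + L) (j' * l + L) + L) ⊆
      Ioo 0 (n * l) := by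
    have e1 : ((i' : ℝ) + 1) ≤ n := by exact_mod_cast hi'
    have e2 : ((j' : ℝ) + 1) ≤ n := by exact_mod_cast hj'
    refine Ioo_subset_Ioo ?_ ?_
    · rw [← min_sub_sub_right]
      refine le_min ?_ ?_
      · rw [add_sub_cancel_right]; positivity
      · rw [add_sub_cancel_right]; positivity
    · rw [← max_add_add_right]
      refine max_le ?_ ?_
      · nlinarith
      · nlinarith
  have hmono := energy_mono_set W s hsub U
  refine (hs U hU hb _ _ ?_ ?_ (hclose i' (-1) (by simp) hPi) (hclose j' 1 (by simp) hQj)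
    (hmono.trans hE)).trans (add_le_add hmono le_rfl)
  · rw [habs]; nlinarith [h1.1]
  · rw [habs]; nlinarith [h1.2]

/-! ### Local lower bound in the supercritical case -/

/-- The scaled functional on the set `E`. -/
def localEnergy (W : ℝ → ℝ) (ε s : ℝ) (E : Set ℝ) (u : ℝ → ℝ) : ℝ≥0∞ :=
  ENNReal.ofReal (scaling ε s) *
    (ENNReal.ofReal (1 / ε) * potentialEnergy W E u
      + ENNReal.ofReal (ε ^ (2 * s - 1)) * gagliardoSq s E u)

lemma scaledEnergy_eq (W : ℝ → ℝ) (ε s : ℝ) (u : UnitFun) :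
    scaledEnergy W ε s u = localEnergy W ε s (Ioo 0 1) u := rfl

lemma sum_localEnergy_le {ι : Type*} (W : ℝ → ℝ) (S : Finset ι) (E : ι → Set ℝ) (F : Set ℝ)
    (hE : ∀ i ∈ S, MeasurableSet (E i)) (hd : (S : Set ι).PairwiseDisjoint E)
    (hF : ∀ i ∈ S, E i ⊆ F) (ε s : ℝ) (u : ℝ → ℝ) :
    ∑ i ∈ S, localEnergy W ε s (E i) u ≤ localEnergy W ε s F u := by
  unfold localEnergy
  rw [← Finset.mul_sum, Finset.sum_add_distrib, ← Finset.mul_sum, ← Finset.mul_sum]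
  gcongr
  · exact sum_potentialEnergy_le W S E F hE hd hF u
  · exact sum_gagliardoSq_le S E F hE hd hF s u

lemma scaling_of_gt {ε s : ℝ} (hs : 1 / 2 < s) :
    scaling ε s = (2 * s - 1) / (1 - ε ^ (2 * s - 1)) := by
  rw [scaling, if_neg hs.ne', ← neg_div_neg_eq]
  congr 1 <;> ring

lemma le_scaling {ε s : ℝ} (hε : ε ∈ Ioo (0 : ℝ) 1) (hs : 1 / 2 < s) : 2 * s - 1 ≤ scaling ε s := by
  rw [scaling_of_gt hs]
  have h1 : ε ^ (2 * s - 1) < 1 := Real.rpow_lt_one hε.1.le hε.2 (by linarith)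
  have h2 : 0 < ε ^ (2 * s - 1) := Real.rpow_pos_of_pos hε.1 _
  rw [le_div_iff₀ (by linarith)]
  nlinarith

lemma volume_affine {E : Set ℝ} (hE : MeasurableSet E) (c : ℝ) {e : ℝ} (he : 0 < e) :
    volume E = ENNReal.ofReal e * volume ((fun z => c + e * z) ⁻¹' E) := by
  have := setLIntegral_affine hE (fun _ => 1) c he.ne'
  rwa [setLIntegral_one, setLIntegral_one, abs_of_pos he] at this

/-- If all but `N` of `n` consecutive blocks are close to `z`, then the function is far from `z` only
on a small set. -/
lemma volume_far_le {U : ℝ → ℝ} {l θ T z : ℝ} (hθ : 0 ≤ θ) (hl : 0 ≤ l) {n N : ℕ}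
    (hN : ∀ S : Finset ℕ, (∀ k ∈ S, k < n ∧ ¬ NearConst U (block l k) z θ) → S.card ≤ N)
    (hT : n * l ≤ T) :
    volume (Ioo 0 T ∩ {x | θ < |U x - z|}) ≤ ENNReal.ofReal (N * l + n * θ + (T - n * l)) := by
  classical
  set S := {x | θ < |U x - z|}
  have hcov : Ioo 0 T ∩ S ⊆ (⋃ k ∈ Finset.range n, Ico ((k : ℝ) * l) (k * l + l) ∩ S) ∪
      Ico (n * l) T := by
    rintro x ⟨hx, hxS⟩
    rcases le_or_gt ((n : ℝ) * l) x with h | h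
    · exact Or.inr ⟨h, hx.2⟩
    · left
      have hl0 : 0 < l := by
        rcases eq_or_lt_of_le hl with h0 | h0
        · rw [← h0, mul_zero] at h; exact absurd hx.1 (not_lt.2 h.le)
        · exact h0
      have hfl := Nat.floor_le (div_nonneg hx.1.le hl)
      have hfl2 := Nat.lt_floor_add_one (x / l)
      rw [le_div_iff₀ hl0] at hfl
      rw [div_lt_iff₀ hl0] at hfl2
      simp only [mem_iUnion]
      refine ⟨⌊x / l⌋₊, ?_, ⟨hfl, by linarith⟩, hxS⟩
      rw [Finset.mem_range, Nat.floor_lt (div_nonneg hx.1.le hl), div_lt_iff₀ hl0]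
      exact h
  refine (measure_mono hcov).trans ((measure_union_le _ _).trans ?_)
  rw [ENNReal.ofReal_add (by positivity) (by linarith), Real.volume_Ico]
  refine add_le_add ((measure_biUnion_finset_le _ _).trans ?_) le_rfl
  have hk : ∀ k ∈ Finset.range n, volume (Ico ((k : ℝ) * l) (k * l + l) ∩ S) ≤
      (if ¬ NearConst U (block l k) z θ then ENNReal.ofReal l else 0) + ENNReal.ofReal θ := by
    intro k _
    have hae : volume (Ico ((k : ℝ) * l) (k * l + l) ∩ S) = volume (block l k ∩ S) :=
      measure_congr (Ioo_ae_eq_Ico.symm.inter (ae_eq_refl S))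
    rw [hae]
    by_cases hnear : NearConst U (block l k) z θ
    · exact le_add_left hnear
    · rw [if_pos hnear]
      refine le_add_right ((measure_mono inter_subset_left).trans ?_)
      rw [block, Real.volume_Ioo, add_sub_cancel_left]
  refine (Finset.sum_le_sum hk).trans ?_
  rw [Finset.sum_add_distrib, ← Finset.sum_filter, Finset.sum_const, Finset.sum_const,
    Finset.card_range, nsmul_eq_mul, nsmul_eq_mul, ENNReal.ofReal_add (by positivity) (by positivity),
    ENNReal.ofReal_mul (Nat.cast_nonneg _), ENNReal.ofReal_mul (Nat.cast_nonneg _),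
    ENNReal.ofReal_natCast, ENNReal.ofReal_natCast]
  gcongr
  exact hN _ fun k hk => by
    rw [Finset.mem_filter, Finset.mem_range] at hk; exact hk

/-- The blow-up of `(a,b)` is a row of blocks. If no block were near `-1`, all but `N` of them would
be near `1`; scaled back, the set far from `1` would have measure at most `ε((N+1)l + nθ) ≤ m/2`,
contradicting `hA`. The same holds with the wells exchanged, so both labels occur and the block
estimate applies. -/
lemma profileTension_le_blowup {W : ℝ → ℝ} (hW : IsDoubleWell W) {s₀ : ℝ}
    (hs₀ : s₀ ∈ Ioo (1 / 2 : ℝ) 1) {s ε : ℕ → ℝ} (happ : Approaches s ε s₀) {u : ℕ → ℝ → ℝ}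
    (hu : ∀ j, Measurable (u j)) {a b m : ℝ} (hab : a < b) (hm : 0 < m)
    (hA : ∀ᶠ j in atTop, ENNReal.ofReal m ≤ volume (Ioo a b ∩ {x | u j x ≤ -1 / 2}))
    (hB : ∀ᶠ j in atTop, ENNReal.ofReal m ≤ volume (Ioo a b ∩ {x | 1 / 2 ≤ u j x})) {d : ℝ}
    (hd : 0 < d) :
    ∀ᶠ j in atTop, profileTension W s₀ ≤
      energy W (s j) ((fun z => a + ε j * z) ⁻¹' Ioo a b) (fun z => u j (a + ε j * z)) +
        ENNReal.ofReal d := by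
  obtain ⟨-, hε0, hs, hε⟩ := happ
  have hPtop := profileTension_lt_top hW hs₀
  have hba : 0 < b - a := sub_pos.2 hab
  -- The budget `K` can be the tension itself, because nothing is to be proved when the energy
  -- exceeds it. The bound on `θ` makes the contribution `ε n θ` of the good blocks at most `m/4`.
  obtain ⟨l, θ, N, hl, hθ0, hθ1, hθm, H⟩ := exists_block_estimate hW hs₀
    (K := (profileTension W s₀).toReal) ENNReal.toReal_nonneg hd (θ₀ := m / (4 * (b - a)))
    (by positivity)
  have hl0 : 0 < l := by linarith
  have hεN : ∀ᶠ j in atTop, ε j * ((N + 1) * l) < m / 4 := by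
    have := hε.mul_const (((N : ℝ) + 1) * l)
    rw [zero_mul] at this
    exact this.eventually (gt_mem_nhds (by positivity))
  filter_upwards [hs.eventually H, hA, hB, hεN] with j hj hAj hBj hεj
  have he := hε0 j
  set T := (b - a) / ε j with hT
  have hT0 : 0 < T := by positivity
  set n := ⌊T / l⌋₊ with hn
  have hn1 : n * l ≤ T := by
    rw [← le_div_iff₀ hl0]; exact Nat.floor_le (by positivity)
  have hn2 : T - n * l ≤ l := by
    have := Nat.lt_floor_add_one (T / l)
    rw [div_lt_iff₀ hl0] at this
    linarith
  have hpre : (fun z => a + ε j * z) ⁻¹' Ioo a b = Ioo 0 T := by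
    rw [preimage_affine_Ioo a a b he, sub_self, zero_div]
  rw [hpre]
  set U := fun z => trunc (u j (a + ε j * z)) with hU
  have hUm : Measurable U := continuous_trunc.measurable.comp
    ((hu j).comp ((measurable_id.const_mul _).const_add _))
  have hUE : energy W (s j) (Ioo 0 (n * l)) U ≤
      energy W (s j) (Ioo 0 T) (fun z => u j (a + ε j * z)) :=
    (energy_trunc_le hW _ _ _).trans (energy_mono_set _ _ (Ioo_subset_Ioo le_rfl hn1) _)
  rcases le_or_gt (energy W (s j) (Ioo 0 (n * l)) U) (profileTension W s₀) with hK | hK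
  swap
  · exact le_add_right (hK.le.trans hUE)
  obtain ⟨hbad, hfin⟩ := hj U hUm (fun x => abs_trunc_le _) n (by rwa [ENNReal.ofReal_toReal hPtop.ne])
  -- a block close to `-z` must be present if `U` is far from `z` on a large set
  have hex : ∀ z : ℝ, (z = 1 ∨ z = -1) →
      ENNReal.ofReal m ≤ volume (Ioo a b ∩ {x | 1 / 2 < |trunc (u j x) - z|}) →
      ∃ i < n, NearConst U (block l i) (-z) θ := by
    intro z hz hmz
    by_contra hno
    push Not at hno
    have hcard : ∀ S : Finset ℕ, (∀ k ∈ S, k < n ∧ ¬ NearConst U (block l k) z θ) → S.card ≤ N := by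
      intro S hS
      refine hbad S fun k hk => ⟨(hS k hk).1, ?_, ?_⟩
      · rcases hz with rfl | rfl
        · exact hno k (hS k hk).1
        · exact (hS k hk).2
      · rcases hz with rfl | rfl
        · exact (hS k hk).2
        · have := hno k (hS k hk).1; rwa [neg_neg] at this
    have h1 := volume_far_le hθ0.le hl0.le hcard hn1
    have htm : Measurable fun x => trunc (u j x) := continuous_trunc.measurable.comp (hu j)
    rw [volume_affine (measurableSet_Ioo.inter (measurableSet_far htm z (1 / 2))) a he] at hmz
    have h2 : (fun z => a + ε j * z) ⁻¹' (Ioo a b ∩ {x | 1 / 2 < |trunc (u j x) - z|}) ⊆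
        Ioo 0 T ∩ {x | θ < |U x - z|} := by
      rw [preimage_inter, hpre]
      exact inter_subset_inter_right _ fun x hx => lt_of_le_of_lt hθ1 hx
    have h3 := hmz.trans (mul_le_mul_right ((measure_mono h2).trans h1) _)
    rw [← ENNReal.ofReal_mul he.le, ENNReal.ofReal_le_ofReal_iff
      (mul_nonneg he.le (by have : 0 ≤ T - n * l := by linarith
                            positivity))] at h3
    have h4 : ε j * (n * θ) ≤ m / 4 := by
      have h5 : (n : ℝ) ≤ T := by
        refine le_trans ?_ hn1
        exact le_mul_of_one_le_right (Nat.cast_nonneg n) hl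
      have h6 : ε j * T = b - a := by rw [hT]; field_simp
      calc ε j * (n * θ) ≤ ε j * (T * θ) := by gcongr
        _ = (b - a) * θ := by rw [← mul_assoc, h6]
        _ ≤ (b - a) * (m / (4 * (b - a))) := by gcongr
        _ = m / 4 := by field_simp
    nlinarith
  have hAz : ENNReal.ofReal m ≤ volume (Ioo a b ∩ {x | 1 / 2 < |trunc (u j x) - 1|}) := by
    refine hAj.trans (measure_mono (inter_subset_inter_right _ fun x (hx : u j x ≤ -1 / 2) => ?_))
    have : trunc (u j x) ≤ -1 / 2 := by unfold trunc; grind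
    change 1 / 2 < |trunc (u j x) - 1|
    rw [abs_of_nonpos] <;> linarith
  have hBz : ENNReal.ofReal m ≤ volume (Ioo a b ∩ {x | 1 / 2 < |trunc (u j x) - (-1)|}) := by
    refine hBj.trans (measure_mono (inter_subset_inter_right _ fun x (hx : 1 / 2 ≤ u j x) => ?_))
    have : 1 / 2 ≤ trunc (u j x) := by unfold trunc; grind
    change 1 / 2 < |trunc (u j x) - (-1)|
    rw [abs_of_nonneg] <;> linarith
  obtain ⟨i, hi, hi'⟩ := hex 1 (Or.inl rfl) hAz
  obtain ⟨k, hk, hk'⟩ := hex (-1) (Or.inr rfl) hBz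
  rw [neg_neg] at hk'
  exact (hfin i k hi hk hi' hk').trans (add_le_add hUE le_rfl)

lemma Approaches.eventually_mem {s ε : ℕ → ℝ} {s₀ : ℝ} (h : Approaches s ε s₀) {r : ℝ} (hr : 0 < r) :
    ∀ᶠ j in atTop, ε j ∈ Ioo 0 r :=
  (h.2.2.2.eventually (gt_mem_nhds hr)).mono fun j hj => ⟨h.2.1 j, hj⟩

/-- The scaling factor is at least `2s - 1`, so the blow-up estimate can be multiplied through;
replacing `2 s j - 1` by `2 s₀ - 1` costs the other half of `d`. -/
lemma local_liminf_of_gt {W : ℝ → ℝ} (hW : IsDoubleWell W) {s₀ : ℝ}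
    (hs₀ : s₀ ∈ Ioo (1 / 2 : ℝ) 1) {s ε : ℕ → ℝ} (happ : Approaches s ε s₀) {u : ℕ → ℝ → ℝ}
    (hu : ∀ j, Measurable (u j)) {a b m : ℝ} (hab : a < b) (hm : 0 < m)
    (hA : ∀ᶠ j in atTop, ENNReal.ofReal m ≤ volume (Ioo a b ∩ {x | u j x ≤ -1 / 2}))
    (hB : ∀ᶠ j in atTop, ENNReal.ofReal m ≤ volume (Ioo a b ∩ {x | 1 / 2 ≤ u j x})) {d : ℝ}
    (hd : 0 < d) :
    ∀ᶠ j in atTop, ENNReal.ofReal (2 * s₀ - 1) * profileTension W s₀ ≤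
      localEnergy W (ε j) (s j) (Ioo a b) (u j) + ENNReal.ofReal d := by
  have hPtop := (profileTension_lt_top hW hs₀).ne
  have h1 : Tendsto (fun j => ENNReal.ofReal (2 * s j - 1) * profileTension W s₀ +
      ENNReal.ofReal (d / 2)) atTop
      (𝓝 (ENNReal.ofReal (2 * s₀ - 1) * profileTension W s₀ + ENNReal.ofReal (d / 2))) := by
    refine Tendsto.add (ENNReal.Tendsto.mul_const (ENNReal.tendsto_ofReal ?_) (Or.inr hPtop))
      tendsto_const_nhds
    exact (happ.2.2.1.const_mul 2).sub_const 1
  have h2 := h1.eventually (lt_mem_nhds (ENNReal.lt_add_right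
    (ENNReal.mul_ne_top ENNReal.ofReal_ne_top hPtop) (by simpa using hd)))
  filter_upwards [h2, profileTension_le_blowup hW hs₀ happ hu hab hm hA hB (half_pos hd),
    happ.eventually_mem one_pos, happ.2.2.1.eventually (lt_mem_nhds hs₀.1)] with j hj1 hj2 hj3 hj4
  have hs1 := (happ.1 j).2
  refine hj1.le.trans ?_
  calc _ ≤ ENNReal.ofReal (2 * s j - 1) *
        (energy W (s j) ((fun z => a + ε j * z) ⁻¹' Ioo a b) (fun z => u j (a + ε j * z)) +
        ENNReal.ofReal (d / 2)) + ENNReal.ofReal (d / 2) :=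
        add_le_add (mul_le_mul_right hj2 _) le_rfl
    _ ≤ localEnergy W (ε j) (s j) (Ioo a b) (u j) + ENNReal.ofReal (d / 2)
        + ENNReal.ofReal (d / 2) := by
        rw [mul_add]
        refine add_le_add (add_le_add ?_ ?_) le_rfl
        · rw [localEnergy, scaled_energy_affine W (s j) measurableSet_Ioo (u j) a hj3.1]
          exact mul_le_mul_left (ENNReal.ofReal_le_ofReal (le_scaling hj3 hj4)) _
        · refine mul_le_of_le_one_left' ?_
          rw [← ENNReal.ofReal_one]
          exact ENNReal.ofReal_le_ofReal (by linarith)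
    _ = _ := by
        rw [add_assoc, ← ENNReal.ofReal_add (by positivity) (by positivity), add_halves]

/-! ### The scaling factor -/

/-- The inverse of the scaling factor, as an integral that depends continuously on `(ε,s)`. -/
def logInt (ε s : ℝ) : ℝ := ∫ x in (0 : ℝ)..(-Real.log ε), Real.exp (-(2 * s - 1) * x)

lemma logInt_half (ε : ℝ) : logInt ε (1 / 2) = -Real.log ε := by
  simp [logInt]

lemma logInt_of_ne {ε s : ℝ} (hε : 0 < ε) (hs : s ≠ 1 / 2) :
    logInt ε s = (1 - ε ^ (2 * s - 1)) / (2 * s - 1) := by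
  have h0 : -(2 * s - 1) ≠ 0 := fun h => hs (by linarith)
  have h1 : 2 * s - 1 ≠ 0 := fun h => hs (by linarith)
  rw [logInt, intervalIntegral.integral_comp_mul_left (fun x => Real.exp x) h0, integral_exp,
    mul_zero, Real.exp_zero, Real.rpow_def_of_pos hε, smul_eq_mul,
    show -(2 * s - 1) * -Real.log ε = Real.log ε * (2 * s - 1) by ring]
  field_simp
  ring

lemma logInt_pos {ε : ℝ} (hε : ε ∈ Ioo (0 : ℝ) 1) (s : ℝ) : 0 < logInt ε s := by
  refine intervalIntegral.intervalIntegral_pos_of_pos_on ?_ (fun x _ => Real.exp_pos _) ?_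
  · exact Continuous.intervalIntegrable (by fun_prop) _ _
  · linarith [Real.log_neg hε.1 hε.2]

lemma scaling_eq {ε : ℝ} (hε : ε ∈ Ioo (0 : ℝ) 1) (s : ℝ) : scaling ε s = 1 / logInt ε s := by
  rcases eq_or_ne s (1 / 2) with rfl | hs
  · rw [scaling, if_pos rfl, logInt_half, abs_of_neg (Real.log_neg hε.1 hε.2)]
  · rw [scaling, if_neg hs, logInt_of_ne hε.1 hs, one_div_div, ← neg_div_neg_eq]
    congr 1 <;> ring

/-- The integral defining `logInt` is continuous in its endpoint and parameter, also at `s = 1/2`,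
and it is positive. -/
lemma continuousOn_scaling : ContinuousOn (fun p : ℝ × ℝ => scaling p.1 p.2)
    (Ioo (0 : ℝ) 1 ×ˢ Ico (1 / 2 : ℝ) 1) := by
  have hc : Continuous fun q : ℝ × ℝ =>
      ∫ x in (0 : ℝ)..q.1, Real.exp (-(2 * q.2 - 1) * x) :=
    intervalIntegral.continuous_parametric_intervalIntegral_of_continuous (by fun_prop)
      continuous_fst
  have hl : ContinuousOn (fun p : ℝ × ℝ => (-Real.log p.1, p.2))
      (Ioo (0 : ℝ) 1 ×ˢ Ico (1 / 2 : ℝ) 1) := by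
    refine ContinuousOn.prodMk (ContinuousOn.neg ?_) continuousOn_snd
    exact ContinuousOn.log continuousOn_fst fun p hp => hp.1.1.ne'
  have h2 : ContinuousOn (fun p : ℝ × ℝ => 1 / logInt p.1 p.2)
      (Ioo (0 : ℝ) 1 ×ˢ Ico (1 / 2 : ℝ) 1) :=
    continuousOn_const.div (hc.comp_continuousOn hl) fun p hp => (logInt_pos hp.1 p.2).ne'
  exact h2.congr fun p hp => scaling_eq hp.1 p.2

lemma integral_rpow_of_pos {a b s : ℝ} (ha : 0 < a) (hb : 0 < b) (hs : s ≠ 1 / 2) :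
    ∫ h in a..b, h ^ (-2 * s) = (a ^ (1 - 2 * s) - b ^ (1 - 2 * s)) / (2 * s - 1) := by
  rw [integral_rpow (Or.inr ⟨fun h => hs (by linarith), ?_⟩),
    show -2 * s + 1 = 1 - 2 * s by ring, ← neg_div_neg_eq]
  · congr 1 <;> ring
  · rintro ⟨h1, -⟩
    exact absurd h1 (not_le.2 (lt_min ha hb))

/-- This is why `1/Λ` is the right normalization: up to `ε^{1-2s}`, `Λ` is the interaction weight of
a sharp jump between the distances `ε` and `1`. The next lemma is the same computation after
blow-up. -/
lemma integral_rpow_eps_one {ε : ℝ} (hε : 0 < ε) (s : ℝ) :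
    ∫ h in ε..1, h ^ (-2 * s) = ε ^ (1 - 2 * s) * logInt ε s := by
  rcases eq_or_ne s (1 / 2) with rfl | hs
  · have : ∀ h : ℝ, h ^ (-2 * (1 / 2) : ℝ) = h⁻¹ := fun h => by
      rw [show (-2 * (1 / 2) : ℝ) = -1 by norm_num, Real.rpow_neg_one]
    simp_rw [this]
    rw [integral_inv_of_pos hε one_pos, logInt_half, one_div, Real.log_inv]
    norm_num
  · rw [integral_rpow_of_pos hε one_pos hs, logInt_of_ne hε hs, Real.one_rpow, mul_div_assoc',
      mul_sub, mul_one, ← Real.rpow_add hε, show 1 - 2 * s + (2 * s - 1) = 0 by ring, Real.rpow_zero]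

lemma integral_rpow_one_inv {ε : ℝ} (hε : 0 < ε) (s : ℝ) :
    ∫ h in (1 : ℝ)..(1 / ε), h ^ (-2 * s) = logInt ε s := by
  rcases eq_or_ne s (1 / 2) with rfl | hs
  · have : ∀ h : ℝ, h ^ (-2 * (1 / 2) : ℝ) = h⁻¹ := fun h => by
      rw [show (-2 * (1 / 2) : ℝ) = -1 by norm_num, Real.rpow_neg_one]
    simp_rw [this]
    rw [integral_inv_of_pos one_pos (by positivity), logInt_half, div_one, one_div, Real.log_inv]
  · rw [integral_rpow_of_pos one_pos (by positivity) hs, logInt_of_ne hε hs, Real.one_rpow, one_div,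
      Real.inv_rpow hε.le, ← Real.rpow_neg hε.le]
    congr 3; ring

lemma intervalIntegrable_rpow_of_pos {a b : ℝ} (ha : 0 < a) (hb : 0 < b) (r : ℝ) :
    IntervalIntegrable (fun h : ℝ => h ^ r) volume a b :=
  intervalIntegral.intervalIntegrable_rpow (Or.inr fun h => by
    rcases le_total a b with h1 | h1
    · rw [uIcc_of_le h1] at h; linarith [h.1]
    · rw [uIcc_of_ge h1] at h; linarith [h.1])

lemma le_logInt {ε s N : ℝ} (hN : 0 ≤ N) (hs : 1 / 2 ≤ s) (h : N ≤ -Real.log ε) :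
    N * Real.exp (-(2 * s - 1) * N) ≤ logInt ε s := by
  have hint : ∀ a b : ℝ, IntervalIntegrable (fun x => Real.exp (-(2 * s - 1) * x)) volume a b :=
    fun a b => Continuous.intervalIntegrable (by fun_prop) _ _
  rw [logInt, ← intervalIntegral.integral_add_adjacent_intervals (hint 0 N) (hint N _)]
  have h1 : 0 ≤ ∫ x in N..(-Real.log ε), Real.exp (-(2 * s - 1) * x) :=
    intervalIntegral.integral_nonneg h fun x _ => (Real.exp_pos _).le
  have h2 : ∫ x in (0 : ℝ)..N, Real.exp (-(2 * s - 1) * N) ≤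
      ∫ x in (0 : ℝ)..N, Real.exp (-(2 * s - 1) * x) := by
    refine intervalIntegral.integral_mono_on hN intervalIntegrable_const (hint 0 N) fun x hx => ?_
    refine Real.exp_le_exp.2 ?_
    have := mul_nonneg (by linarith : 0 ≤ 2 * s - 1) (sub_nonneg.2 hx.2)
    nlinarith
  rw [intervalIntegral.integral_const, smul_eq_mul, sub_zero] at h2
  linarith

/-- For each fixed `N`, only the part of the integral over `[0,N]` is kept; its lower bound `N
exp(-(2s-1)N)` tends to `N` as `s → 1/2`, however fast `ε` tends to `0`. -/
lemma Approaches.tendsto_logInt {s ε : ℕ → ℝ} (h : Approaches s ε (1 / 2)) :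
    Tendsto (fun j => logInt (ε j) (s j)) atTop atTop := by
  refine tendsto_atTop.2 fun C => ?_
  obtain ⟨N, hN⟩ := exists_nat_gt (max C 0)
  have hN0 : (0 : ℝ) ≤ N := Nat.cast_nonneg N
  have hCN : C < N := (le_max_left _ _).trans_lt hN
  have h1 : Tendsto (fun j => (N : ℝ) * Real.exp (-(2 * s j - 1) * N)) atTop (𝓝 N) := by
    have h2 : Tendsto (fun j => (N : ℝ) * Real.exp (-(2 * s j - 1) * N)) atTop
        (𝓝 ((N : ℝ) * Real.exp (-(2 * (1 / 2) - 1) * N))) := by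
      have hc : Continuous fun x : ℝ => (N : ℝ) * Real.exp (-(2 * x - 1) * N) := by fun_prop
      exact (hc.tendsto (1 / 2)).comp h.2.2.1
    simpa using h2
  filter_upwards [h1.eventually (lt_mem_nhds hCN), h.eventually_mem (Real.exp_pos (-(N : ℝ)))]
    with j hj1 hj2
  refine hj1.le.trans (le_logInt hN0 (h.1 j).1 ?_)
  have := (Real.log_lt_log hj2.1 hj2.2).le
  rw [Real.log_exp] at this
  linarith

/-! ### Counting transitions at a fixed distance -/

/-- If `A` fills most of an interval of length `h` on the left and `B` most of one on the right, and
together they fill most of the span, then many points of `A` are sent into `B` by the shift `h`. -/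
lemma ofReal_le_volume_shift {A B : Set ℝ} (hA : MeasurableSet A)
    (hAB : Disjoint A B) {p q h : ℝ} (hpq : p ≤ q) (hh : 0 ≤ h) :
    ENNReal.ofReal h ≤ volume {x | x ∈ A ∧ x + h ∈ B} + volume (Ioc p (q + h) \ (A ∪ B)) +
      volume (Ioc p (p + h) \ A) + volume (Ioc q (q + h) \ B) := by
  have hsplit : ∀ a b c : ℝ, a ≤ b → b ≤ c →
      volume (A ∩ Ioc a c) = volume (A ∩ Ioc a b) + volume (A ∩ Ioc b c) := by
    intro a b c hab hbc
    rw [← Ioc_union_Ioc_eq_Ioc hab hbc, inter_union_distrib_left,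
      measure_union _ (hA.inter measurableSet_Ioc)]
    exact (Ioc_disjoint_Ioc_of_le le_rfl).mono inter_subset_right inter_subset_right
  have hshift : ∀ S : Set ℝ, volume ((fun x => x + h) ⁻¹' S) = volume S :=
    fun S => measure_preimage_add_right volume h S
  -- A point of `A` in `(p,q]` shifted by `h` lands in `A`, in `B`, or in neither. Splitting `A ∩
  -- (p,q+h]` at `p + h` and at `q` and comparing cancels the part of `A` in `(p+h,q+h]`.
  have h1 : volume (A ∩ Ioc p q) ≤ volume (A ∩ Ioc (p + h) (q + h)) +
      volume {x | x ∈ A ∧ x + h ∈ B} + volume (Ioc p (q + h) \ (A ∪ B)) := by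
    rw [← hshift (A ∩ Ioc (p + h) (q + h)), ← hshift (Ioc p (q + h) \ (A ∪ B))]
    refine le_trans (measure_mono ?_) ((measure_union_le _ _).trans
      (add_le_add (measure_union_le _ _) le_rfl))
    rintro x ⟨hxA, hx⟩
    by_cases h2 : x + h ∈ A
    · exact Or.inl (Or.inl ⟨h2, by linarith [hx.1], by linarith [hx.2]⟩)
    · by_cases h3 : x + h ∈ B
      · exact Or.inl (Or.inr ⟨hxA, h3⟩)
      · exact Or.inr ⟨⟨by linarith [hx.1], by linarith [hx.2]⟩, fun h4 => h4.elim h2 h3⟩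
  have h2 := hsplit p (p + h) (q + h) (by linarith) (by linarith)
  have h3 := hsplit p q (q + h) hpq (by linarith)
  have h4 : volume (A ∩ Ioc q (q + h)) ≤ volume (Ioc q (q + h) \ B) :=
    measure_mono fun x hx => ⟨hx.2, fun hB => Set.disjoint_left.1 hAB hx.1 hB⟩
  have hfin : volume (A ∩ Ioc (p + h) (q + h)) ≠ ⊤ :=
    ((measure_mono inter_subset_right).trans_lt (by simp)).ne
  have h5 : volume (A ∩ Ioc p (p + h)) ≤ volume {x | x ∈ A ∧ x + h ∈ B} +
      volume (Ioc p (q + h) \ (A ∪ B)) + volume (Ioc q (q + h) \ B) := by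
    refine (ENNReal.add_le_add_iff_left hfin).1 ?_
    calc _ = volume (A ∩ Ioc p (q + h)) := by rw [h2, add_comm]
      _ ≤ _ := by
        rw [h3]
        refine (add_le_add h1 h4).trans (le_of_eq ?_)
        ring
  calc ENNReal.ofReal h = volume (Ioc p (p + h)) := by rw [Real.volume_Ioc, add_sub_cancel_left]
    _ ≤ volume (Ioc p (p + h) ∩ A) + volume (Ioc p (p + h) \ A) := measure_le_inter_add_sdiff _ _ _
    _ ≤ _ := by
      rw [inter_comm]
      refine (add_le_add h5 le_rfl).trans (le_of_eq ?_)
      ring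

/-- Pigeonhole: a set of small measure in an interval has small density on some piece of length
`h`. -/
lemma exists_piece {F : Set ℝ} {p δ η h : ℝ} (hδ : 0 < δ) (hη : 0 ≤ η) (hF : MeasurableSet F)
    (hFm : volume (Ioc p (p + δ) ∩ F) ≤ ENNReal.ofReal (η * δ)) (hh : 0 < h) (hhδ : h ≤ δ / 2) :
    ∃ p', p ≤ p' ∧ p' + h ≤ p + δ ∧ volume (Ioc p' (p' + h) ∩ F) ≤ ENNReal.ofReal (2 * η * h) := by
  set n := ⌊δ / h⌋₊ with hn
  have hn1 : n * h ≤ δ := by rw [← le_div_iff₀ hh]; exact Nat.floor_le (by positivity)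
  have hn2 : δ < (n + 1) * h := by rw [← div_lt_iff₀ hh]; exact Nat.lt_floor_add_one _
  -- The pieces fill at least half of the interval. If each had density above `2η`, the total would
  -- exceed `ηδ`.
  have hn3 : δ / 2 ≤ n * h := by nlinarith
  by_contra hcon
  push Not at hcon
  have hk : ∀ k ∈ Finset.range n, ENNReal.ofReal (2 * η * h) <
      volume (Ioc (p + k * h) (p + k * h + h) ∩ F) := by
    intro k hk
    rw [Finset.mem_range] at hk
    have : ((k : ℝ) + 1) ≤ n := by exact_mod_cast hk
    exact hcon _ (by have : 0 ≤ (k : ℝ) * h := by positivity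
                     linarith) (by nlinarith)
  have hn0 : 0 < n := by
    rcases Nat.eq_zero_or_pos n with h0 | h0
    · rw [h0] at hn3; simp at hn3; linarith
    · exact h0
  have hsum : ∑ k ∈ Finset.range n, ENNReal.ofReal (2 * η * h) <
      ∑ k ∈ Finset.range n, volume (Ioc (p + k * h) (p + k * h + h) ∩ F) :=
    ENNReal.sum_lt_sum_of_nonempty ⟨0, Finset.mem_range.2 hn0⟩ hk
  have hdisj : Pairwise (Function.onFun Disjoint fun k : ℕ => Ioc (p + k * h) (p + k * h + h)) := by
    have key : ∀ i j : ℕ, i < j → Disjoint (Ioc (p + i * h) (p + i * h + h))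
        (Ioc (p + j * h) (p + j * h + h)) := by
      intro i j hij
      have h1 : ((i : ℝ) + 1) ≤ j := by exact_mod_cast hij
      refine Set.disjoint_left.2 fun x hx hx' => ?_
      have := hx.2
      have := hx'.1
      nlinarith
    intro i j hij
    rcases lt_or_gt_of_ne hij with h | h
    · exact key i j h
    · exact (key j i h).symm
  rw [← measure_biUnion_finset (fun i _ j _ hij => (hdisj hij).mono inter_subset_left
    inter_subset_left) (fun k _ => measurableSet_Ioc.inter hF)] at hsum
  have hsub : (⋃ k ∈ Finset.range n, Ioc (p + k * h) (p + k * h + h) ∩ F) ⊆ Ioc p (p + δ) ∩ F := by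
    refine iUnion₂_subset fun k hk => inter_subset_inter_left _ (Ioc_subset_Ioc ?_ ?_)
    · have : 0 ≤ (k : ℝ) * h := by positivity
      linarith
    · rw [Finset.mem_range] at hk
      have : ((k : ℝ) + 1) ≤ n := by exact_mod_cast hk
      nlinarith
  have h2 := hsum.trans_le ((measure_mono hsub).trans hFm)
  rw [Finset.sum_const, Finset.card_range, nsmul_eq_mul, ← ENNReal.ofReal_natCast,
    ← ENNReal.ofReal_mul (Nat.cast_nonneg n), ENNReal.ofReal_lt_ofReal_iff_of_nonneg (by positivity)]
    at h2
  nlinarith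

/-- Lower bound of the Gagliardo energy by the number of transitions at each distance. -/
lemma le_gagliardoSq_of_shift {u : ℝ → ℝ} (hu : Measurable u) (s : ℝ) {E A B : Set ℝ}
    (hE : MeasurableSet E) (hA : A ⊆ E) (hB : B ⊆ E) (hAm : MeasurableSet A) (hBm : MeasurableSet B)
    {c k : ℝ} (hc : 0 ≤ c) (hk : 0 ≤ k) (hAB : ∀ x ∈ A, ∀ y ∈ B, c ≤ |u x - u y|) {r r' : ℝ}
    (hr : 0 < r) (hr' : 0 < r')
    (hshift : ∀ h ∈ Ioc r r', ENNReal.ofReal (k * h) ≤ volume {x | x ∈ A ∧ x + h ∈ B}) :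
    ENNReal.ofReal (2 * c ^ 2 * k * ∫ h in r..r', h ^ (-2 * s)) ≤ gagliardoSq s E u := by
  rcases le_or_gt r r' with hrr | hrr
  swap
  · refine le_trans (le_of_eq (ENNReal.ofReal_of_nonpos ?_)) bot_le
    refine mul_nonpos_of_nonneg_of_nonpos (by positivity) ?_
    rw [intervalIntegral.integral_symm]
    refine neg_nonpos.2 (intervalIntegral.integral_nonneg hrr.le fun h hh => ?_)
    exact Real.rpow_nonneg (hr'.le.trans hh.1) _
  rw [gagliardoSq_slice hu s hE, lintegral_eq_of_even]
  swap
  · intro h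
    rw [fracKernel_neg]
    congr 1
    rw [← lintegral_add_right_eq_self _ h]
    refine lintegral_congr fun x => ?_
    rw [add_neg_cancel_right, sqDist_comm]; ring
  have hpt : ∀ h ∈ Ioc r r', ENNReal.ofReal (c ^ 2 * k) * ENNReal.ofReal (h ^ (-2 * s)) ≤
      fracKernel s h *
        ∫⁻ x, E.indicator 1 x * (E.indicator 1 (x + h) * sqDist (u x) (u (x + h))) := by
    intro h hh
    have hh0 : 0 < h := hr.trans hh.1
    have hmS : MeasurableSet {x | x ∈ A ∧ x + h ∈ B} := hAm.inter ((measurable_add_const h) hBm)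
    calc _ = fracKernel s h * (ENNReal.ofReal (c ^ 2) * ENNReal.ofReal (k * h)) := by
          rw [fracKernel_of_pos hh0, ← ENNReal.ofReal_mul (by positivity),
            ← ENNReal.ofReal_mul (by positivity), ← ENNReal.ofReal_mul (by positivity)]
          congr 1
          rw [show -2 * s = (-1 - 2 * s) + 1 by ring, Real.rpow_add_one hh0.ne']
          ring
      _ ≤ fracKernel s h * (ENNReal.ofReal (c ^ 2) * volume {x | x ∈ A ∧ x + h ∈ B}) :=
          mul_le_mul_right (mul_le_mul_right (hshift h hh) _) _
      _ ≤ _ := by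
          refine mul_le_mul_right ?_ _
          rw [← setLIntegral_const]
          rw [← lintegral_indicator hmS]
          refine lintegral_mono fun x => ?_
          by_cases hx : x ∈ {x | x ∈ A ∧ x + h ∈ B}
          · rw [indicator_of_mem hx, indicator_of_mem (hA hx.1), indicator_of_mem (hB hx.2),
              Pi.one_apply, Pi.one_apply, one_mul, one_mul]
            exact le_sqDist hc (hAB _ hx.1 _ hx.2)
          · rw [indicator_of_notMem hx]; exact bot_le
  calc _ = 2 * (ENNReal.ofReal (c ^ 2 * k) * ∫⁻ h in Ioc r r', ENNReal.ofReal (h ^ (-2 * s))) := by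
        rw [lintegral_Ioc_rpow hr hrr, show (2 : ℝ≥0∞) = ENNReal.ofReal 2 by simp,
          ← ENNReal.ofReal_mul (by positivity), ← ENNReal.ofReal_mul (by positivity)]
        congr 1; ring
    _ ≤ _ := by
        refine mul_le_mul_right ?_ 2
        rw [← lintegral_const_mul' _ _ ENNReal.ofReal_ne_top]
        refine (setLIntegral_mono' measurableSet_Ioc hpt).trans ?_
        exact lintegral_mono_set fun h hh => hr.trans hh.1

/-! ### Local lower bound in the critical case -/

/-- Pigeonhole finds pieces of length `h` inside both zones with defect at most `2ηh` each, and the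
mixed set costs `m ≤ ηh`. The three losses add up to `5ηh`. -/
lemma zone_shift {A B : Set ℝ} (hA : MeasurableSet A) (hB : MeasurableSet B) (hAB : Disjoint A B)
    {a b p q δ η m h : ℝ} (hap : a < p) (hpq : p + δ ≤ q) (hqb : q + δ < b) (hδ : 0 < δ)
    (hη : 0 ≤ η) (hm0 : 0 ≤ m)
    (hpA : volume (Ioc p (p + δ) \ A) ≤ ENNReal.ofReal (η * δ))
    (hqB : volume (Ioc q (q + δ) \ B) ≤ ENNReal.ofReal (η * δ))
    (hm : volume (Ioo a b \ (A ∪ B)) ≤ ENNReal.ofReal m) (hh : 0 < h) (hhδ : h ≤ δ / 2)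
    (hmh : m ≤ η * h) :
    ENNReal.ofReal ((1 - 5 * η) * h) ≤ volume {x | x ∈ A ∧ x + h ∈ B} := by
  obtain ⟨p', hp1, hp2, hp3⟩ := exists_piece hδ hη hA.compl (by rwa [← sdiff_eq]) hh hhδ
  obtain ⟨q', hq1, hq2, hq3⟩ := exists_piece hδ hη hB.compl (by rwa [← sdiff_eq]) hh hhδ
  rw [← sdiff_eq] at hp3 hq3
  have key := ofReal_le_volume_shift hA hAB (p := p') (q := q') (by linarith) hh.le
  have hsub : Ioc p' (q' + h) \ (A ∪ B) ⊆ Ioo a b \ (A ∪ B) := fun x hx =>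
    ⟨⟨by linarith [hx.1.1], by linarith [hx.1.2]⟩, hx.2⟩
  have h1 : volume (Ioc p' (q' + h) \ (A ∪ B)) ≤ ENNReal.ofReal m := (measure_mono hsub).trans hm
  have h2 : ENNReal.ofReal h ≤ volume {x | x ∈ A ∧ x + h ∈ B} + ENNReal.ofReal (5 * η * h) := by
    refine key.trans ?_
    rw [add_assoc, add_assoc]
    refine add_le_add le_rfl ((add_le_add h1 (add_le_add hp3 hq3)).trans ?_)
    rw [← ENNReal.ofReal_add (by positivity) (by positivity), ← ENNReal.ofReal_add hm0 (by positivity)]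
    exact ENNReal.ofReal_le_ofReal (by linarith)
  rw [show (1 - 5 * η) * h = h - 5 * η * h by ring, ENNReal.ofReal_sub _ (by positivity)]
  exact tsub_le_iff_right.2 h2

/-- The two phases are at least `2 - 2η` apart in value, which with the symmetry factor `2` gives
`8(1-η)²`. The distances start at `m/η` so that the mixed set has measure at most `ηh`. -/
lemma zone_gagliardo {u : ℝ → ℝ} (hu : Measurable u) (s : ℝ) {a b p q δ η m : ℝ} (hap : a < p)
    (haq : a < q) (hpb : p + δ < b) (hqb : q + δ < b) (hpq : p + δ ≤ q ∨ q + δ ≤ p) (hδ : 0 < δ)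
    (hη : 0 < η) (hη1 : η ≤ 1 / 8) (hm0 : 0 < m)
    (hpA : volume (Ioc p (p + δ) ∩ {x | ¬ u x ≤ -1 + η}) ≤ ENNReal.ofReal (η * δ))
    (hqB : volume (Ioc q (q + δ) ∩ {x | ¬ 1 - η ≤ u x}) ≤ ENNReal.ofReal (η * δ))
    (hm : volume (Ioo a b ∩ {x | |u x| < 1 - η}) ≤ ENNReal.ofReal m) :
    ENNReal.ofReal (8 * (1 - η) ^ 2 * (1 - 5 * η) * ∫ h in (m / η)..(δ / 2), h ^ (-2 * s)) ≤
      gagliardoSq s (Ioo a b) u := by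
  set A := Ioo a b ∩ {x | u x ≤ -1 + η} with hA
  set B := Ioo a b ∩ {x | 1 - η ≤ u x} with hB
  have hAm : MeasurableSet A := measurableSet_Ioo.inter (measurableSet_le hu measurable_const)
  have hBm : MeasurableSet B := measurableSet_Ioo.inter (measurableSet_le measurable_const hu)
  have hdiff : ∀ x ∈ A, ∀ y ∈ B, 2 - 2 * η ≤ |u x - u y| := by
    intro x hx y hy
    have h1 : u x ≤ -1 + η := hx.2
    have h2 : 1 - η ≤ u y := hy.2
    rw [abs_of_nonpos (by linarith)]; linarith
  have hAB : Disjoint A B := Set.disjoint_left.2 fun x hx hx' => by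
    have := hdiff x hx x hx'
    rw [sub_self, abs_zero] at this
    linarith
  have hpA' : volume (Ioc p (p + δ) \ A) ≤ ENNReal.ofReal (η * δ) := by
    refine (measure_mono ?_).trans hpA
    exact fun x hx => ⟨hx.1, fun h => hx.2 ⟨⟨by linarith [hx.1.1], by linarith [hx.1.2]⟩, h⟩⟩
  have hqB' : volume (Ioc q (q + δ) \ B) ≤ ENNReal.ofReal (η * δ) := by
    refine (measure_mono ?_).trans hqB
    exact fun x hx => ⟨hx.1, fun h => hx.2 ⟨⟨by linarith [hx.1.1], by linarith [hx.1.2]⟩, h⟩⟩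
  have hm' : volume (Ioo a b \ (A ∪ B)) ≤ ENNReal.ofReal m := by
    refine (measure_mono ?_).trans hm
    rintro x ⟨hx, hn⟩
    have h1 : -1 + η < u x := not_le.1 fun h => hn (Or.inl ⟨hx, h⟩)
    have h2 : u x < 1 - η := not_le.1 fun h => hn (Or.inr ⟨hx, h⟩)
    exact ⟨hx, show |u x| < 1 - η from abs_lt.2 ⟨by linarith, h2⟩⟩
  have e : 8 * (1 - η) ^ 2 * (1 - 5 * η) = 2 * (2 - 2 * η) ^ 2 * (1 - 5 * η) := by ring
  have hmη : ∀ h ∈ Ioc (m / η) (δ / 2), m ≤ η * h := fun h hh => by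
    rw [mul_comm, ← div_le_iff₀ hη]; exact hh.1.le
  rw [e]
  rcases hpq with hpq | hpq
  · refine le_gagliardoSq_of_shift hu s measurableSet_Ioo inter_subset_left inter_subset_left hAm hBm
      (by linarith) (by linarith) hdiff (by positivity) (by positivity) fun h hh => ?_
    exact zone_shift hAm hBm hAB hap hpq hqb hδ hη.le hm0.le hpA' hqB' hm'
      ((by positivity : 0 < m / η).trans hh.1) hh.2 (hmη h hh)
  · refine le_gagliardoSq_of_shift hu s measurableSet_Ioo inter_subset_left inter_subset_left hBm hAm
      (by linarith) (by linarith) (fun x hx y hy => by rw [abs_sub_comm]; exact hdiff y hy x hx)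
      (by positivity) (by positivity) fun h hh => ?_
    exact zone_shift hBm hAm hAB.symm haq hpq hpb hδ hη.le hm0.le hqB' hpA' (by rwa [union_comm])
      ((by positivity : 0 < m / η).trans hh.1) hh.2 (hmη h hh)

/-- The part of the normalized integral of `h^{-2s}` that is captured between scales comparable to
`ε Λ` and a fixed scale tends to `1`. -/
lemma tendsto_captured {s ε : ℕ → ℝ} (happ : Approaches s ε (1 / 2)) {C r : ℝ} (hC : 0 < C)
    (hr : 0 < r) (hr1 : r ≤ 1) {k : ℝ} (hk : k < 1) :
    ∀ᶠ j in atTop, k ≤ scaling (ε j) (s j) * ε j ^ (2 * s j - 1) *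
      ∫ h in (C * (ε j * logInt (ε j) (s j)))..r, h ^ (-2 * s j) := by
  have hΛ := happ.tendsto_logInt
  -- The parts missing from the full integral over `[ε,1]` are negligible against `Λ`: below `CεΛ`
  -- the normalized integrand is at most `1/h`, which costs `log (CΛ)`, and above `r` it is at most
  -- `r^{-2}`.
  have h1 : Tendsto (fun x : ℝ => 1 - Real.log (C * x) / x - r ^ (-2 : ℝ) / x) atTop (𝓝 1) := by
    have e1 : Tendsto (fun x : ℝ => Real.log (C * x) / x) atTop (𝓝 0) := by
      have e2 : Tendsto (fun x : ℝ => Real.log x / x) atTop (𝓝 0) :=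
        Real.isLittleO_log_id_atTop.tendsto_div_nhds_zero
      have e3 : Tendsto (fun x : ℝ => Real.log C / x) atTop (𝓝 0) :=
        tendsto_const_nhds.div_atTop tendsto_id
      have e4 := e3.add e2
      rw [add_zero] at e4
      refine e4.congr' ?_
      filter_upwards [eventually_gt_atTop 0] with x hx
      rw [Real.log_mul hC.ne' hx.ne', add_div]
    have e5 : Tendsto (fun x : ℝ => r ^ (-2 : ℝ) / x) atTop (𝓝 0) :=
      tendsto_const_nhds.div_atTop tendsto_id
    simpa using (tendsto_const_nhds.sub e1).sub e5
  filter_upwards [(h1.comp hΛ).eventually (lt_mem_nhds hk), hΛ.eventually_ge_atTop (1 / C),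
    happ.eventually_mem one_pos] with j hj1 hj2 hj3
  have hs := happ.1 j
  refine hj1.le.trans ?_
  rw [Function.comp_apply]
  set Λ := logInt (ε j) (s j) with hΛdef
  have hΛ0 : 0 < Λ := logInt_pos hj3 _
  have he := hj3.1
  have hCΛ : 1 ≤ C * Λ := by rw [div_le_iff₀ hC] at hj2; linarith
  set ρ := C * (ε j * Λ) with hρ
  have hρ0 : 0 < ρ := by positivity
  have hερ : ε j ≤ ρ := by rw [hρ]; nlinarith
  rw [scaling_eq hj3]
  have hII := fun {a b : ℝ} (ha : 0 < a) (hb : 0 < b) =>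
    intervalIntegrable_rpow_of_pos ha hb (-2 * s j)
  have hadd : (∫ h in ε j..ρ, h ^ (-2 * s j)) + (∫ h in ρ..r, h ^ (-2 * s j)) +
      (∫ h in r..1, h ^ (-2 * s j)) = ε j ^ (1 - 2 * s j) * Λ := by
    rw [intervalIntegral.integral_add_adjacent_intervals (hII he hρ0) (hII hρ0 hr),
      intervalIntegral.integral_add_adjacent_intervals (hII he hr) (hII hr one_pos),
      integral_rpow_eps_one he]
  set t := ε j ^ (2 * s j - 1) with ht
  have ht0 : 0 < t := Real.rpow_pos_of_pos he _
  have ht1 : t ≤ 1 := Real.rpow_le_one he.le hj3.2.le (by linarith [hs.1])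
  have htt : t * ε j ^ (1 - 2 * s j) = 1 := by
    rw [ht, ← Real.rpow_add he, show 2 * s j - 1 + (1 - 2 * s j) = 0 by ring, Real.rpow_zero]
  have b1 : t * ∫ h in ε j..ρ, h ^ (-2 * s j) ≤ Real.log (C * Λ) := by
    have e1 : ∫ h in ε j..ρ, h ^ (-2 * s j) ≤ ∫ h in ε j..ρ, ε j ^ (1 - 2 * s j) * h⁻¹ := by
      refine intervalIntegral.integral_mono_on hερ (hII he hρ0) ?_ fun h hh => ?_
      · refine IntervalIntegrable.const_mul ?_ _
        have := intervalIntegrable_rpow_of_pos he hρ0 (-1)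
        simpa [Real.rpow_neg_one] using this
      · have hh0 : 0 < h := he.trans_le hh.1
        rw [show -2 * s j = (1 - 2 * s j) + -1 by ring, Real.rpow_add hh0, Real.rpow_neg_one]
        refine mul_le_mul_of_nonneg_right ?_ (inv_nonneg.2 hh0.le)
        exact Real.rpow_le_rpow_of_nonpos he hh.1 (by linarith [hs.1])
    rw [intervalIntegral.integral_const_mul, integral_inv_of_pos he hρ0] at e1
    have e2 : ρ / ε j = C * Λ := by rw [hρ]; field_simp
    rw [e2] at e1
    calc _ ≤ t * (ε j ^ (1 - 2 * s j) * Real.log (C * Λ)) := mul_le_mul_of_nonneg_left e1 ht0.le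
      _ = _ := by rw [← mul_assoc, htt, one_mul]
  have b2 : t * ∫ h in r..1, h ^ (-2 * s j) ≤ r ^ (-2 : ℝ) := by
    have e1 : ∫ h in r..1, h ^ (-2 * s j) ≤ ∫ h in r..1, r ^ (-2 : ℝ) := by
      refine intervalIntegral.integral_mono_on hr1 (hII hr one_pos) intervalIntegrable_const
        fun h hh => ?_
      have hh0 : 0 < h := hr.trans_le hh.1
      exact (Real.rpow_le_rpow_of_nonpos hr hh.1 (by linarith [hs.1])).trans
        (Real.rpow_le_rpow_of_exponent_ge hr hr1 (by linarith [hs.2]))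
    rw [intervalIntegral.integral_const, smul_eq_mul] at e1
    have e0 : 0 ≤ ∫ h in r..1, h ^ (-2 * s j) :=
      intervalIntegral.integral_nonneg hr1 fun h hh => Real.rpow_nonneg (hr.le.trans hh.1) _
    have e2 : 0 < r ^ (-2 : ℝ) := Real.rpow_pos_of_pos hr _
    nlinarith
  have b3 : t * ∫ h in ρ..r, h ^ (-2 * s j) =
      Λ - t * (∫ h in ε j..ρ, h ^ (-2 * s j)) - t * ∫ h in r..1, h ^ (-2 * s j) := by
    have : ∫ h in ρ..r, h ^ (-2 * s j) = ε j ^ (1 - 2 * s j) * Λ -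
      (∫ h in ε j..ρ, h ^ (-2 * s j)) - ∫ h in r..1, h ^ (-2 * s j) := by linarith
    rw [this, mul_sub, mul_sub, ← mul_assoc, htt, one_mul]
  rw [mul_assoc, b3, one_div, ← div_eq_inv_mul, le_div_iff₀ hΛ0]
  have : (1 - Real.log (C * Λ) / Λ - r ^ (-2 : ℝ) / Λ) * Λ = Λ - Real.log (C * Λ) - r ^ (-2 : ℝ) := by
    field_simp
  rw [this]
  linarith

/-- An energy of at least `9`, a number above the limit value `8`, leaves nothing to prove.
Otherwise the potential term bounds the measure of the transition set by `(9/c) εΛ`, so transitions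
can be counted from a scale comparable to `εΛ` upwards. -/
lemma local_liminf_half_of_zones {W : ℝ → ℝ} (hW : IsDoubleWell W) {s ε : ℕ → ℝ}
    (happ : Approaches s ε (1 / 2)) {u : ℕ → ℝ → ℝ} (hu : ∀ j, Measurable (u j))
    {a b p q δ η : ℝ} (hap : a < p) (haq : a < q) (hpb : p + δ < b) (hqb : q + δ < b)
    (hpq : p + δ ≤ q ∨ q + δ ≤ p) (hδ : 0 < δ) (hδ1 : δ ≤ 1) (hη : 0 < η) (hη1 : η ≤ 1 / 8)
    (hpA : ∀ᶠ j in atTop, volume (Ioc p (p + δ) ∩ {x | ¬ u j x ≤ -1 + η}) ≤ ENNReal.ofReal (η * δ))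
    (hqB : ∀ᶠ j in atTop, volume (Ioc q (q + δ) ∩ {x | ¬ 1 - η ≤ u j x}) ≤ ENNReal.ofReal (η * δ)) :
    ∀ᶠ j in atTop, ENNReal.ofReal (8 * (1 - η) ^ 2 * (1 - 5 * η) * (1 - η)) ≤
      localEnergy W (ε j) (s j) (Ioo a b) (u j) := by
  obtain ⟨c, hc, hcW⟩ := hW.exists_pos_le hη
  filter_upwards [hpA, hqB, happ.eventually_mem one_pos,
    tendsto_captured happ (C := 9 / c / η) (r := δ / 2) (by positivity) (by positivity) (by linarith)
      (k := 1 - η) (by linarith)] with j hj1 hj2 hj3 hj4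
  have he := hj3.1
  set Λ := logInt (ε j) (s j) with hΛdef
  have hΛ0 : 0 < Λ := logInt_pos hj3 _
  rcases le_or_gt 9 (localEnergy W (ε j) (s j) (Ioo a b) (u j)) with hbig | hsmall
  · refine le_trans ?_ hbig
    rw [show (9 : ℝ≥0∞) = ENNReal.ofReal 9 by simp]
    refine ENNReal.ofReal_le_ofReal ?_
    have h1 : (1 - η) ^ 2 * (1 - 5 * η) * (1 - η) ≤ 1 := by
      have e1 : (1 - η) ^ 2 ≤ 1 := by nlinarith
      have e2 : (1 - η) ^ 2 * (1 - 5 * η) ≤ 1 := mul_le_one₀ e1 (by linarith) (by linarith)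
      exact mul_le_one₀ e2 (by linarith) (by linarith)
    linarith
  set m := 9 / c * (ε j * Λ) with hm
  have hm0 : 0 < m := by positivity
  have hscal : scaling (ε j) (s j) = 1 / Λ := scaling_eq hj3 _
  have hbad : volume (Ioo a b ∩ {x | |u j x| < 1 - η}) ≤ ENNReal.ofReal m := by
    set S := Ioo a b ∩ {x | |u j x| < 1 - η}
    have hSm : MeasurableSet S := measurableSet_Ioo.inter
      (measurableSet_lt (_root_.continuous_abs.measurable.comp (hu j)) measurable_const)
    have h1 : ENNReal.ofReal c * volume S ≤ potentialEnergy W (Ioo a b) (u j) := by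
      rw [← setLIntegral_const]
      refine (setLIntegral_mono' hSm fun x hx => ?_).trans (lintegral_mono_set inter_subset_left)
      have hx2 : |u j x| < 1 - η := hx.2
      obtain ⟨h2, h3⟩ := abs_lt.1 hx2
      refine ENNReal.ofReal_le_ofReal (hcW _ (by linarith) ?_ ?_)
      · rw [abs_of_nonpos] <;> linarith
      · rw [abs_of_nonneg] <;> linarith
    have h2 : ENNReal.ofReal (1 / Λ * (1 / ε j)) * potentialEnergy W (Ioo a b) (u j) ≤
        ENNReal.ofReal 9 := by
      rw [ENNReal.ofReal_mul (by positivity), mul_assoc, ← hscal]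
      refine le_trans (mul_le_mul_right (le_add_right le_rfl) _) (hsmall.le.trans ?_)
      simp
    have h3 : ENNReal.ofReal (1 / Λ * (1 / ε j) * c) * volume S ≤ ENNReal.ofReal 9 := by
      rw [ENNReal.ofReal_mul (by positivity), mul_assoc]
      exact (mul_le_mul_right h1 _).trans h2
    have h4 : ENNReal.ofReal (1 / Λ * (1 / ε j) * c) ≠ 0 := by
      have : 0 < 1 / Λ * (1 / ε j) * c := by positivity
      simpa using this
    rw [mul_comm] at h3
    have h5 : volume S ≤ ENNReal.ofReal 9 / ENNReal.ofReal (1 / Λ * (1 / ε j) * c) :=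
      (ENNReal.le_div_iff_mul_le (Or.inl h4) (Or.inl ENNReal.ofReal_ne_top)).2 h3
    have h6 : 0 < 1 / Λ * (1 / ε j) * c := by positivity
    rw [← ENNReal.ofReal_div_of_pos h6] at h5
    refine h5.trans (ENNReal.ofReal_le_ofReal (le_of_eq ?_))
    rw [hm]; field_simp
  have hgag := zone_gagliardo (hu j) (s j) hap haq hpb hqb hpq hδ hη hη1 hm0 hj1 hj2 hbad
  have hmη : m / η = 9 / c / η * (ε j * Λ) := by rw [hm]; ring
  rw [hmη] at hgag
  have hsc0 : 0 ≤ scaling (ε j) (s j) := by rw [hscal]; positivity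
  have ht0 : 0 ≤ ε j ^ (2 * s j - 1) := Real.rpow_nonneg he.le _
  calc _ ≤ ENNReal.ofReal (8 * (1 - η) ^ 2 * (1 - 5 * η) *
        (scaling (ε j) (s j) * ε j ^ (2 * s j - 1) *
          ∫ h in (9 / c / η * (ε j * Λ))..(δ / 2), h ^ (-2 * s j))) := by
        have h5 : 0 ≤ 1 - 5 * η := by linarith
        have h6 : 0 ≤ 8 * (1 - η) ^ 2 * (1 - 5 * η) := by positivity
        exact ENNReal.ofReal_le_ofReal (mul_le_mul_of_nonneg_left hj4 h6)
    _ = ENNReal.ofReal (scaling (ε j) (s j)) * (ENNReal.ofReal (ε j ^ (2 * s j - 1)) *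
        ENNReal.ofReal (8 * (1 - η) ^ 2 * (1 - 5 * η) *
          ∫ h in (9 / c / η * (ε j * Λ))..(δ / 2), h ^ (-2 * s j))) := by
        rw [← ENNReal.ofReal_mul ht0, ← ENNReal.ofReal_mul hsc0]
        congr 1; ring
    _ ≤ _ := by
        rw [localEnergy]
        exact mul_le_mul_right (le_add_left (mul_le_mul_right hgag _)) _

/-! ### Local lower bound -/

/-- The rescaled tension computed with Lipschitz profiles. -/
def rescaledProfileTension (W : ℝ → ℝ) (s : ℝ) : ℝ≥0∞ :=
  if s = 1 / 2 then 8 else ENNReal.ofReal (2 * s - 1) * profileTension W s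

lemma le_of_two_mul_le {X Y : ℝ≥0∞} {m : ℝ} (hm : 0 ≤ m) (h : ENNReal.ofReal (2 * m) ≤ X + Y)
    (hY : Y ≤ ENNReal.ofReal m) : ENNReal.ofReal m ≤ X := by
  rw [two_mul, ENNReal.ofReal_add hm hm] at h
  exact (ENNReal.add_le_add_iff_right ENNReal.ofReal_ne_top).1 (h.trans (add_le_add le_rfl hY))

/-- Small intervals around almost every point of `A` are almost filled by `A`. -/
lemma exists_density_point {A : Set ℝ} (hA : MeasurableSet A) (h0 : volume A ≠ 0) :
    ∃ p ∈ A, ∀ η : ℝ, 0 < η → ∀ᶠ r in 𝓝[>] (0 : ℝ),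
      volume (Ioc (p - r) (p - r + 2 * r) \ A) ≤ ENNReal.ofReal (η / 2 * (2 * r)) := by
  have h1 := Besicovitch.ae_tendsto_measure_inter_div (volume : Measure ℝ) A
  rw [ae_restrict_iff' hA] at h1
  have h2 : ∃ p ∈ A, Tendsto (fun r => volume (A ∩ Metric.closedBall p r) /
      volume (Metric.closedBall p r)) (𝓝[>] 0) (𝓝 1) := by
    by_contra hcon
    push Not at hcon
    refine h0 (measure_mono_null (fun p hp => ?_) h1)
    exact fun h => hcon p hp (h hp)
  obtain ⟨p, hp, hlim⟩ := h2
  refine ⟨p, hp, fun η hη => ?_⟩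
  have hlt : ENNReal.ofReal (1 - η / 2) < 1 := by
    rw [ENNReal.ofReal_lt_one]; linarith
  filter_upwards [hlim.eventually (lt_mem_nhds hlt), self_mem_nhdsWithin] with r hr hr0
  have hr0 : 0 < r := hr0
  have hball : volume (Metric.closedBall p r) = ENNReal.ofReal (2 * r) := Real.volume_closedBall p r
  have hle : ENNReal.ofReal (1 - η / 2) * ENNReal.ofReal (2 * r) ≤
      volume (A ∩ Metric.closedBall p r) := by
    have h0 : ENNReal.ofReal (2 * r) ≠ 0 := by simpa using hr0
    rw [hball] at hr
    exact (ENNReal.le_div_iff_mul_le (Or.inl h0) (Or.inl ENNReal.ofReal_ne_top)).1 hr.le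
  have hsub : Ioc (p - r) (p - r + 2 * r) \ A ⊆ Metric.closedBall p r \ A := by
    refine sdiff_subset_sdiff_left fun x hx => ?_
    rw [Real.closedBall_eq_Icc]
    exact ⟨hx.1.le, by linarith [hx.2]⟩
  refine (measure_mono hsub).trans ?_
  have hadd := measure_inter_add_sdiff (μ := volume) (Metric.closedBall p r) hA
  rw [inter_comm] at hle
  have hfin : ENNReal.ofReal (1 - η / 2) * ENNReal.ofReal (2 * r) ≠ ⊤ :=
    ENNReal.mul_ne_top ENNReal.ofReal_ne_top ENNReal.ofReal_ne_top
  refine (ENNReal.add_le_add_iff_left hfin).1 ?_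
  calc _ ≤ volume (Metric.closedBall p r) := by
        rw [← hadd]; exact add_le_add hle le_rfl
    _ = ENNReal.ofReal ((1 - η / 2) * (2 * r) + η / 2 * (2 * r)) := by rw [hball]; congr 1; ring
    _ ≤ _ := by
        refine ENNReal.ofReal_add_le.trans (add_le_add ?_ le_rfl)
        rw [mul_comm, ENNReal.ofReal_mul (by positivity), mul_comm]

/-- At `s₀ = 1/2`, density points of the two level sets of `v` provide disjoint zones almost filled
by one phase each. For `s₀ > 1/2` it is enough that both phases of `u j` keep a fixed positive
measure. -/
lemma local_liminf {W : ℝ → ℝ} (hW : IsDoubleWell W) {s₀ : ℝ} (hs₀ : s₀ ∈ Ico (1 / 2 : ℝ) 1)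
    {s ε : ℕ → ℝ} (happ : Approaches s ε s₀) {u : ℕ → ℝ → ℝ} (hu : ∀ j, Measurable (u j))
    {v : ℝ → ℝ} (hv : Measurable v) {a b : ℝ} (hab : a < b)
    (hconv : ∀ η : ℝ, 0 < η →
      Tendsto (fun j => volume (Ioo a b ∩ {x | η ≤ |u j x - v x|})) atTop (𝓝 0))
    (hA : volume (Ioo a b ∩ {x | v x = -1}) ≠ 0) (hB : volume (Ioo a b ∩ {x | v x = 1}) ≠ 0)
    {d : ℝ} (hd : 0 < d) :
    ∀ᶠ j in atTop, rescaledProfileTension W s₀ ≤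
      localEnergy W (ε j) (s j) (Ioo a b) (u j) + ENNReal.ofReal d := by
  have hconv' : ∀ η m : ℝ, 0 < η → 0 < m → ∀ᶠ j in atTop,
      volume (Ioo a b ∩ {x | η ≤ |u j x - v x|}) ≤ ENNReal.ofReal m := fun η m hη hm =>
    (hconv η hη).eventually (eventually_le_nhds (by simpa using hm))
  rcases eq_or_lt_of_le hs₀.1 with h12 | h12
  · subst h12
    rw [rescaledProfileTension, if_pos rfl]
    have hAm : MeasurableSet (Ioo a b ∩ {x | v x = -1}) :=
      measurableSet_Ioo.inter (hv (measurableSet_singleton (-1)))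
    have hBm : MeasurableSet (Ioo a b ∩ {x | v x = 1}) :=
      measurableSet_Ioo.inter (hv (measurableSet_singleton 1))
    obtain ⟨p, hp, hp'⟩ := exists_density_point hAm hA
    obtain ⟨q, hq, hq'⟩ := exists_density_point hBm hB
    have hpv : v p = -1 := hp.2
    have hqv : v q = 1 := hq.2
    have hpq : p ≠ q := by rintro rfl; rw [hpv] at hqv; norm_num at hqv
    have hpq0 : 0 < |p - q| := abs_pos.2 (sub_ne_zero.2 hpq)
    -- The factor `(1-η)²(1-5η)(1-η)` is at least `(1-2η)(1-6η)`, hence at least `1 - 8η`;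
    -- multiplied by `8`, the loss is at most `64η ≤ d`.
    set η := min (1 / 8) (d / 64) with hη
    have hη0 : 0 < η := by positivity
    have hη1 : η ≤ 1 / 8 := min_le_left _ _
    have hsmall : ∀ x : ℝ, 0 < x → ∀ᶠ r in 𝓝[>] (0 : ℝ), r < x := fun x hx =>
      mem_nhdsWithin_of_mem_nhds (gt_mem_nhds hx)
    obtain ⟨r, hr1, hr2, hr3, hr4, hr5, hr6, hr7, hr8, hr0⟩ := ((hp' η hη0).and ((hq' η hη0).and
      ((hsmall (p - a) (sub_pos.2 hp.1.1)).and ((hsmall (b - p) (sub_pos.2 hp.1.2)).and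
      ((hsmall (q - a) (sub_pos.2 hq.1.1)).and ((hsmall (b - q) (sub_pos.2 hq.1.2)).and
      ((hsmall (1 / 2) (by norm_num)).and ((hsmall (|p - q| / 2) (by positivity)).and
        self_mem_nhdsWithin)))))))).exists
    have hr0 : 0 < r := hr0
    have hzone : ∀ z : ℝ, a < z - r → z + r < b → ∀ w : ℝ,
        volume (Ioc (z - r) (z - r + 2 * r) \ (Ioo a b ∩ {x | v x = w})) ≤
          ENNReal.ofReal (η / 2 * (2 * r)) → ∀ P : ℝ → Prop, (∀ y, ¬ P y → η ≤ |y - w|) →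
        ∀ᶠ j in atTop, volume (Ioc (z - r) (z - r + 2 * r) ∩ {x | ¬ P (u j x)}) ≤
          ENNReal.ofReal (η * (2 * r)) := by
      intro z hz1 hz2 w hzw P hP
      filter_upwards [hconv' η (η / 2 * (2 * r)) hη0 (by positivity)] with j hj
      have hsub : Ioc (z - r) (z - r + 2 * r) ∩ {x | ¬ P (u j x)} ⊆
          (Ioc (z - r) (z - r + 2 * r) \ (Ioo a b ∩ {x | v x = w})) ∪
            (Ioo a b ∩ {x | η ≤ |u j x - v x|}) := by
        rintro x ⟨hx, hxP⟩
        have hxab : x ∈ Ioo a b := ⟨by linarith [hx.1], by linarith [hx.2]⟩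
        by_cases hvx : v x = w
        · refine Or.inr ⟨hxab, ?_⟩
          have := hP _ hxP
          rw [← hvx] at this
          exact this
        · exact Or.inl ⟨hx, fun h => hvx h.2⟩
      refine (measure_mono hsub).trans ((measure_union_le _ _).trans ((add_le_add hzw hj).trans ?_))
      rw [← ENNReal.ofReal_add (by positivity) (by positivity)]
      exact ENNReal.ofReal_le_ofReal (by linarith)
    have hord : p - r + 2 * r ≤ q - r ∨ q - r + 2 * r ≤ p - r := by
      rcases lt_or_gt_of_ne hpq with h | h
      · rw [abs_of_neg (by linarith)] at hr8; left; linarith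
      · rw [abs_of_pos (by linarith)] at hr8; right; linarith
    have key := local_liminf_half_of_zones hW happ hu (a := a) (b := b) (p := p - r) (q := q - r)
      (δ := 2 * r) (η := η) (by linarith) (by linarith) (by linarith) (by linarith) hord
      (by positivity) (by linarith) hη0 hη1
      (hzone p (by linarith) (by linarith) (-1) hr1 (fun y => y ≤ -1 + η) fun y hy => by
        rw [not_le] at hy
        rw [abs_of_pos] <;> linarith)
      (hzone q (by linarith) (by linarith) 1 hr2 (fun y => 1 - η ≤ y) fun y hy => by
        rw [not_le] at hy
        rw [abs_of_neg] <;> linarith)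
    filter_upwards [key] with j hj
    refine le_trans ?_ (add_le_add hj le_rfl)
    have h5 : 0 ≤ 1 - 5 * η := by linarith
    have h6 : 0 ≤ 1 - η := by linarith
    rw [← ENNReal.ofReal_add (by positivity) hd.le, show (8 : ℝ≥0∞) = ENNReal.ofReal 8 by simp]
    refine ENNReal.ofReal_le_ofReal ?_
    have h7 : 1 - 2 * η ≤ (1 - η) ^ 2 := by nlinarith
    have h8 : 1 - 6 * η ≤ (1 - 5 * η) * (1 - η) := by nlinarith
    have h9 : (1 - 2 * η) * (1 - 6 * η) ≤ (1 - η) ^ 2 * ((1 - 5 * η) * (1 - η)) :=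
      mul_le_mul h7 h8 (by linarith) (by positivity)
    have h10 : η ≤ d / 64 := min_le_right _ _
    nlinarith [sq_nonneg η]
  · rw [rescaledProfileTension, if_neg h12.ne']
    have hfin : ∀ S : Set ℝ, volume (Ioo a b ∩ S) ≠ ⊤ := fun S =>
      ((measure_mono inter_subset_left).trans_lt (by simp)).ne
    -- Half of the smaller measure: convergence in measure can spoil at most `m` of each level set,
    -- so at least `m` remains.
    set m := min (volume (Ioo a b ∩ {x | v x = -1})).toReal
      (volume (Ioo a b ∩ {x | v x = 1})).toReal / 2 with hm
    have hm0 : 0 < m := by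
      have h1 := ENNReal.toReal_pos hA (hfin _)
      have h2 := ENNReal.toReal_pos hB (hfin _)
      positivity
    have h2m : 2 * m = min (volume (Ioo a b ∩ {x | v x = -1})).toReal
      (volume (Ioo a b ∩ {x | v x = 1})).toReal := by rw [hm]; ring
    have gen : ∀ (w : ℝ) (P : ℝ → Prop), ENNReal.ofReal (2 * m) ≤ volume (Ioo a b ∩ {x | v x = w}) →
        (∀ y, ¬ P y → 1 / 2 ≤ |y - w|) →
        ∀ᶠ j in atTop, ENNReal.ofReal m ≤ volume (Ioo a b ∩ {x | P (u j x)}) := by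
      intro w P hw hP
      filter_upwards [hconv' (1 / 2) m (by norm_num) hm0] with j hj
      refine le_of_two_mul_le hm0.le (hw.trans ((measure_mono ?_).trans (measure_union_le _ _))) hj
      rintro x ⟨hx, hxw⟩
      by_cases hPx : P (u j x)
      · exact Or.inl ⟨hx, hPx⟩
      · refine Or.inr ⟨hx, ?_⟩
        have h1 := hP _ hPx
        have h2 : v x = w := hxw
        rw [← h2] at h1
        exact h1
    refine local_liminf_of_gt hW ⟨h12, hs₀.2⟩ happ hu hab hm0
      (gen (-1) (fun y => y ≤ -1 / 2) ?_ fun y hy => ?_)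
      (gen 1 (fun y => 1 / 2 ≤ y) ?_ fun y hy => ?_) hd
    · rw [h2m]
      exact (ENNReal.ofReal_le_ofReal (min_le_left _ _)).trans ENNReal.ofReal_toReal_le
    · rw [not_le] at hy
      rw [abs_of_pos] <;> linarith
    · rw [h2m]
      exact (ENNReal.ofReal_le_ofReal (min_le_right _ _)).trans ENNReal.ofReal_toReal_le
    · rw [not_le] at hy
      rw [abs_of_neg] <;> linarith

/-! ### Positivity and finiteness of the surface tension -/

lemma surfaceTension_lt_top {W : ℝ → ℝ} (hW : IsDoubleWell W) {s : ℝ}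
    (hs : s ∈ Ioo (1 / 2 : ℝ) 1) : surfaceTension W s < ⊤ :=
  (surfaceTension_le_profileTension W s).trans_lt (profileTension_lt_top hW hs)

/-- A function going from `-1` to `1` has a unit interval on which it is positive on exactly half of
the points. -/
lemma exists_half_interval {u : ℝ → ℝ} (hu : Measurable u) (htop : Tendsto u atTop (𝓝 1))
    (hbot : Tendsto u atBot (𝓝 (-1))) :
    ∃ x, volume (Ioo x (x + 1) ∩ {y | 0 < u y}) = ENNReal.ofReal (1 / 2) ∧
      volume (Ioo x (x + 1) ∩ {y | u y ≤ 0}) = ENNReal.ofReal (1 / 2) := by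
  have hS : MeasurableSet {y | 0 < u y} := measurableSet_lt measurable_const hu
  set V : ℝ → ℝ := {y | 0 < u y}.indicator 1 with hV
  have hVm : Measurable V := measurable_one.indicator hS
  have hVb : ∀ x, |V x| ≤ 1 := fun x => by
    by_cases hx : x ∈ {y | 0 < u y}
    · rw [hV, indicator_of_mem hx]; simp
    · rw [hV, indicator_of_notMem hx]; simp
  have hbox : ∀ x, boxAverage V 1 x = volume.real (Ioc x (x + 1) ∩ {y | 0 < u y}) := fun x => by
    rw [boxAverage, intervalIntegral.integral_comp_add_left (f := V), add_zero,
      intervalIntegral.integral_of_le (by linarith), hV, integral_indicator_one hS,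
      measureReal_restrict_apply hS, inter_comm]
    norm_num
  obtain ⟨a, ha⟩ := (hbot.eventually (gt_mem_nhds (show (-1 : ℝ) < 0 by norm_num))).exists_forall_of_atBot
  obtain ⟨b, hb⟩ := (htop.eventually (lt_mem_nhds (show (0 : ℝ) < 1 by norm_num))).exists_forall_of_atTop
  have h0 : boxAverage V 1 (a - 1) = 0 := by
    rw [hbox]
    have : Ioc (a - 1) (a - 1 + 1) ∩ {y | 0 < u y} = ∅ :=
      eq_empty_iff_forall_notMem.2 fun y hy =>
        absurd (show 0 < u y from hy.2) (not_lt.2 (ha y (by linarith [hy.1.2])).le)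
    rw [this]; simp
  have h1 : boxAverage V 1 b = 1 := by
    rw [hbox]
    have : Ioc b (b + 1) ∩ {y | 0 < u y} = Ioc b (b + 1) :=
      inter_eq_left.2 fun y hy => hb y hy.1.le
    rw [this]; simp
  -- The averaged indicator is continuous, `0` far to the left and `1` far to the right, so it takes
  -- the value `1/2`.
  have hmem : (1 / 2 : ℝ) ∈ range (boxAverage V 1) :=
    mem_range_of_exists_le_of_exists_ge (continuous_boxAverage hVm hVb 1)
      ⟨a - 1, by rw [h0]; norm_num⟩ ⟨b, by rw [h1]; norm_num⟩
  obtain ⟨x, hx⟩ := hmem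
  rw [hbox] at hx
  have hae : ∀ S : Set ℝ, volume (Ioo x (x + 1) ∩ S) = volume (Ioc x (x + 1) ∩ S) := fun S =>
    measure_congr (Ioo_ae_eq_Ioc.inter (ae_eq_refl S))
  have hfin : volume (Ioc x (x + 1) ∩ {y | 0 < u y}) ≠ ⊤ :=
    ((measure_mono inter_subset_left).trans_lt (by simp)).ne
  have e1 : volume (Ioc x (x + 1) ∩ {y | 0 < u y}) = ENNReal.ofReal (1 / 2) := by
    rw [← hx, Measure.real, ENNReal.ofReal_toReal hfin]
  refine ⟨x, by rw [hae, e1], ?_⟩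
  have e2 := measure_inter_add_sdiff (μ := volume) (Ioc x (x + 1)) hS
  have e3 : Ioc x (x + 1) \ {y | 0 < u y} = Ioc x (x + 1) ∩ {y | u y ≤ 0} := by
    ext y
    exact ⟨fun h => ⟨h.1, (not_lt.1 h.2 : u y ≤ 0)⟩, fun h => ⟨h.1, (not_lt.2 h.2 : ¬ 0 < u y)⟩⟩
  rw [e1, e3, Real.volume_Ioc, add_sub_cancel_left] at e2
  rw [hae]
  refine (ENNReal.add_right_inj (ENNReal.ofReal_ne_top (r := 1 / 2))).1 ?_
  rw [e2, ← ENNReal.ofReal_add (by norm_num) (by norm_num)]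
  norm_num

/-- An interval split evenly by the sign of `u` is near neither well for `θ = 1/4`, so every
competitor pays the cost of a bad block. -/
lemma surfaceTension_pos {W : ℝ → ℝ} (hW : IsDoubleWell W) {s : ℝ} (hs : s ∈ Icc (1 / 2 : ℝ) 1) :
    0 < surfaceTension W s := by
  obtain ⟨k, hk0, hk⟩ := hW.exists_bad_cost (θ := 1 / 4) (l := 1) (by norm_num) (by norm_num) le_rfl
  refine (pos_iff_ne_zero.2 hk0).trans_le ?_
  refine le_iInf fun u => le_iInf fun hu => le_iInf fun htop => le_iInf fun hbot => ?_
  obtain ⟨x, hx1, hx2⟩ := exists_half_interval hu htop hbot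
  have hUm : Measurable fun y => trunc (u y) := continuous_trunc.measurable.comp hu
  have hlt : ENNReal.ofReal (1 / 4) < ENNReal.ofReal (1 / 2) :=
    (ENNReal.ofReal_lt_ofReal_iff (by norm_num)).2 (by norm_num)
  refine (hk s hs (fun y => trunc (u y)) hUm (fun y => abs_trunc_le _) x ?_ ?_).trans
    ((energy_trunc_le hW s _ u).trans (energy_mono_set W s (subset_univ _) u))
  · refine not_le.2 (hlt.trans_le ?_)
    rw [← hx1]
    refine measure_mono (inter_subset_inter_right _ fun y (hy : 0 < u y) => ?_)
    have : 0 < trunc (u y) := by unfold trunc; grind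
    change 1 / 4 < |trunc (u y) - (-1)|
    rw [abs_of_pos] <;> linarith
  · refine not_le.2 (hlt.trans_le ?_)
    rw [← hx2]
    refine measure_mono (inter_subset_inter_right _ fun y (hy : u y ≤ 0) => ?_)
    have : trunc (u y) ≤ 0 := by unfold trunc; grind
    change 1 / 4 < |trunc (u y) - 1|
    rw [abs_of_neg] <;> linarith

lemma rescaledTension_of_gt (W : ℝ → ℝ) {s : ℝ} (hs : 1 / 2 < s) :
    rescaledTension W s = ENNReal.ofReal (2 * s - 1) * surfaceTension W s :=
  if_neg hs.ne'

lemma rescaledTension_pos {W : ℝ → ℝ} (hW : IsDoubleWell W) {s : ℝ} (hs : s ∈ Ico (1 / 2 : ℝ) 1) :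
    0 < rescaledTension W s := by
  rcases eq_or_lt_of_le hs.1 with h | h
  · rw [rescaledTension, if_pos h.symm]; norm_num
  · rw [rescaledTension_of_gt W h]
    have h1 : 0 < 2 * s - 1 := by linarith
    exact ENNReal.mul_pos (by simpa using h1) (surfaceTension_pos hW ⟨hs.1, hs.2.le⟩).ne'

lemma rescaledTension_lt_top {W : ℝ → ℝ} (hW : IsDoubleWell W) {s : ℝ}
    (hs : s ∈ Ico (1 / 2 : ℝ) 1) : rescaledTension W s < ⊤ := by
  rcases eq_or_lt_of_le hs.1 with h | h
  · rw [rescaledTension, if_pos h.symm]; simp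
  · rw [rescaledTension_of_gt W h]
    exact ENNReal.mul_lt_top ENNReal.ofReal_lt_top (surfaceTension_lt_top hW ⟨h, hs.2⟩)

/-! ### Lower semicontinuity of the rescaled tension, by blow-down -/

lemma exists_competitor {W : ℝ → ℝ} {s : ℝ} {c : ℝ≥0∞} (h : surfaceTension W s < c) :
    ∃ u : ℝ → ℝ, Measurable u ∧ Tendsto u atTop (𝓝 1) ∧ Tendsto u atBot (𝓝 (-1)) ∧
      energy W s univ u < c := by
  unfold surfaceTension at h
  simp only [iInf_lt_iff] at h
  obtain ⟨u, hu, h1, h2, h3⟩ := h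
  exact ⟨u, hu, h1, h2, h3⟩

lemma tendsto_scaling_of_gt {s : ℝ} (hs : 1 / 2 < s) :
    Tendsto (fun ε => scaling ε s) (𝓝[>] 0) (𝓝 (2 * s - 1)) := by
  simp only [scaling_of_gt hs]
  have h1 : Tendsto (fun ε : ℝ => ε ^ (2 * s - 1)) (𝓝[>] 0) (𝓝 0) := by
    have := (Real.continuousAt_rpow_const 0 (2 * s - 1) (Or.inr (by linarith))).tendsto
    rw [Real.zero_rpow (by linarith)] at this
    exact this.mono_left nhdsWithin_le_nhds
  have h2 := (tendsto_const_nhds (x := 2 * s - 1)).div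
    ((tendsto_const_nhds (x := (1 : ℝ))).sub h1) (by norm_num)
  rw [sub_zero, div_one] at h2
  exact h2

/-- The sign function with value `1` at `0`. -/
def stepSign (x : ℝ) : ℝ := if x < 0 then -1 else 1

lemma measurable_stepSign : Measurable stepSign :=
  Measurable.ite measurableSet_Iio measurable_const measurable_const

/-- For a fixed competitor, `u (x / ε)` approaches the step function because the transition region
shrinks with `ε`, and the scaling factor tends to `2s - 1`. Both errors can thus be made small at
one scale. -/
lemma exists_blowdown_scale {u : ℝ → ℝ} (htop : Tendsto u atTop (𝓝 1))
    (hbot : Tendsto u atBot (𝓝 (-1))) {s : ℝ} (hs : 1 / 2 < s) {E : ℝ} {r d : ℝ}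
    (hr : 0 < r) (hd : 0 < d) :
    ∃ ε ∈ Ioo (0 : ℝ) r, scaling ε s * E ≤ (2 * s - 1) * E + d ∧
      volume (Ioo (-1) 1 ∩ {x | r ≤ |u (x / ε) - stepSign x|}) ≤ ENNReal.ofReal r := by
  obtain ⟨a, ha⟩ := (hbot.eventually (Metric.ball_mem_nhds _ hr)).exists_forall_of_atBot
  obtain ⟨b, hb⟩ := (htop.eventually (Metric.ball_mem_nhds _ hr)).exists_forall_of_atTop
  set R := max |a| |b| + 1 with hR
  have hR0 : 0 < R := by positivity
  have haR : -R ≤ a := by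
    have := le_max_left |a| |b|
    have := neg_abs_le a
    linarith
  have hbR : b ≤ R := by
    have := le_max_right |a| |b|
    have := le_abs_self b
    linarith
  have hlt : ∀ {q : ℝ}, 0 < q → ∀ᶠ ε in 𝓝[>] (0 : ℝ), ε < q := fun hq =>
    mem_nhdsWithin_of_mem_nhds (gt_mem_nhds hq)
  have hpos : ∀ᶠ ε in 𝓝[>] (0 : ℝ), 0 < ε := self_mem_nhdsWithin
  obtain ⟨ε, hε1, hε2, hε3, hε0⟩ := ((((tendsto_scaling_of_gt hs).mul_const E).eventually
    (gt_mem_nhds (show (2 * s - 1) * E < (2 * s - 1) * E + d by linarith))).and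
    ((hlt hr).and ((hlt (show 0 < r / (2 * R) by positivity)).and hpos))).exists
  refine ⟨ε, ⟨hε0, hε2⟩, hε1.le, ?_⟩
  have hsub : Ioo (-1) 1 ∩ {x | r ≤ |u (x / ε) - stepSign x|} ⊆ Ioo (-(ε * R)) (ε * R) := by
    rintro x ⟨-, hx⟩
    have hx : r ≤ |u (x / ε) - stepSign x| := hx
    by_contra hcon
    rw [mem_Ioo, not_and_or, not_lt, not_lt] at hcon
    rcases hcon with h | h
    · have h2 : x / ε ≤ -R := by rw [div_le_iff₀ hε0]; linarith
      have h3 := ha (x / ε) (h2.trans haR)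
      rw [Real.dist_eq] at h3
      have h4 : x < 0 := lt_of_le_of_lt h (by have := mul_pos hε0 hR0; linarith)
      rw [stepSign, if_pos h4] at hx
      linarith
    · have h2 : R ≤ x / ε := by rw [le_div_iff₀ hε0]; linarith
      have h3 := hb (x / ε) (hbR.trans h2)
      rw [Real.dist_eq] at h3
      have h4 : ¬ x < 0 := not_lt.2 (le_trans (by positivity) h)
      rw [stepSign, if_neg h4] at hx
      linarith
  refine (measure_mono hsub).trans ?_
  rw [Real.volume_Ioo]
  refine ENNReal.ofReal_le_ofReal ?_
  have : ε * (2 * R) < r := by rwa [lt_div_iff₀ (by positivity)] at hε3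
  linarith

/-- If it failed along `s j → s₀`, almost optimal competitors for `m_{s j}` could be blown down with
`ε j → 0` fast enough to converge to the step function at no extra cost, and `local_liminf` on
`(-1,1)` would give a contradiction. The endpoint `s₀ = 1/2` is included, which supplies the lower
bound `8` in the limit of `(2s-1) m_s`. -/
lemma eventually_rescaledProfileTension_le {W : ℝ → ℝ} (hW : IsDoubleWell W) {s₀ : ℝ}
    (hs₀ : s₀ ∈ Ico (1 / 2 : ℝ) 1) {d : ℝ} (hd : 0 < d) :
    ∀ᶠ s in 𝓝[Ioo (1 / 2) 1] s₀,
      rescaledProfileTension W s₀ ≤ rescaledTension W s + ENNReal.ofReal d := by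
  by_contra hcon
  have hfreq : ∃ᶠ s in 𝓝[Ioo (1 / 2) 1] s₀, s ∈ Ioo (1 / 2 : ℝ) 1 ∧
      ¬ rescaledProfileTension W s₀ ≤ rescaledTension W s + ENNReal.ofReal d :=
    (not_eventually.1 hcon).and_eventually self_mem_nhdsWithin |>.mono fun s hs => ⟨hs.2, hs.1⟩
  obtain ⟨s, hs, hsP⟩ := exists_seq_forall_of_frequently hfreq
  have hs1 : ∀ j, s j ∈ Ioo (1 / 2 : ℝ) 1 := fun j => (hsP j).1
  have hd3 : 0 < d / 3 := by positivity
  have hcomp : ∀ j, ∃ u : ℝ → ℝ, Measurable u ∧ Tendsto u atTop (𝓝 1) ∧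
      Tendsto u atBot (𝓝 (-1)) ∧
      energy W (s j) univ u < surfaceTension W (s j) + ENNReal.ofReal (d / 3) := fun j =>
    exists_competitor (ENNReal.lt_add_right (surfaceTension_lt_top hW (hs1 j)).ne
      (by simpa using hd))
  choose u hu htop hbot hE using hcomp
  have hEfin : ∀ j, energy W (s j) univ (u j) ≠ ⊤ := fun j => ((hE j).trans_le le_top).ne
  have hscale := fun j : ℕ => exists_blowdown_scale (htop j) (hbot j) (hs1 j).1
    (E := (energy W (s j) univ (u j)).toReal)
    (r := 1 / ((j : ℝ) + 1)) (d := d / 3) (by positivity) hd3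
  choose ε hε hεE hεv using hscale
  have hlim0 : Tendsto (fun j : ℕ => 1 / ((j : ℝ) + 1)) atTop (𝓝 0) :=
    tendsto_one_div_add_atTop_nhds_zero_nat
  have happ : Approaches s ε s₀ := by
    refine ⟨fun j => ⟨(hs1 j).1.le, (hs1 j).2⟩, fun j => (hε j).1, hs.mono_right nhdsWithin_le_nhds,
      ?_⟩
    exact squeeze_zero (fun j => (hε j).1.le) (fun j => (hε j).2.le) hlim0
  have hconv : ∀ η : ℝ, 0 < η → Tendsto (fun j =>
      volume (Ioo (-1) 1 ∩ {x | η ≤ |u j (x / ε j) - stepSign x|})) atTop (𝓝 0) := by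
    intro η hη
    have h1 : Tendsto (fun j : ℕ => ENNReal.ofReal (1 / ((j : ℝ) + 1))) atTop (𝓝 0) := by
      have := ENNReal.tendsto_ofReal hlim0
      rwa [ENNReal.ofReal_zero] at this
    refine tendsto_of_tendsto_of_tendsto_of_le_of_le' tendsto_const_nhds h1
      (Eventually.of_forall fun _ => bot_le) ?_
    filter_upwards [hlim0.eventually (gt_mem_nhds hη)] with j hj
    refine le_trans (measure_mono (inter_subset_inter_right _ fun x hx => ?_)) (hεv j)
    exact hj.le.trans hx
  have hneg : Ioo (-1 : ℝ) 0 ⊆ Ioo (-1) 1 ∩ {x | stepSign x = -1} := fun x hx =>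
    ⟨⟨hx.1, by linarith [hx.2]⟩, if_pos hx.2⟩
  have hpos : Ioo (0 : ℝ) 1 ⊆ Ioo (-1) 1 ∩ {x | stepSign x = 1} := fun x hx =>
    ⟨⟨by linarith [hx.1], hx.2⟩, if_neg (not_lt.2 hx.1.le)⟩
  have key := local_liminf hW hs₀ happ (u := fun j x => u j (x / ε j))
    (fun j => (hu j).comp (measurable_id.div_const _)) measurable_stepSign
    (a := -1) (b := 1) (by norm_num) hconv
    (fun h => by have := measure_mono_null hneg h; simp at this)
    (fun h => by have := measure_mono_null hpos h; simp at this) hd3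
  obtain ⟨j, hj1, hj2⟩ := (key.and (happ.eventually_mem one_pos)).exists
  refine (hsP j).2 (hj1.trans ?_)
  have hsc := le_scaling hj2 (hs1 j).1
  have ht0 : 0 < 2 * s j - 1 := by linarith [(hs1 j).1]
  have ht1 : 2 * s j - 1 ≤ 1 := by linarith [(hs1 j).2]
  have hloc : localEnergy W (ε j) (s j) (Ioo (-1) 1) (fun x => u j (x / ε j)) ≤
      ENNReal.ofReal (scaling (ε j) (s j)) * energy W (s j) univ (u j) := by
    rw [localEnergy, scaled_energy_affine W (s j) measurableSet_Ioo _ 0 (hε j).1]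
    refine mul_le_mul_right ((energy_mono_set W _ (subset_univ _) _).trans (le_of_eq ?_)) _
    congr 1
    funext z
    rw [zero_add, mul_div_cancel_left₀ _ (hε j).1.ne']
  rw [rescaledTension_of_gt W (hs1 j).1]
  calc _ ≤ ENNReal.ofReal (scaling (ε j) (s j)) * energy W (s j) univ (u j)
        + ENNReal.ofReal (d / 3) := add_le_add hloc le_rfl
    _ ≤ ENNReal.ofReal (2 * s j - 1) * energy W (s j) univ (u j) + ENNReal.ofReal (d / 3) +
        ENNReal.ofReal (d / 3) := by
        refine add_le_add ?_ le_rfl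
        rw [← ENNReal.ofReal_toReal (hEfin j), ← ENNReal.ofReal_mul (ht0.le.trans hsc),
          ← ENNReal.ofReal_mul ht0.le, ← ENNReal.ofReal_add (by positivity) hd3.le]
        exact ENNReal.ofReal_le_ofReal (hεE j)
    _ ≤ ENNReal.ofReal (2 * s j - 1) * surfaceTension W (s j) + ENNReal.ofReal (d / 3) +
        ENNReal.ofReal (d / 3) + ENNReal.ofReal (d / 3) := by
        refine add_le_add (add_le_add ((mul_le_mul_right (hE j).le _).trans ?_) le_rfl) le_rfl
        rw [mul_add]
        refine add_le_add le_rfl (mul_le_of_le_one_left' ?_)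
        rw [← ENNReal.ofReal_one]
        exact ENNReal.ofReal_le_ofReal ht1
    _ = _ := by
        rw [add_assoc, add_assoc, ← ENNReal.ofReal_add hd3.le hd3.le,
          ← ENNReal.ofReal_add hd3.le (by positivity)]
        congr 2; ring

/-- For `s > 1/2` the preceding neighbourhood estimate holds in particular at the point itself, and
this gives the inequality that is not evident from the definitions. -/
lemma rescaledProfileTension_eq {W : ℝ → ℝ} (hW : IsDoubleWell W) {s : ℝ}
    (hs : s ∈ Ico (1 / 2 : ℝ) 1) : rescaledProfileTension W s = rescaledTension W s := by
  rcases eq_or_lt_of_le hs.1 with h | h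
  · rw [rescaledTension, rescaledProfileTension, if_pos h.symm, if_pos h.symm]
  refine le_antisymm ?_ ?_
  · refine ENNReal.le_of_forall_pos_le_add fun d hd _ => ?_
    have := eventually_rescaledProfileTension_le hW hs (d := d) (by exact_mod_cast hd)
    rw [nhdsWithin_eq_nhds.2 (Ioo_mem_nhds h hs.2)] at this
    simpa using this.self_of_nhds
  · rw [rescaledTension_of_gt W h, rescaledProfileTension, if_neg h.ne']
    exact mul_le_mul_right (surfaceTension_le_profileTension W s) _

/-! ### The linear profile near the critical exponent -/

/-- A slice is at most `4(2+h)` for `h > 1`, so times the kernel it contributes `4h^{-2s}` plus an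
integrable rest, and evenness doubles this to `8`. The bound `s ≤ 3/4` makes the part `h ≤ 1`
uniform. `S` contains the distances above `1` realized in `E`: everything for the line, a bounded
range for an interval. -/
lemma gagliardoSq_trunc_le {s : ℝ} (hs : s ∈ Icc (1 / 2 : ℝ) (3 / 4)) {E S : Set ℝ}
    (hE : MeasurableSet E) (hS : MeasurableSet S)
    (hES : ∀ h, h ∉ S → ∀ x, 1 < h → x ∈ E → x + h ∉ E) :
    gagliardoSq s E trunc ≤ ENNReal.ofReal 64 +
      8 * ∫⁻ h in Ioi 1 ∩ S, ENNReal.ofReal (h ^ (-2 * s)) := by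
  have hstep := isProfile_trunc.step
  rw [gagliardoSq_slice continuous_trunc.measurable s hE, lintegral_eq_of_even]
  swap
  · intro h
    rw [fracKernel_neg]
    congr 1
    rw [← lintegral_add_right_eq_self _ h]
    refine lintegral_congr fun x => ?_
    rw [add_neg_cancel_right, sqDist_comm]; ring
  set G : ℝ → ℝ≥0∞ := fun h => fracKernel s h *
      ∫⁻ x, E.indicator 1 x * (E.indicator 1 (x + h) * sqDist (trunc x) (trunc (x + h))) with hG
  have hG1 : ∀ h, G h ≤ fracKernel s h * (4 * stepWeight 1 h) := by
    intro h
    refine mul_le_mul_right ?_ _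
    have h4 : ENNReal.ofReal (2 ^ 2) = 4 := by norm_num
    rw [← h4]
    refine le_trans (lintegral_mono fun x => ?_) (hstep.lintegral_sqDist_le h)
    rw [← mul_assoc]
    refine mul_le_of_le_one_left' (mul_le_one' ?_ ?_)
    · exact indicator_le_self' (fun _ _ => zero_le) _
    · exact indicator_le_self' (fun _ _ => zero_le) _
  have hG0 : ∀ h ∈ Ioi (1 : ℝ), h ∉ S → G h = 0 := by
    intro h hh hS
    have : ∀ x, E.indicator (1 : ℝ → ℝ≥0∞) x *
        (E.indicator 1 (x + h) * sqDist (trunc x) (trunc (x + h))) = 0 := by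
      intro x
      by_cases hx : x ∈ E
      · rw [indicator_of_notMem (hES h hS x hh hx), zero_mul, mul_zero]
      · rw [indicator_of_notMem hx, zero_mul]
    simp only [hG, this, lintegral_zero, mul_zero]
  have hI1 : ∫⁻ h in Ioc (0 : ℝ) 1, G h ≤ ENNReal.ofReal 24 := by
    calc _ ≤ ∫⁻ h in Ioc (0 : ℝ) 1, ENNReal.ofReal 12 * ENNReal.ofReal (h ^ (-(1 / 2) : ℝ)) := by
          refine setLIntegral_mono' measurableSet_Ioc fun h hh => (hG1 h).trans ?_
          have hh0 := hh.1
          rw [fracKernel_of_pos hh0, stepWeight, abs_of_pos hh0,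
            show (4 : ℝ≥0∞) = ENNReal.ofReal 4 by simp, ← ENNReal.ofReal_mul (by norm_num),
            ← ENNReal.ofReal_mul (by positivity), ← ENNReal.ofReal_mul (by norm_num)]
          refine ENNReal.ofReal_le_ofReal ?_
          have e1 : h ^ (-1 - 2 * s) * h ^ 2 ≤ h ^ (-(1 / 2) : ℝ) := by
            rw [← Real.rpow_natCast h 2, ← Real.rpow_add hh0]
            exact Real.rpow_le_rpow_of_exponent_ge hh0 hh.2 (by push_cast; linarith [hs.2])
          have e2 : min 1 (h ^ 2) * (2 * 1 + h) ≤ h ^ 2 * 3 :=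
            mul_le_mul (min_le_right _ _) (by linarith [hh.2]) (by positivity) (by positivity)
          have e3 : 0 < h ^ (-1 - 2 * s) := Real.rpow_pos_of_pos hh0 _
          nlinarith
      _ = ENNReal.ofReal 24 := by
          rw [lintegral_const_mul' _ _ ENNReal.ofReal_ne_top,
            lintegral_Ioc_zero_one_rpow (by norm_num), ← ENNReal.ofReal_mul (by norm_num)]
          norm_num
  have hI2 : ∫⁻ h in Ioi (1 : ℝ), G h ≤ ENNReal.ofReal 8 +
      4 * ∫⁻ h in Ioi 1 ∩ S, ENNReal.ofReal (h ^ (-2 * s)) := by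
    have e0 : ∫⁻ h in Ioi (1 : ℝ), G h = ∫⁻ h in Ioi (1 : ℝ) ∩ S, G h := by
      rw [← lintegral_inter_add_sdiff G (Ioi 1) hS,
        setLIntegral_congr_fun (g := fun _ => 0) (measurableSet_Ioi.diff hS)
          (fun h hh => hG0 h hh.1 hh.2), lintegral_zero, add_zero]
    have e1 : ∀ h ∈ Ioi (1 : ℝ) ∩ S, G h ≤ ENNReal.ofReal 8 * ENNReal.ofReal (h ^ (-2 : ℝ)) +
        4 * ENNReal.ofReal (h ^ (-2 * s)) := by
      intro h hh
      have hh1 : (1 : ℝ) < h := hh.1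
      have hh0 : 0 < h := by linarith
      refine (hG1 h).trans ?_
      rw [fracKernel_of_pos hh0, stepWeight, abs_of_pos hh0,
        show (4 : ℝ≥0∞) = ENNReal.ofReal 4 by simp, ← ENNReal.ofReal_mul (by norm_num),
        ← ENNReal.ofReal_mul (by positivity), ← ENNReal.ofReal_mul (by norm_num),
        ← ENNReal.ofReal_mul (by norm_num), ← ENNReal.ofReal_add (by positivity) (by positivity)]
      refine ENNReal.ofReal_le_ofReal ?_
      have e1 : h ^ (-2 * s) = h ^ (-1 - 2 * s) * h := by
        rw [← Real.rpow_add_one hh0.ne']; congr 1; ring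
      have e2 : h ^ (-1 - 2 * s) ≤ h ^ (-2 : ℝ) :=
        Real.rpow_le_rpow_of_exponent_le hh1.le (by linarith [hs.1])
      have e3 : 0 < h ^ (-1 - 2 * s) := Real.rpow_pos_of_pos hh0 _
      have e4 : min 1 (h ^ 2) ≤ 1 := min_le_left _ _
      have e5 : min 1 (h ^ 2) * (2 * 1 + h) ≤ 2 + h := by nlinarith
      rw [e1]
      nlinarith
    rw [e0]
    refine (setLIntegral_mono' (measurableSet_Ioi.inter hS) e1).trans ?_
    have hm : Measurable fun h : ℝ => ENNReal.ofReal 8 * ENNReal.ofReal (h ^ (-2 : ℝ)) :=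
      ((measurable_id.pow_const (-2 : ℝ)).ennreal_ofReal).const_mul _
    rw [lintegral_add_left hm, lintegral_const_mul' _ _ ENNReal.ofReal_ne_top,
      lintegral_const_mul' _ _ (by simp)]
    refine add_le_add ?_ le_rfl
    calc _ ≤ ENNReal.ofReal 8 * ∫⁻ h in Ioi (1 : ℝ), ENNReal.ofReal (h ^ (-2 : ℝ)) :=
          mul_le_mul_right (lintegral_mono_set inter_subset_left) _
      _ = ENNReal.ofReal 8 := by
          rw [lintegral_Ioi_rpow one_pos (by norm_num), ← ENNReal.ofReal_mul (by norm_num)]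
          norm_num
  rw [← Ioc_union_Ioi_eq_Ioi (zero_le_one (α := ℝ)),
    lintegral_union measurableSet_Ioi (Ioc_disjoint_Ioi le_rfl)]
  refine (mul_le_mul_right (add_le_add hI1 hI2) 2).trans (le_of_eq ?_)
  rw [show ENNReal.ofReal 64 = 2 * (ENNReal.ofReal 24 + ENNReal.ofReal 8) by
    rw [← ENNReal.ofReal_add (by norm_num) (by norm_num), show (2 : ℝ≥0∞) = ENNReal.ofReal 2 by simp,
      ← ENNReal.ofReal_mul (by norm_num)]; norm_num]
  rw [← add_assoc, mul_add, ← mul_assoc]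
  norm_num

/-! ### Upper semicontinuity and continuity of the rescaled tension -/

lemma IsProfile.energy_le_add {W : ℝ → ℝ} {u : ℝ → ℝ} {R D : ℝ} (hu : IsProfile u R D) (s s' : ℝ) :
    energy W s' univ u ≤ energy W s univ u +
      ENNReal.ofReal (D ^ 2) * ∫⁻ h, stepWeight R h * (fracKernel s' h - fracKernel s h) := by
  rw [energy, energy, add_assoc]
  exact add_le_add le_rfl (hu.step.gagliardoSq_le s s')

lemma IsProfile.tendsto_excess {u : ℝ → ℝ} {R D : ℝ} (hu : IsProfile u R D) {s₀ : ℝ}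
    (hs₀ : s₀ ∈ Ioo (1 / 2 : ℝ) 1) :
    Tendsto (fun s => ENNReal.ofReal (D ^ 2) *
      ∫⁻ h, stepWeight R h * (fracKernel s h - fracKernel s₀ h)) (𝓝 s₀) (𝓝 0) := by
  have := ENNReal.Tendsto.const_mul (a := ENNReal.ofReal (D ^ 2))
    (tendsto_kernel_excess hs₀ hu.step.R_pos.le) (Or.inr ENNReal.ofReal_ne_top)
  rwa [mul_zero] at this

lemma exists_profile_lt {W : ℝ → ℝ} {s : ℝ} {c : ℝ≥0∞} (h : profileTension W s < c) :
    ∃ u R D, IsProfile u R D ∧ energy W s univ u < c := by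
  unfold profileTension at h
  simp only [iInf_lt_iff] at h
  obtain ⟨u, R, D, h1, h2⟩ := h
  exact ⟨u, R, D, h1, h2⟩

/-- Profiles that are almost optimal at `s₀` have almost optimal energy at nearby exponents. -/
lemma exists_profile_upper {W : ℝ → ℝ} (hW : IsDoubleWell W) {s₀ : ℝ}
    (hs₀ : s₀ ∈ Ioo (1 / 2 : ℝ) 1) {d : ℝ≥0∞} (hd : d ≠ 0) :
    ∃ u R D, IsProfile u R D ∧
      ∀ᶠ s in 𝓝 s₀, energy W s univ u ≤ profileTension W s₀ + d := by
  have hd2 : d / 2 ≠ 0 := by simpa using hd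
  obtain ⟨u, R, D, hu, hE⟩ := exists_profile_lt (ENNReal.lt_add_right
    (profileTension_lt_top hW hs₀).ne hd2)
  refine ⟨u, R, D, hu, ?_⟩
  filter_upwards [(hu.tendsto_excess hs₀).eventually (eventually_le_nhds (pos_iff_ne_zero.2 hd2))]
    with s hs
  refine (hu.energy_le_add s₀ s).trans ((add_le_add hE.le hs).trans ?_)
  rw [add_assoc, ENNReal.add_halves]

/-- At `s₀ = 1/2` the linear profile has seminorm at most `8/(2s-1)` plus a constant, and
multiplying by `2s - 1` leaves `8`. For `s₀ > 1/2` an almost optimal Lipschitz profile at `s₀` stays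
almost optimal nearby. -/
lemma eventually_rescaledTension_le {W : ℝ → ℝ} (hW : IsDoubleWell W) {s₀ : ℝ}
    (hs₀ : s₀ ∈ Ico (1 / 2 : ℝ) 1) {d : ℝ} (hd : 0 < d) :
    ∀ᶠ s in 𝓝[Ioo (1 / 2) 1] s₀,
      rescaledTension W s ≤ rescaledTension W s₀ + ENNReal.ofReal d := by
  rcases eq_or_lt_of_le hs₀.1 with h | h
  · subst h
    have hP := hW.potentialEnergy_lt_top isProfile_trunc.left isProfile_trunc.right
      isProfile_trunc.bound
    set P := potentialEnergy W univ trunc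
    have hlim : Tendsto (fun s : ℝ => ENNReal.ofReal (2 * s - 1) * (P + ENNReal.ofReal 64))
        (𝓝 (1 / 2)) (𝓝 0) := by
      have h1 : Tendsto (fun s : ℝ => ENNReal.ofReal (2 * s - 1)) (𝓝 (1 / 2)) (𝓝 0) := by
        have hc : Continuous fun s : ℝ => 2 * s - 1 := by fun_prop
        have := ENNReal.tendsto_ofReal (hc.tendsto (1 / 2))
        simpa using this
      have := ENNReal.Tendsto.mul_const (b := P + ENNReal.ofReal 64) h1
        (Or.inr (ENNReal.add_lt_top.2 ⟨hP, ENNReal.ofReal_lt_top⟩).ne)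
      rwa [zero_mul] at this
    filter_upwards [self_mem_nhdsWithin,
      nhdsWithin_le_nhds (hlim.eventually (eventually_le_nhds
        (show (0 : ℝ≥0∞) < ENNReal.ofReal d by simpa using hd))),
      nhdsWithin_le_nhds (gt_mem_nhds (show (1 / 2 : ℝ) < 3 / 4 by norm_num))] with s hs h1 h2
    have ht : 0 < 2 * s - 1 := by linarith [hs.1]
    rw [rescaledTension_of_gt W hs.1, rescaledTension, if_pos rfl]
    have h3 := gagliardoSq_trunc_le (s := s) ⟨hs.1.le, le_of_lt h2⟩ (E := univ) (S := univ)
      MeasurableSet.univ MeasurableSet.univ (fun h hh => absurd (mem_univ _) hh)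
    rw [inter_univ, lintegral_Ioi_rpow one_pos (by linarith)] at h3
    calc _ ≤ ENNReal.ofReal (2 * s - 1) * (P + (ENNReal.ofReal 64 +
          8 * ENNReal.ofReal (-1 ^ (-2 * s + 1) / (-2 * s + 1)))) :=
          mul_le_mul_right ((surfaceTension_le_energy isProfile_trunc).trans
            (add_le_add le_rfl h3)) _
      _ = ENNReal.ofReal (2 * s - 1) * (P + ENNReal.ofReal 64) + 8 *
          (ENNReal.ofReal (2 * s - 1) * ENNReal.ofReal (-1 ^ (-2 * s + 1) / (-2 * s + 1))) := by ring
      _ ≤ ENNReal.ofReal d + 8 * 1 := by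
          refine add_le_add h1 (mul_le_mul_right (le_of_eq ?_) 8)
          rw [← ENNReal.ofReal_mul ht.le, Real.one_rpow, ← ENNReal.ofReal_one]
          congr 1
          rw [mul_div_assoc', div_eq_one_iff_eq (by linarith)]; ring
      _ = _ := by rw [mul_one, add_comm]
  · have hs₀' : s₀ ∈ Ioo (1 / 2 : ℝ) 1 := ⟨h, hs₀.2⟩
    have hd2 : 0 < d / 2 := by positivity
    obtain ⟨u, R, D, hu, hE⟩ := exists_profile_upper hW hs₀' (d := ENNReal.ofReal (d / 2))
      (by simpa using hd)
    have hPt := (profileTension_lt_top hW hs₀').ne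
    have hlim : Tendsto (fun s : ℝ => ENNReal.ofReal (2 * s - 1) * profileTension W s₀) (𝓝 s₀)
        (𝓝 (ENNReal.ofReal (2 * s₀ - 1) * profileTension W s₀)) := by
      refine ENNReal.Tendsto.mul_const (ENNReal.tendsto_ofReal ?_) (Or.inr hPt)
      have hc : Continuous fun s : ℝ => 2 * s - 1 := by fun_prop
      exact hc.tendsto s₀
    have hlt := hlim.eventually (gt_mem_nhds (ENNReal.lt_add_right (b := ENNReal.ofReal (d / 2))
      (ENNReal.mul_ne_top ENNReal.ofReal_ne_top hPt) (by simpa using hd)))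
    filter_upwards [self_mem_nhdsWithin, nhdsWithin_le_nhds hE, nhdsWithin_le_nhds hlt]
      with s hs h1 h2
    rw [← rescaledProfileTension_eq hW hs₀, rescaledProfileTension, if_neg h.ne',
      rescaledTension_of_gt W hs.1]
    calc _ ≤ ENNReal.ofReal (2 * s - 1) * (profileTension W s₀ + ENNReal.ofReal (d / 2)) :=
          mul_le_mul_right ((surfaceTension_le_energy hu).trans h1) _
      _ ≤ (ENNReal.ofReal (2 * s₀ - 1) * profileTension W s₀ + ENNReal.ofReal (d / 2)) +
          ENNReal.ofReal (d / 2) := by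
          rw [mul_add]
          refine add_le_add h2.le (mul_le_of_le_one_left' ?_)
          rw [← ENNReal.ofReal_one]
          exact ENNReal.ofReal_le_ofReal (by linarith [hs.2])
      _ = _ := by
          rw [add_assoc, ← ENNReal.ofReal_add hd2.le hd2.le, add_halves]

lemma continuousOn_rescaledTension {W : ℝ → ℝ} (hW : IsDoubleWell W) :
    ContinuousOn (rescaledTension W) (Ico (1 / 2 : ℝ) 1) := by
  intro s₀ hs₀
  refine (ENNReal.tendsto_nhds (rescaledTension_lt_top hW hs₀).ne).2 fun d hd => ?_
  wlog hdt : d ≠ ⊤ generalizing d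
  · rw [not_ne_iff.1 hdt]
    exact Eventually.of_forall fun s => ⟨by simp, by simp⟩
  obtain ⟨d', hd', rfl⟩ : ∃ d' : ℝ, 0 < d' ∧ d = ENNReal.ofReal d' :=
    ⟨d.toReal, ENNReal.toReal_pos hd.ne' hdt, (ENNReal.ofReal_toReal hdt).symm⟩
  have h1 := eventually_rescaledProfileTension_le hW hs₀ hd'
  have h2 := eventually_rescaledTension_le hW hs₀ hd'
  rw [rescaledProfileTension_eq hW hs₀] at h1
  rw [eventually_nhdsWithin_iff] at h1 h2 ⊢
  -- The one-sided estimates only concern `s > 1/2`. The value `s = 1/2` is met near `s₀` only if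
  -- `s₀ = 1/2`, and then the two tensions are the same number.
  have h3 : ∀ᶠ s in 𝓝 s₀, s = 1 / 2 → s₀ = 1 / 2 := by
    rcases eq_or_lt_of_le hs₀.1 with h | h
    · exact Eventually.of_forall fun _ _ => h.symm
    · filter_upwards [lt_mem_nhds h] with s hs h4
      exact absurd h4.symm (ne_of_lt hs)
  filter_upwards [h1, h2, h3] with s hs1 hs2 hs3 hs
  rcases eq_or_lt_of_le hs.1 with h | h
  · have e : s₀ = s := by rw [hs3 h.symm, ← h]
    rw [e]
    exact ⟨tsub_le_self, le_add_right le_rfl⟩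
  · exact ⟨tsub_le_iff_right.2 (hs1 ⟨h, hs.2⟩), hs2 ⟨h, hs.2⟩⟩

/-! ### The essential jump set of a sign function -/

/-- The open set of points near which `v = z` almost everywhere. -/
def essRegion (v : ℝ → ℝ) (z : ℝ) : Set ℝ :=
  {t | ∃ a b, t ∈ Ioo a b ∧ volume (Ioo a b ∩ {x | v x ≠ z}) = 0}

/-- The points of `(0,1)` near which `v` takes both values `1` and `-1` on sets of positive
measure. -/
def essJump (v : ℝ → ℝ) : Set ℝ :=
  {t | t ∈ Ioo (0 : ℝ) 1 ∧ ∀ a b, t ∈ Ioo a b →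
    volume (Ioo a b ∩ {x | v x = 1}) ≠ 0 ∧ volume (Ioo a b ∩ {x | v x = -1}) ≠ 0}

/-- `v` takes only the values `1` and `-1` on `(0,1)`, up to a null set. -/
def IsSign (v : ℝ → ℝ) : Prop :=
  ∀ᵐ x ∂(volume : Measure ℝ).restrict (Ioo 0 1), v x = 1 ∨ v x = -1

lemma IsSign.measure_eq_zero {v : ℝ → ℝ} (hv : IsSign v) :
    volume (Ioo 0 1 ∩ {x | ¬ (v x = 1 ∨ v x = -1)}) = 0 := by
  have := (ae_restrict_iff' measurableSet_Ioo).1 hv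
  rw [ae_iff] at this
  convert this using 2
  ext x
  simp only [mem_inter_iff, mem_ofPred_eq, Classical.not_imp]

lemma isOpen_essRegion (v : ℝ → ℝ) (z : ℝ) : IsOpen (essRegion v z) := by
  rw [isOpen_iff_mem_nhds]
  rintro t ⟨a, b, ht, h⟩
  exact mem_of_superset (isOpen_Ioo.mem_nhds ht) fun x hx => ⟨a, b, hx, h⟩

lemma measure_essRegion (v : ℝ → ℝ) (z : ℝ) : volume (essRegion v z ∩ {x | v x ≠ z}) = 0 := by
  refine measure_null_of_locally_null _ fun x hx => ?_
  obtain ⟨a, b, ht, h⟩ := hx.1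
  exact ⟨Ioo a b ∩ (essRegion v z ∩ {x | v x ≠ z}),
    inter_mem (mem_nhdsWithin_of_mem_nhds (isOpen_Ioo.mem_nhds ht)) self_mem_nhdsWithin,
    measure_mono_null (inter_subset_inter_right _ inter_subset_right) h⟩

/-- The intersection is open, and it is null because `v` would have to equal both `z` and `z'`
almost everywhere on it. -/
lemma disjoint_essRegion (v : ℝ → ℝ) {z z' : ℝ} (hz : z ≠ z') :
    Disjoint (essRegion v z) (essRegion v z') := by
  rw [Set.disjoint_iff_inter_eq_empty]
  refine ((isOpen_essRegion v z).inter (isOpen_essRegion v z')).eq_empty_of_measure_zero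
    (μ := volume) ?_
  refine measure_mono_null ?_ (measure_union_null (measure_essRegion v z) (measure_essRegion v z'))
  rintro x ⟨h1, h2⟩
  by_cases h : v x = z
  · exact Or.inr ⟨h2, fun h3 => hz (h.symm.trans h3)⟩
  · exact Or.inl ⟨h1, h⟩

lemma IsSign.mem_essRegion {v : ℝ → ℝ} (hv : IsSign v) {t : ℝ} (ht : t ∈ Ioo (0 : ℝ) 1)
    (h : t ∉ essJump v) : t ∈ essRegion v 1 ∪ essRegion v (-1) := by
  have h : ¬ (t ∈ Ioo (0 : ℝ) 1 ∧ ∀ a b, t ∈ Ioo a b →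
    volume (Ioo a b ∩ {x | v x = 1}) ≠ 0 ∧ volume (Ioo a b ∩ {x | v x = -1}) ≠ 0) := h
  push Not at h
  obtain ⟨a, b, hab, h⟩ := h ht
  have hm : t ∈ Ioo (max a 0) (min b 1) := ⟨max_lt hab.1 ht.1, lt_min hab.2 ht.2⟩
  have hs1 : Ioo (max a 0) (min b 1) ⊆ Ioo a b := Ioo_subset_Ioo (le_max_left _ _) (min_le_left _ _)
  have hs2 : Ioo (max a 0) (min b 1) ⊆ Ioo 0 1 := Ioo_subset_Ioo (le_max_right _ _) (min_le_right _ _)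
  by_cases h1 : volume (Ioo a b ∩ {x | v x = 1}) = 0
  · refine Or.inr ⟨_, _, hm, measure_mono_null ?_ (measure_union_null h1 hv.measure_eq_zero)⟩
    rintro x ⟨hx, hne⟩
    by_cases hx1 : v x = 1
    · exact Or.inl ⟨hs1 hx, hx1⟩
    · exact Or.inr ⟨hs2 hx, fun hh => hh.elim hx1 hne⟩
  · refine Or.inl ⟨_, _, hm, measure_mono_null ?_ (measure_union_null (h h1) hv.measure_eq_zero)⟩
    rintro x ⟨hx, hne⟩
    by_cases hx1 : v x = -1
    · exact Or.inl ⟨hs1 hx, hx1⟩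
    · exact Or.inr ⟨hs2 hx, fun hh => hh.elim hne hx1⟩

/-- Off the essential jumps the interval `(0,1)` is covered by two disjoint open sets, so a
connected set lies in one of them. -/
lemma IsSign.subset_or_subset {v : ℝ → ℝ} (hv : IsSign v) {S : Set ℝ} (hS : IsPreconnected S)
    (h01 : S ⊆ Ioo 0 1) (h : ∀ t ∈ S, t ∉ essJump v) :
    S ⊆ essRegion v 1 ∨ S ⊆ essRegion v (-1) :=
  hS.subset_or_subset (isOpen_essRegion v 1) (isOpen_essRegion v (-1))
    (disjoint_essRegion v (by norm_num)) fun t ht => hv.mem_essRegion (h01 ht) (h t ht)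

/-- An interval on which both values have positive measure contains an essential jump. -/
lemma IsSign.exists_mem_essJump {v : ℝ → ℝ} (hv : IsSign v) {a b : ℝ} (hab : Ioo a b ⊆ Ioo 0 1)
    (h1 : volume (Ioo a b ∩ {x | v x = 1}) ≠ 0) (h2 : volume (Ioo a b ∩ {x | v x = -1}) ≠ 0) :
    ∃ t ∈ Ioo a b, t ∈ essJump v := by
  by_contra hcon
  push Not at hcon
  rcases hv.subset_or_subset isPreconnected_Ioo hab hcon with h | h
  · refine h2 (measure_mono_null ?_ (measure_essRegion v 1))
    rintro x ⟨hx, hx1⟩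
    refine ⟨h hx, ?_⟩
    have hx1 : v x = -1 := hx1
    show v x ≠ 1
    rw [hx1]; norm_num
  · refine h1 (measure_mono_null ?_ (measure_essRegion v (-1)))
    rintro x ⟨hx, hx1⟩
    refine ⟨h hx, ?_⟩
    have hx1 : v x = 1 := hx1
    show v x ≠ -1
    rw [hx1]; norm_num

/-- `w` is a measurable representative of `v` with values in `{-1,1}` that is constant on intervals
free of essential jumps of `v`. -/
structure IsSignRep (v w : ℝ → ℝ) : Prop where
  measurable : Measurable w
  sign : ∀ x, w x = 1 ∨ w x = -1
  ae_eq : v =ᵐ[(volume : Measure ℝ).restrict (Ioo 0 1)] w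
  const : ∀ x y, x ∈ Ioo (0 : ℝ) 1 → y ∈ Ioo (0 : ℝ) 1 → x ≤ y → (∀ t ∈ essJump v, t ∉ Icc x y) →
    w x = w y

open Classical in
lemma IsSign.exists_rep {v : ℝ → ℝ} (hv : IsSign v) (hJ : (essJump v).Finite) :
    ∃ w, IsSignRep v w := by
  refine ⟨fun x => if x ∈ essRegion v 1 then 1 else -1,
    Measurable.ite (isOpen_essRegion v 1).measurableSet measurable_const measurable_const,
    fun x => ?_, ?_, fun x y hx hy hxy h => ?_⟩
  · by_cases h : x ∈ essRegion v 1 <;> simp [h]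
  · rw [EventuallyEq, ae_restrict_iff' measurableSet_Ioo, ae_iff]
    refine measure_mono_null ?_ (measure_union_null (measure_union_null (measure_essRegion v 1)
      (measure_essRegion v (-1))) (hJ.measure_zero volume))
    intro x hx
    have hx : ¬ (x ∈ Ioo (0 : ℝ) 1 → v x = if x ∈ essRegion v 1 then 1 else -1) := hx
    rw [Classical.not_imp] at hx
    by_cases hj : x ∈ essJump v
    · exact Or.inr hj
    rcases hv.mem_essRegion hx.1 hj with h | h
    · refine Or.inl (Or.inl ⟨h, ?_⟩)
      have := hx.2
      rwa [if_pos h] at this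
    · refine Or.inl (Or.inr ⟨h, ?_⟩)
      have := hx.2
      rwa [if_neg ((disjoint_essRegion v (by norm_num)).notMem_of_mem_right h)] at this
  · rcases hv.subset_or_subset isPreconnected_Icc
      (fun z hz => ⟨hx.1.trans_le hz.1, hz.2.trans_lt hy.2⟩) (fun t ht hj => h t hj ht) with h | h
    · simp only [if_pos (h (left_mem_Icc.2 hxy)), if_pos (h (right_mem_Icc.2 hxy))]
    · have hd := disjoint_essRegion v (show (1 : ℝ) ≠ -1 by norm_num)
      simp only [if_neg (hd.notMem_of_mem_right (h (left_mem_Icc.2 hxy))),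
        if_neg (hd.notMem_of_mem_right (h (right_mem_Icc.2 hxy)))]

lemma IsSignRep.exists_jump {v w : ℝ → ℝ} (hw : IsSignRep v w) {x y : ℝ}
    (hx : x ∈ Ioo (0 : ℝ) 1) (hy : y ∈ Ioo (0 : ℝ) 1) (hxy : x ≤ y) (hne : w x ≠ w y) :
    ∃ t ∈ essJump v, t ∈ Icc x y := by
  by_contra hcon
  push Not at hcon
  exact hne (hw.const x y hx hy hxy hcon)

lemma IsSignRep.abs_sub_le {v w : ℝ → ℝ} (hw : IsSignRep v w) (x y : ℝ) : |w x - w y| ≤ 2 := by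
  rcases hw.sign x with h | h <;> rcases hw.sign y with h' | h' <;> rw [h, h'] <;> norm_num

lemma IsSignRep.measure_inter_eq {v w : ℝ → ℝ} (hw : IsSignRep v w) {S : Set ℝ}
    (hS : S ⊆ Ioo 0 1) (z : ℝ) : volume (S ∩ {x | v x = z}) = volume (S ∩ {x | w x = z}) := by
  have h := (ae_restrict_iff' measurableSet_Ioo).1 hw.ae_eq
  refine measure_congr (h.mono fun x hx => ?_)
  refine propext (and_congr_right fun hxS => ?_)
  show v x = z ↔ w x = z
  rw [hx (hS hxS)]

/-- Near an isolated essential jump the representative is a step. -/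
lemma IsSignRep.exists_step {v w : ℝ → ℝ} (hw : IsSignRep v w) {t δ : ℝ} (ht : t ∈ essJump v)
    (hδ : 0 < δ) (h01 : Ioo (t - δ) (t + δ) ⊆ Ioo 0 1)
    (hiso : ∀ t' ∈ essJump v, t' ∈ Ioo (t - δ) (t + δ) → t' = t) :
    ∃ z : ℝ, (z = 1 ∨ z = -1) ∧ (∀ x ∈ Ioo (t - δ) t, w x = -z) ∧ ∀ x ∈ Ioo t (t + δ), w x = z := by
  have hL : ∀ x ∈ Ioo (t - δ) t, w x = w (t - δ / 2) := fun x hx => by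
    have hm : t - δ / 2 ∈ Ioo (t - δ) t := ⟨by linarith, by linarith⟩
    have hs : Ioo (t - δ) t ⊆ Ioo (t - δ) (t + δ) := Ioo_subset_Ioo_right (by linarith)
    have key : ∀ x ∈ Ioo (t - δ) t, ∀ y ∈ Ioo (t - δ) t, x ≤ y → w x = w y := fun x hx y hy hxy =>
      hw.const x y (h01 (hs hx)) (h01 (hs hy)) hxy fun t' ht' hm' => by
        have := hiso t' ht' ⟨hx.1.trans_le hm'.1, by linarith [hm'.2, hy.2]⟩
        linarith [hm'.2, hy.2]
    rcases le_total x (t - δ / 2) with h | h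
    · exact key _ hx _ hm h
    · exact (key _ hm _ hx h).symm
  have hR : ∀ x ∈ Ioo t (t + δ), w x = w (t + δ / 2) := fun x hx => by
    have hm : t + δ / 2 ∈ Ioo t (t + δ) := ⟨by linarith, by linarith⟩
    have hs : Ioo t (t + δ) ⊆ Ioo (t - δ) (t + δ) := Ioo_subset_Ioo_left (by linarith)
    have key : ∀ x ∈ Ioo t (t + δ), ∀ y ∈ Ioo t (t + δ), x ≤ y → w x = w y := fun x hx y hy hxy =>
      hw.const x y (h01 (hs hx)) (h01 (hs hy)) hxy fun t' ht' hm' => by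
        have := hiso t' ht' ⟨by linarith [hm'.1, hx.1], hm'.2.trans_lt hy.2⟩
        linarith [hm'.1, hx.1]
    rcases le_total x (t + δ / 2) with h | h
    · exact key _ hx _ hm h
    · exact (key _ hm _ hx h).symm
  have hne : w (t - δ / 2) = -w (t + δ / 2) := by
    obtain ⟨h1, h2⟩ := ht.2 (t - δ) (t + δ) ⟨by linarith, by linarith⟩
    rw [hw.measure_inter_eq h01] at h1 h2
    have key : ∀ z z' : ℝ, z' ≠ z → w (t - δ / 2) = z' → w (t + δ / 2) = z' →
        volume (Ioo (t - δ) (t + δ) ∩ {x | w x = z}) = 0 := fun z z' hz ha hb => by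
      refine measure_mono_null (t := {t}) ?_ Real.volume_singleton
      rintro x ⟨hx, hxz⟩
      have hxz : w x = z := hxz
      rcases lt_trichotomy x t with h | h | h
      · exact absurd (((hL x ⟨hx.1, h⟩).trans ha).symm.trans hxz) hz
      · exact h
      · exact absurd (((hR x ⟨h, hx.2⟩).trans hb).symm.trans hxz) hz
    rcases hw.sign (t - δ / 2) with ha | ha <;> rcases hw.sign (t + δ / 2) with hb | hb
    · exact absurd (key (-1) 1 (by norm_num) ha hb) h2
    · rw [ha, hb]; norm_num
    · rw [ha, hb]
    · exact absurd (key 1 (-1) (by norm_num) ha hb) h1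
  exact ⟨w (t + δ / 2), hw.sign _, fun x hx => (hL x hx).trans hne, hR⟩

lemma exists_isolating_radius {J : Set ℝ} (hJ : J.Finite) {t : ℝ} (ht : t ∈ Ioo (0 : ℝ) 1) :
    ∃ δ₀ > 0, ∀ δ ≤ δ₀, Ioo (t - δ) (t + δ) ⊆ Ioo 0 1 ∧
      ∀ t' ∈ J, t' ∈ Ioo (t - δ) (t + δ) → t' = t := by
  have hopen : Ioo 0 1 ∩ (J \ {t})ᶜ ∈ 𝓝 t :=
    inter_mem (isOpen_Ioo.mem_nhds ht)
      ((hJ.subset sdiff_subset).isClosed.isOpen_compl.mem_nhds fun h => h.2 rfl)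
  obtain ⟨r, hr, hb⟩ := Metric.mem_nhds_iff.1 hopen
  rw [Real.ball_eq_Ioo] at hb
  refine ⟨r, hr, fun δ hδ => ?_⟩
  have hs : Ioo (t - δ) (t + δ) ⊆ Ioo (t - r) (t + r) :=
    Ioo_subset_Ioo (by linarith) (by linarith)
  refine ⟨fun x hx => (hb (hs hx)).1, fun t' ht' hx => ?_⟩
  by_contra hne
  exact (hb (hs hx)).2 ⟨ht', hne⟩

lemma exists_uniform_isolating_radius {J : Set ℝ} (hJ : J.Finite) (h01 : J ⊆ Ioo 0 1) :
    ∃ δ > 0, ∀ t ∈ J, Ioo (t - δ) (t + δ) ⊆ Ioo 0 1 ∧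
      ∀ t' ∈ J, t' ∈ Ioo (t - δ) (t + δ) → t' = t := by
  have h : ∀ t : J, ∃ δ₀ > (0 : ℝ), ∀ δ ≤ δ₀, Ioo ((t : ℝ) - δ) (t + δ) ⊆ Ioo 0 1 ∧
      ∀ t' ∈ J, t' ∈ Ioo ((t : ℝ) - δ) (t + δ) → t' = t := fun t =>
    exists_isolating_radius hJ (h01 t.2)
  choose f hf0 hf using h
  have : Finite J := hJ
  rcases isEmpty_or_nonempty J with hE | hE
  · exact ⟨1, one_pos, fun t ht => (hE.false ⟨t, ht⟩).elim⟩
  · obtain ⟨i, hi⟩ := Finite.exists_min f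
    exact ⟨f i, hf0 i, fun t ht => hf ⟨t, ht⟩ (f i) (hi ⟨t, ht⟩)⟩

/-! ### Bounded variation and the jump set -/

lemma edist_le_edist_of_abs_le {a b c d : ℝ} (h : |a - b| ≤ |c - d|) : edist a b ≤ edist c d := by
  rw [edist_dist, edist_dist, Real.dist_eq, Real.dist_eq]
  exact ENNReal.ofReal_le_ofReal h

lemma IsSignRep.boundedVariationOn {v w : ℝ → ℝ} (hw : IsSignRep v w) (hJ : (essJump v).Finite) :
    BoundedVariationOn w (Ioo 0 1) := by
  -- A jump of `w` between `x` and `y` may come from an essential jump at either endpoint. Counting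
  -- with both `<` and `≤` makes the monotone function `c` increase by at least `2` in every case,
  -- so it dominates the increments of `w`.
  set c : ℝ → ℝ := fun x =>
    2 * (((essJump v ∩ Iio x).ncard : ℝ) + ((essJump v ∩ Iic x).ncard : ℝ)) with hc
  have hf : ∀ S : Set ℝ, (essJump v ∩ S).Finite := fun S => hJ.subset inter_subset_left
  have hm1 : ∀ x y, x ≤ y → (essJump v ∩ Iio x).ncard ≤ (essJump v ∩ Iio y).ncard := fun x y h =>
    ncard_le_ncard (inter_subset_inter_right _ (Iio_subset_Iio h)) (hf _)
  have hm2 : ∀ x y, x ≤ y → (essJump v ∩ Iic x).ncard ≤ (essJump v ∩ Iic y).ncard := fun x y h =>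
    ncard_le_ncard (inter_subset_inter_right _ (Iic_subset_Iic.2 h)) (hf _)
  have hmono : Monotone c := fun x y h => by
    have e1 : ((essJump v ∩ Iio x).ncard : ℝ) ≤ (essJump v ∩ Iio y).ncard := by
      exact_mod_cast hm1 x y h
    have e2 : ((essJump v ∩ Iic x).ncard : ℝ) ≤ (essJump v ∩ Iic y).ncard := by
      exact_mod_cast hm2 x y h
    simp only [hc]; linarith
  have key : ∀ x ∈ Ioo (0 : ℝ) 1, ∀ y ∈ Ioo (0 : ℝ) 1, x ≤ y → |w y - w x| ≤ |c y - c x| := by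
    intro x hx y hy hxy
    by_cases hne : w x = w y
    · rw [hne, sub_self, abs_zero]; exact abs_nonneg _
    obtain ⟨t, ht, htm⟩ := hw.exists_jump hx hy hxy hne
    refine (hw.abs_sub_le y x).trans (le_trans ?_ (le_abs_self _))
    have e1 := hm1 x y hxy
    have e2 := hm2 x y hxy
    have e3 : (essJump v ∩ Iio x).ncard + (essJump v ∩ Iic x).ncard + 1 ≤
        (essJump v ∩ Iio y).ncard + (essJump v ∩ Iic y).ncard := by
      rcases htm.2.lt_or_eq with h | h
      · have : (essJump v ∩ Iio x).ncard < (essJump v ∩ Iio y).ncard :=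
          ncard_lt_ncard ⟨inter_subset_inter_right _ (Iio_subset_Iio hxy),
            fun hs => absurd (show t < x from (hs ⟨ht, h⟩).2) (not_lt.2 htm.1)⟩ (hf _)
        omega
      · have hxt : x < t := by
          rcases htm.1.lt_or_eq with h' | h'
          · exact h'
          · exact absurd (by rw [h', h]) hne
        have : (essJump v ∩ Iic x).ncard < (essJump v ∩ Iic y).ncard :=
          ncard_lt_ncard ⟨inter_subset_inter_right _ (Iic_subset_Iic.2 hxy),
            fun hs => absurd (show t ≤ x from (hs ⟨ht, h.le⟩).2) (not_le.2 hxt)⟩ (hf _)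
        omega
    have e4 : ((essJump v ∩ Iio x).ncard : ℝ) + (essJump v ∩ Iic x).ncard + 1 ≤
        (essJump v ∩ Iio y).ncard + (essJump v ∩ Iic y).ncard := by exact_mod_cast e3
    simp only [hc]; linarith
  have h1 : eVariationOn w (Ioo 0 1) ≤ eVariationOn c (Ioo 0 1) := by
    refine iSup_mono fun p => Finset.sum_le_sum fun i _ => edist_le_edist_of_abs_le ?_
    exact key _ (p.2.2.2 i) _ (p.2.2.2 (i + 1)) (p.2.2.1 (Nat.le_succ i))
  have h2 : eVariationOn c (Ioo 0 1) ≤ ENNReal.ofReal (c 1 - c 0) := by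
    refine le_trans (eVariationOn.mono c (show Ioo (0 : ℝ) 1 ⊆ Icc 0 1 ∩ Icc 0 1 by
      rw [inter_self]; exact Ioo_subset_Icc_self)) ?_
    exact ((hmono.monotoneOn _).eVariationOn_eq (by simp) (by simp)).le
  exact ((h1.trans h2).trans_lt ENNReal.ofReal_lt_top).ne

lemma IsSign.isBVSign {v : UnitFun} (hv : IsSign v) (hJ : (essJump v).Finite) : IsBVSign v := by
  obtain ⟨w, hw⟩ := hv.exists_rep hJ
  exact ⟨⟨w, hw.boundedVariationOn hJ, hw.ae_eq⟩, hv⟩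

/-- Remove the largest jump point: an interval around it, disjoint from an interval that contains
the other points, has values `1` and `-1` of `f`, hence variation at least `1`. The variable right
endpoint `b` carries the induction. -/
lemma card_le_eVariationOn {v f : ℝ → ℝ}
    (hf : v =ᵐ[(volume : Measure ℝ).restrict (Ioo 0 1)] f) (S : Finset ℝ) :
    (S : Set ℝ) ⊆ essJump v → ∀ b ≤ 1, (∀ t ∈ S, t < b) →
      (S.card : ℝ≥0∞) ≤ eVariationOn f (Ioo 0 b) := by
  induction S using Finset.induction_on_max with
  | empty => intro _ b _ _; simp
  | insert a S hS ih =>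
    intro hsub b hb1 hlt
    have haJ : a ∈ essJump v := hsub (by simp)
    have hab : a < b := hlt a (by simp)
    obtain ⟨c, hca, hcS⟩ : ∃ c, (c < a ∧ 0 < c) ∧ ∀ t ∈ S, t < c := by
      have e1 : ∀ᶠ c in 𝓝[<] a, ∀ t ∈ S, t < c :=
        (Filter.eventually_all_finset S).2 fun t ht =>
          mem_nhdsWithin_of_mem_nhds (lt_mem_nhds (hS t ht))
      have e2 : ∀ᶠ c in 𝓝[<] a, c < a := self_mem_nhdsWithin
      have e3 : ∀ᶠ c in 𝓝[<] a, 0 < c := mem_nhdsWithin_of_mem_nhds (lt_mem_nhds haJ.1.1)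
      obtain ⟨c, h1, h2, h3⟩ := (e1.and (e2.and e3)).exists
      exact ⟨c, ⟨h2, h3⟩, h1⟩
    have i1 := ih (fun t ht => hsub (by simp [Finset.mem_coe.1 ht])) c (by linarith) hcS
    have hsub' : Ioo c b ⊆ Ioo (0 : ℝ) 1 := Ioo_subset_Ioo hca.2.le hb1
    have hz : ∀ z : ℝ, volume (Ioo c b ∩ {x | v x = z}) ≠ 0 → ∃ x ∈ Ioo c b, f x = z := by
      intro z hz
      by_contra hcon
      push Not at hcon
      refine hz ?_
      have h := (ae_restrict_iff' measurableSet_Ioo).1 hf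
      rw [ae_iff] at h
      refine measure_mono_null ?_ h
      rintro x ⟨hx, hxz⟩ hh
      have hxz : v x = z := hxz
      exact hcon x hx (by rw [← hh (hsub' hx), hxz])
    obtain ⟨hp1, hp2⟩ := haJ.2 c b ⟨hca.1, hab⟩
    obtain ⟨x, hx, hfx⟩ := hz 1 hp1
    obtain ⟨y, hy, hfy⟩ := hz (-1) hp2
    have i2 : (1 : ℝ≥0∞) ≤ eVariationOn f (Ioo c b) := by
      refine le_trans ?_ (eVariationOn.edist_le f hx hy)
      rw [edist_dist, Real.dist_eq, hfx, hfy, ← ENNReal.ofReal_one]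
      exact ENNReal.ofReal_le_ofReal (by norm_num)
    have hcard : ((insert a S).card : ℝ≥0∞) = S.card + 1 := by
      rw [Finset.card_insert_of_notMem fun h => lt_irrefl a (hS a h)]; push_cast; rfl
    rw [hcard]
    refine (add_le_add i1 i2).trans ((eVariationOn.add_le_union f ?_).trans (eVariationOn.mono f ?_))
    · exact fun x hx y hy => (hx.2.trans hy.1).le
    · exact union_subset (Ioo_subset_Ioo_right (hca.1.trans hab).le) (Ioo_subset_Ioo_left hca.2.le)

lemma IsBVSign.finite_essJump {v : UnitFun} (hv : IsBVSign v) : (essJump v).Finite := by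
  obtain ⟨⟨f, hf, hvf⟩, -⟩ := hv
  by_contra hinf
  obtain ⟨n, hn⟩ := ENNReal.exists_nat_gt (show eVariationOn f (Ioo 0 1) ≠ ⊤ from hf)
  obtain ⟨S, hS, hcard⟩ := Set.Infinite.exists_subset_card_eq hinf n
  have := card_le_eVariationOn hvf S hS 1 le_rfl fun t ht => (hS ht).1.2
  rw [hcard] at this
  exact absurd hn (not_lt.2 this)

lemma hasApproxLimit_of_mem_essRegion {v : UnitFun} {t z : ℝ} (h : t ∈ essRegion v z) :
    HasApproxLimit v t z := by
  obtain ⟨a, b, ht, h0⟩ := h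
  have hev : ∀ᶠ r in 𝓝[>] (0 : ℝ), Ioo (t - r) (t + r) ⊆ Ioo a b := by
    have e1 : ∀ᶠ r in 𝓝[>] (0 : ℝ), r < t - a :=
      mem_nhdsWithin_of_mem_nhds (gt_mem_nhds (by linarith [ht.1]))
    have e2 : ∀ᶠ r in 𝓝[>] (0 : ℝ), r < b - t :=
      mem_nhdsWithin_of_mem_nhds (gt_mem_nhds (by linarith [ht.2]))
    filter_upwards [e1, e2] with r h1 h2
    exact Ioo_subset_Ioo (by linarith) (by linarith)
  refine tendsto_const_nhds.congr' (hev.mono fun r hr => ?_)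
  have : ∫⁻ x in Ioo (t - r) (t + r), ENNReal.ofReal |v x - z| = 0 := by
    rw [setLIntegral_congr_fun_ae (g := fun _ => 0) measurableSet_Ioo]
    · simp
    · rw [ae_iff]
      refine measure_mono_null ?_ h0
      intro x hx
      have hx : ¬ (x ∈ Ioo (t - r) (t + r) → ENNReal.ofReal |v x - z| = 0) := hx
      rw [Classical.not_imp] at hx
      refine ⟨hr hx.1, fun hh => hx.2 ?_⟩
      rw [hh]; simp
  simp only [this, mul_zero]

/-- Around an isolated jump, `v` equals `∓ζ` on the two halves, and `|ζ - z| + |-ζ - z| ≥ 2` keeps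
the mean of `|v - z|` at least `1` for every `z`. -/
lemma not_hasApproxLimit_of_mem_essJump {v : UnitFun} (hv : IsSign v) (hJ : (essJump v).Finite)
    {t : ℝ} (ht : t ∈ essJump v) (z : ℝ) : ¬ HasApproxLimit v t z := by
  intro hlim
  obtain ⟨w, hw⟩ := hv.exists_rep hJ
  obtain ⟨δ, hδ, hiso⟩ := exists_isolating_radius hJ ht.1
  have hev : ∀ᶠ r in 𝓝[>] (0 : ℝ), r ≤ δ ∧ 0 < r := by
    have e1 : ∀ᶠ r in 𝓝[>] (0 : ℝ), r < δ := mem_nhdsWithin_of_mem_nhds (gt_mem_nhds hδ)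
    have e2 : ∀ᶠ r in 𝓝[>] (0 : ℝ), 0 < r := self_mem_nhdsWithin
    exact e1.mp (e2.mono fun r h h' => ⟨h'.le, h⟩)
  have h2 := hlim.eventually (gt_mem_nhds (show (0 : ℝ≥0∞) < 1 by norm_num))
  obtain ⟨r, hr1, hrδ, hr0⟩ := (h2.and hev).exists
  obtain ⟨h01, his⟩ := hiso r hrδ
  obtain ⟨ζ, hζ, hl, hr⟩ := hw.exists_step ht hr0 h01 his
  have hconst : ∀ (S : Set ℝ) (y : ℝ), MeasurableSet S → S ⊆ Ioo (t - r) (t + r) →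
      (∀ x ∈ S, w x = y) → ∫⁻ x in S, ENNReal.ofReal |v x - z| = ENNReal.ofReal |y - z| * volume S := by
    intro S y hS hS' hy
    rw [setLIntegral_congr_fun_ae (g := fun _ => ENNReal.ofReal |y - z|) hS]
    · rw [setLIntegral_const]
    · filter_upwards [(ae_restrict_iff' measurableSet_Ioo).1 hw.ae_eq] with x hx hxS
      rw [hx (h01 (hS' hxS)), hy x hxS]
  have e1 := hconst (Ioo (t - r) t) (-ζ) measurableSet_Ioo (Ioo_subset_Ioo_right (by linarith)) hl
  have e2 := hconst (Ioo t (t + r)) ζ measurableSet_Ioo (Ioo_subset_Ioo_left (by linarith)) hr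
  have e3 : ENNReal.ofReal (2 * r) ≤ ∫⁻ x in Ioo (t - r) (t + r), ENNReal.ofReal |v x - z| := by
    refine le_trans ?_ (lintegral_mono_set (show Ioo (t - r) t ∪ Ioo t (t + r) ⊆ _ from
      union_subset (Ioo_subset_Ioo_right (by linarith)) (Ioo_subset_Ioo_left (by linarith))))
    rw [lintegral_union measurableSet_Ioo
      (Set.disjoint_left.2 fun x h1 h2 => absurd (h1.2.trans h2.1) (lt_irrefl _)), e1, e2,
      Real.volume_Ioo, Real.volume_Ioo, sub_sub_cancel, add_sub_cancel_left, ← add_mul,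
      ← ENNReal.ofReal_add (abs_nonneg _) (abs_nonneg _), ← ENNReal.ofReal_mul (by positivity)]
    refine ENNReal.ofReal_le_ofReal (mul_le_mul_of_nonneg_right ?_ hr0.le)
    have h3 : 2 = |2 * ζ| := by rcases hζ with h | h <;> rw [h] <;> norm_num
    have h4 : |2 * ζ| = |(ζ - z) - (-ζ - z)| := by congr 1; ring
    have h5 := abs_sub (ζ - z) (-ζ - z)
    linarith
  have h0 : ENNReal.ofReal (2 * r) ≠ 0 := by
    rw [Ne, ENNReal.ofReal_eq_zero, not_le]; linarith
  have h6 : (1 : ℝ≥0∞) ≤ (ENNReal.ofReal (2 * r))⁻¹ *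
      ∫⁻ x in Ioo (t - r) (t + r), ENNReal.ofReal |v x - z| := by
    rw [← ENNReal.inv_mul_cancel h0 ENNReal.ofReal_ne_top]
    exact mul_le_mul_right e3 _
  exact absurd hr1 (not_lt.2 h6)

lemma IsBVSign.jumpSet_eq {v : UnitFun} (hv : IsBVSign v) : jumpSet v = essJump v := by
  have hs : IsSign v := hv.2
  ext t
  constructor
  · rintro ⟨ht, hno⟩
    by_contra hj
    rcases hs.mem_essRegion ht hj with h | h
    · exact hno ⟨1, hasApproxLimit_of_mem_essRegion h⟩
    · exact hno ⟨-1, hasApproxLimit_of_mem_essRegion h⟩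
  · rintro ht
    exact ⟨ht.1, fun ⟨z, hz⟩ => not_hasApproxLimit_of_mem_essJump hs hv.finite_essJump ht z hz⟩

lemma sharpInterface_of_isBVSign {v : UnitFun} (hv : IsBVSign v) (c : ℝ≥0∞) :
    sharpInterface c v = c * ((essJump v).ncard : ℝ≥0∞) := by
  rw [sharpInterface, if_pos hv, hv.jumpSet_eq, ← hv.finite_essJump.cast_ncard_eq]
  rfl

/-! ### The lower bound of the `Γ`-limit -/

/-- The lower limits at infinity bound `W` away from `0` outside a compact interval, and compactness
does so inside it. Unlike `exists_pos_le`, no bound on `z` is assumed; the functions here are not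
truncated. -/
lemma IsDoubleWell.exists_pos_le_of_far {W : ℝ → ℝ} (hW : IsDoubleWell W) {θ : ℝ} (hθ : 0 < θ) :
    ∃ c : ℝ, 0 < c ∧ ∀ z, θ ≤ |z - 1| → θ ≤ |z - (-1)| → c ≤ W z := by
  obtain ⟨c₁, hc₁, hc₁'⟩ := EReal.lt_iff_exists_real_btwn.1 hW.liminf_atTop
  obtain ⟨c₂, hc₂, hc₂'⟩ := EReal.lt_iff_exists_real_btwn.1 hW.liminf_atBot
  obtain ⟨a, ha⟩ := (eventually_lt_of_lt_liminf hc₁').exists_forall_of_atTop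
  obtain ⟨b, hb⟩ := (eventually_lt_of_lt_liminf hc₂').exists_forall_of_atBot
  have hc₁ : 0 < c₁ := by exact_mod_cast hc₁
  have hc₂ : 0 < c₂ := by exact_mod_cast hc₂
  have hK : IsCompact (Icc b a ∩ ({z | θ ≤ |z - 1|} ∩ {z | θ ≤ |z - (-1)|})) := by
    refine isCompact_Icc.inter_right (IsClosed.inter ?_ ?_)
    · exact isClosed_le continuous_const (by fun_prop)
    · exact isClosed_le continuous_const (by fun_prop)
  obtain ⟨c₃, hc₃, hK'⟩ : ∃ c₃ : ℝ, 0 < c₃ ∧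
      ∀ z ∈ Icc b a ∩ ({z | θ ≤ |z - 1|} ∩ {z | θ ≤ |z - (-1)|}), c₃ ≤ W z := by
    rcases Set.eq_empty_or_nonempty (Icc b a ∩ ({z | θ ≤ |z - 1|} ∩ {z | θ ≤ |z - (-1)|}))
      with he | hne
    · exact ⟨1, one_pos, fun z hz => by rw [he] at hz; exact hz.elim⟩
    · obtain ⟨z₀, hz₀, hmin⟩ := hK.exists_isMinOn hne hW.continuous.continuousOn
      refine ⟨W z₀, ?_, fun z hz => hmin hz⟩
      refine lt_of_le_of_ne (hW.nonneg _) fun h0 => ?_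
      obtain ⟨-, h2, h3⟩ := hz₀
      have h2 : θ ≤ |z₀ - 1| := h2
      have h3 : θ ≤ |z₀ - (-1)| := h3
      rcases (hW.zero_iff z₀).1 h0.symm with h | h
      · rw [h] at h2; simp at h2; linarith
      · rw [h] at h3; simp at h3; linarith
  refine ⟨min c₁ (min c₂ c₃), lt_min hc₁ (lt_min hc₂ hc₃), fun z h1 h2 => ?_⟩
  rcases le_total a z with h | h
  · have : c₁ < W z := by exact_mod_cast ha z h
    exact (min_le_left _ _).trans this.le
  · rcases le_total z b with h' | h'
    · have : c₂ < W z := by exact_mod_cast hb z h'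
      exact ((min_le_right _ _).trans (min_le_left _ _)).trans this.le
    · exact ((min_le_right _ _).trans (min_le_right _ _)).trans (hK' z ⟨⟨h', h⟩, h1, h2⟩)

lemma logInt_le {ε s : ℝ} (hε : ε ∈ Ioo (0 : ℝ) 1) (hs : 1 / 2 ≤ s) : logInt ε s ≤ -Real.log ε := by
  have h0 : 0 ≤ -Real.log ε := by have := Real.log_neg hε.1 hε.2; linarith
  have h1 : logInt ε s ≤ ∫ _ in (0 : ℝ)..(-Real.log ε), (1 : ℝ) := by
    refine intervalIntegral.integral_mono_on h0 ?_ ?_ fun x hx => ?_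
    · exact (Continuous.intervalIntegrable (by fun_prop) _ _)
    · exact (Continuous.intervalIntegrable (by fun_prop) _ _)
    · rw [Real.exp_le_one_iff]
      nlinarith [hx.1]
  simpa using h1

/-- Since `Λ ≤ |log ε|`, the product is at most `ε |log ε|`, uniformly in the exponent. -/
lemma Approaches.tendsto_mul_logInt {s ε : ℕ → ℝ} {s₀ : ℝ} (h : Approaches s ε s₀) :
    Tendsto (fun j => ε j * logInt (ε j) (s j)) atTop (𝓝 0) := by
  have h1 : Tendsto (fun j => -(ε j * Real.log (ε j))) atTop (𝓝 0) := by
    have := (Real.continuous_mul_log.tendsto 0).comp h.2.2.2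
    simpa using this.neg
  refine tendsto_of_tendsto_of_tendsto_of_le_of_le' tendsto_const_nhds h1 ?_ ?_
  · exact (h.eventually_mem one_pos).mono fun j hj => (mul_pos hj.1 (logInt_pos hj _)).le
  · refine (h.eventually_mem one_pos).mono fun j hj => ?_
    have := mul_le_mul_of_nonneg_left (logInt_le hj (h.1 j).1) hj.1.le
    linarith

lemma ConvMeasure.tendsto_volume {u : ℕ → UnitFun} {v : UnitFun} (h : ConvMeasure u v) {E : Set ℝ}
    (hE : E ⊆ Ioo 0 1) {η : ℝ} (hη : 0 < η) :
    Tendsto (fun j => volume (E ∩ {x | η ≤ |u j x - v x|})) atTop (𝓝 0) := by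
  have h1 := tendstoInMeasure_iff_norm.1 h η hη
  refine tendsto_of_tendsto_of_tendsto_of_le_of_le tendsto_const_nhds h1 (fun _ => bot_le)
    fun j => ?_
  show volume (E ∩ {x | η ≤ |u j x - v x|}) ≤ _
  rw [Measure.restrict_apply' measurableSet_Ioo, inter_comm]
  refine measure_mono (inter_subset_inter (fun x hx => ?_) hE)
  exact hx

/-- A bound of the scaled energy forces the function to be close to the wells. -/
lemma volume_far_le_of_localEnergy_le {W : ℝ → ℝ} {c θ : ℝ} (hc : 0 < c)
    (hcW : ∀ z, θ ≤ |z - 1| → θ ≤ |z - (-1)| → c ≤ W z) {ε s C : ℝ} (hε : ε ∈ Ioo (0 : ℝ) 1)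
    {u : ℝ → ℝ} (hu : Measurable fun x => W (u x))
    (h : localEnergy W ε s (Ioo 0 1) u ≤ ENNReal.ofReal C) :
    volume (Ioo 0 1 ∩ {x | θ ≤ |u x - 1| ∧ θ ≤ |u x - (-1)|}) ≤
      ENNReal.ofReal (C / c * (ε * logInt ε s)) := by
  set F := {x | θ ≤ |u x - 1| ∧ θ ≤ |u x - (-1)|} with hF
  have hΛ := logInt_pos hε s
  have h1 : ENNReal.ofReal c * volume (Ioo 0 1 ∩ F) ≤ potentialEnergy W (Ioo 0 1) u := by
    have e : ENNReal.ofReal c * volume (Ioo 0 1 ∩ F) ≤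
        ENNReal.ofReal c * (volume.restrict (Ioo 0 1))
          {x | ENNReal.ofReal c ≤ ENNReal.ofReal (W (u x))} := by
      rw [Measure.restrict_apply' measurableSet_Ioo, inter_comm]
      refine mul_le_mul_right (measure_mono (inter_subset_inter_left _ fun x hx => ?_)) _
      exact ENNReal.ofReal_le_ofReal (hcW _ hx.1 hx.2)
    exact e.trans (mul_meas_ge_le_lintegral hu.ennreal_ofReal _)
  have h2 : ENNReal.ofReal (1 / (ε * logInt ε s)) * potentialEnergy W (Ioo 0 1) u ≤
      ENNReal.ofReal C := by
    refine le_trans ?_ h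
    rw [localEnergy, scaling_eq hε]
    refine le_trans (le_of_eq ?_) (mul_le_mul_right le_self_add _)
    rw [← mul_assoc, ← ENNReal.ofReal_mul (by positivity)]
    congr 2
    field_simp
  have hp : 0 < ε * logInt ε s := mul_pos hε.1 hΛ
  have h3 : ENNReal.ofReal (c / (ε * logInt ε s)) * volume (Ioo 0 1 ∩ F) ≤ ENNReal.ofReal C := by
    refine le_trans (le_trans (le_of_eq ?_) (mul_le_mul_right h1 _)) h2
    rw [← mul_assoc, ← ENNReal.ofReal_mul (by positivity)]
    congr 2
    field_simp
  rw [mul_comm, ← ENNReal.le_div_iff_mul_le (Or.inl (by simp; positivity)) (Or.inl (by simp)),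
    ← ENNReal.ofReal_div_of_pos (by positivity)] at h3
  refine h3.trans (le_of_eq ?_)
  congr 1
  field_simp

/-- A limit in measure of functions that are close to the wells is a sign function. -/
lemma ConvMeasure.isSign {u : ℕ → UnitFun} {v : UnitFun} (huv : ConvMeasure u v)
    (h : ∀ θ > (0 : ℝ), ∀ r > (0 : ℝ), ∃ᶠ j in atTop,
      volume (Ioo 0 1 ∩ {x | θ ≤ |u j x - 1| ∧ θ ≤ |u j x - (-1)|}) ≤ ENNReal.ofReal r) :
    IsSign v := by
  have key : ∀ n : ℕ, volume (Ioo 0 1 ∩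
      {x | 2 * (1 / ((n : ℝ) + 1)) ≤ |v x - 1| ∧ 2 * (1 / ((n : ℝ) + 1)) ≤ |v x - (-1)|}) = 0 := by
    intro n
    set θ : ℝ := 1 / ((n : ℝ) + 1) with hθ
    have hθ0 : 0 < θ := by positivity
    refine le_antisymm (ENNReal.le_of_forall_pos_le_add fun r hr _ => ?_) bot_le
    have hr : (0 : ℝ) < r := hr
    have e2 := (huv.tendsto_volume subset_rfl hθ0).eventually
      (gt_mem_nhds (show (0 : ℝ≥0∞) < ENNReal.ofReal (r / 2) by simpa using hr))
    obtain ⟨j, hj, h2⟩ := ((h θ hθ0 (r / 2) (by positivity)).and_eventually e2).exists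
    have hsub : Ioo 0 1 ∩ {x | 2 * θ ≤ |v x - 1| ∧ 2 * θ ≤ |v x - (-1)|} ⊆
        (Ioo 0 1 ∩ {x | θ ≤ |u j x - 1| ∧ θ ≤ |u j x - (-1)|}) ∪
          (Ioo 0 1 ∩ {x | θ ≤ |u j x - v x|}) := by
      rintro x ⟨hx, hx1, hx2⟩
      by_cases hd : θ ≤ |u j x - v x|
      · exact Or.inr ⟨hx, hd⟩
      · rw [not_le] at hd
        have t1 : |v x - 1| ≤ |u j x - 1| + |u j x - v x| := by
          have := abs_sub (u j x - 1) (u j x - v x)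
          rwa [show u j x - 1 - (u j x - v x) = v x - 1 by ring] at this
        have t2 : |v x - (-1)| ≤ |u j x - (-1)| + |u j x - v x| := by
          have := abs_sub (u j x - (-1)) (u j x - v x)
          rwa [show u j x - (-1) - (u j x - v x) = v x - (-1) by ring] at this
        exact Or.inl ⟨hx, by linarith, by linarith⟩
    rw [zero_add]
    refine (measure_mono hsub).trans ((measure_union_le _ _).trans ((add_le_add hj h2.le).trans
      (le_of_eq ?_)))
    rw [← ENNReal.ofReal_add (by positivity) (by positivity), add_halves, ENNReal.ofReal_coe_nnreal]
  rw [IsSign, ae_restrict_iff' measurableSet_Ioo, ae_iff]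
  refine measure_mono_null ?_ (measure_iUnion_null key)
  intro x hx
  have hx : ¬ (x ∈ Ioo (0 : ℝ) 1 → v x = 1 ∨ v x = -1) := hx
  push Not at hx
  obtain ⟨hx0, hx1, hx2⟩ := hx
  have hm : 0 < min |v x - 1| |v x - (-1)| / 2 :=
    half_pos (lt_min (abs_pos.2 (sub_ne_zero.2 hx1)) (abs_pos.2 (sub_ne_zero.2 hx2)))
  obtain ⟨n, hn⟩ := exists_nat_one_div_lt hm
  refine mem_iUnion.2 ⟨n, hx0, ?_, ?_⟩
  · have := min_le_left |v x - 1| |v x - (-1)|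
    linarith
  · have := min_le_right |v x - 1| |v x - (-1)|
    linarith

lemma isSign_of_frequently_le {W : ℝ → ℝ} (hW : IsDoubleWell W) {s₀ : ℝ} {s ε : ℕ → ℝ}
    (happ : Approaches s ε s₀) {u : ℕ → UnitFun} {v : UnitFun} (huv : ConvMeasure u v) {C : ℝ}
    (h : ∃ᶠ j in atTop, scaledEnergy W (ε j) (s j) (u j) ≤ ENNReal.ofReal C) :
    IsSign v := by
  refine huv.isSign fun θ hθ r hr => ?_
  obtain ⟨c, hc, hcW⟩ := hW.exists_pos_le_of_far hθ
  have e1 : ∀ᶠ j in atTop, C / c * (ε j * logInt (ε j) (s j)) < r := by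
    have := happ.tendsto_mul_logInt.const_mul (C / c)
    rw [mul_zero] at this
    exact this.eventually (gt_mem_nhds hr)
  refine (h.and_eventually (e1.and (happ.eventually_mem one_pos))).mono fun j hj => ?_
  exact (volume_far_le_of_localEnergy_le hc hcW hj.2.2
    (hW.continuous.measurable.comp (u j).measurable) hj.1).trans
    (ENNReal.ofReal_le_ofReal hj.2.1.le)

lemma exists_disjoint_intervals (S : Finset ℝ) (hS : (S : Set ℝ) ⊆ Ioo 0 1) :
    ∃ δ > 0, (∀ t ∈ S, Ioo (t - δ) (t + δ) ⊆ Ioo 0 1) ∧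
      (S : Set ℝ).PairwiseDisjoint fun t => Ioo (t - δ) (t + δ) := by
  obtain ⟨δ, hδ, h⟩ := exists_uniform_isolating_radius S.finite_toSet hS
  refine ⟨δ / 2, by positivity, fun t ht => ?_, fun t ht t' ht' hne => ?_⟩
  · exact (Ioo_subset_Ioo (by linarith) (by linarith)).trans (h t ht).1
  · refine Set.disjoint_left.2 fun x hx hx' => hne ?_
    exact ((h t ht).2 t' ht' ⟨by linarith [hx.1, hx'.2], by linarith [hx.2, hx'.1]⟩).symm

/-- Disjoint intervals around the chosen jump points each carry one tension by `local_liminf`, and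
the local energies add up. The set `S` is finite, but finiteness of `essJump v` is not assumed. -/
lemma card_mul_le_liminf {W : ℝ → ℝ} (hW : IsDoubleWell W) {s₀ : ℝ}
    (hs₀ : s₀ ∈ Ico (1 / 2 : ℝ) 1) {s ε : ℕ → ℝ} (happ : Approaches s ε s₀) {u : ℕ → UnitFun}
    {v : UnitFun} (huv : ConvMeasure u v) (S : Finset ℝ) (hS : (S : Set ℝ) ⊆ essJump v) :
    rescaledTension W s₀ * S.card ≤ liminf (fun j => scaledEnergy W (ε j) (s j) (u j)) atTop := by
  obtain ⟨δ, hδ, h01, hdis⟩ := exists_disjoint_intervals S fun t ht => (hS ht).1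
  refine ENNReal.le_of_forall_pos_le_add fun r hr _ => ?_
  have hr : (0 : ℝ) < r := hr
  set d : ℝ := r / (S.card + 1) with hd
  have hd0 : 0 < d := by positivity
  have hev : ∀ᶠ j in atTop, ∀ t ∈ S, rescaledTension W s₀ ≤
      localEnergy W (ε j) (s j) (Ioo (t - δ) (t + δ)) (u j) + ENNReal.ofReal d := by
    refine (Filter.eventually_all_finset S).2 fun t ht => ?_
    obtain ⟨hB, hA⟩ := (hS ht).2 (t - δ) (t + δ) ⟨by linarith, by linarith⟩
    rw [← rescaledProfileTension_eq hW hs₀]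
    exact local_liminf hW hs₀ happ (fun j => (u j).measurable) v.measurable (by linarith)
      (fun η hη => huv.tendsto_volume (h01 t ht) hη) hA hB hd0
  have hev2 : ∀ᶠ j in atTop, rescaledTension W s₀ * S.card ≤
      scaledEnergy W (ε j) (s j) (u j) + r := by
    refine hev.mono fun j hj => ?_
    have h1 := Finset.sum_le_sum hj
    rw [Finset.sum_const, nsmul_eq_mul, Finset.sum_add_distrib, Finset.sum_const, nsmul_eq_mul,
      mul_comm] at h1
    refine h1.trans (add_le_add (sum_localEnergy_le W S _ _ (fun _ _ => measurableSet_Ioo) hdis h01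
      (ε j) (s j) (u j)) ?_)
    rw [← ENNReal.ofReal_natCast, ← ENNReal.ofReal_mul (by positivity),
      ← ENNReal.ofReal_coe_nnreal (p := r)]
    refine ENNReal.ofReal_le_ofReal ?_
    rw [hd, mul_div_assoc', div_le_iff₀ (by positivity)]
    nlinarith
  have h2 : rescaledTension W s₀ * S.card - r ≤
      liminf (fun j => scaledEnergy W (ε j) (s j) (u j)) atTop :=
    le_liminf_of_le (by isBoundedDefault) (hev2.mono fun j hj => tsub_le_iff_right.2 hj)
  exact tsub_le_iff_right.1 h2

lemma finite_of_card_mul_le {J : Set ℝ} {c L : ℝ≥0∞} (hc : c ≠ 0) (hL : L ≠ ⊤)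
    (h : ∀ S : Finset ℝ, (S : Set ℝ) ⊆ J → c * S.card ≤ L) : J.Finite := by
  by_contra hinf
  obtain ⟨n, hn⟩ := ENNReal.exists_nat_mul_gt hc hL
  obtain ⟨S, hS, hcard⟩ := Set.Infinite.exists_subset_card_eq hinf n
  have := h S hS
  rw [hcard, mul_comm] at this
  exact absurd hn (not_lt.2 this)

/-- When `L` is finite, the bound on finite subsets and `c ≠ 0` make the essential jump set finite,
so `v` has bounded variation and the whole jump set can be taken for `S`. -/
lemma sharpInterface_le_of_card_mul_le {v : UnitFun} (hv : IsSign v) {c L : ℝ≥0∞} (hc : c ≠ 0)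
    (h : ∀ S : Finset ℝ, (S : Set ℝ) ⊆ essJump v → c * S.card ≤ L) : sharpInterface c v ≤ L := by
  by_cases hL : L = ⊤
  · rw [hL]; exact le_top
  have hJ := finite_of_card_mul_le hc hL h
  rw [sharpInterface_of_isBVSign (hv.isBVSign hJ), ncard_eq_toFinset_card _ hJ]
  exact h hJ.toFinset (by simp)

theorem sharpInterface_le_liminf {W : ℝ → ℝ} (hW : IsDoubleWell W) {s₀ : ℝ}
    (hs₀ : s₀ ∈ Ico (1 / 2 : ℝ) 1) {s ε : ℕ → ℝ} (happ : Approaches s ε s₀) {u : ℕ → UnitFun}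
    {v : UnitFun} (huv : ConvMeasure u v) :
    sharpInterface (rescaledTension W s₀) v ≤
      liminf (fun j => scaledEnergy W (ε j) (s j) (u j)) atTop := by
  by_cases hL : liminf (fun j => scaledEnergy W (ε j) (s j) (u j)) atTop = ⊤
  · rw [hL]; exact le_top
  obtain ⟨C, hC⟩ := ENNReal.lt_iff_exists_nnreal_btwn.1 (lt_top_iff_ne_top.2 hL)
  have hfreq : ∃ᶠ j in atTop, scaledEnergy W (ε j) (s j) (u j) ≤ ENNReal.ofReal C := by
    rw [ENNReal.ofReal_coe_nnreal]
    exact (frequently_lt_of_liminf_lt (by isBoundedDefault) hC.1).mono fun j hj => hj.le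
  exact sharpInterface_le_of_card_mul_le (isSign_of_frequently_le hW happ huv hfreq)
    (rescaledTension_pos hW hs₀).ne' fun S hS => card_mul_le_liminf hW hs₀ happ huv S hS

/-! ### Recovery: one transition -/

lemma Approaches.tendsto_rpow {s ε : ℕ → ℝ} {s₀ : ℝ} (h : Approaches s ε s₀) (hs₀ : 1 / 2 < s₀) :
    Tendsto (fun j => ε j ^ (2 * s j - 1)) atTop (𝓝 0) := by
  have h1 : Tendsto (fun j => (ε j, 2 * s j - 1)) atTop (𝓝 (0, 2 * s₀ - 1)) :=
    h.2.2.2.prodMk_nhds ((h.2.2.1.const_mul 2).sub_const 1)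
  have h2 := (Real.continuousAt_rpow_of_pos (0, 2 * s₀ - 1) (by
    show 0 < 2 * s₀ - 1; linarith)).tendsto.comp h1
  rw [Real.zero_rpow (by linarith)] at h2
  exact h2

lemma Approaches.tendsto_scaling {s ε : ℕ → ℝ} {s₀ : ℝ} (h : Approaches s ε s₀)
    (hs₀ : 1 / 2 < s₀) : Tendsto (fun j => scaling (ε j) (s j)) atTop (𝓝 (2 * s₀ - 1)) := by
  have h1 := ((h.2.2.1.const_mul 2).sub_const 1).div
    ((tendsto_const_nhds (x := (1 : ℝ))).sub (h.tendsto_rpow hs₀)) (by norm_num)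
  rw [sub_zero, div_one] at h1
  refine h1.congr' ((h.2.2.1.eventually (lt_mem_nhds hs₀)).mono fun j hj => ?_)
  exact (scaling_of_gt hj).symm

/-- This is the coefficient of interactions at a fixed distance. At `s₀ = 1/2` the scaling factor
tends to `0` while the power stays at most `1`; for `s₀ > 1/2` the power tends to `0` while the
factor stays bounded. -/
lemma Approaches.tendsto_scaling_mul_rpow {s ε : ℕ → ℝ} {s₀ : ℝ} (h : Approaches s ε s₀) :
    Tendsto (fun j => scaling (ε j) (s j) * ε j ^ (2 * s j - 1)) atTop (𝓝 0) := by
  have hs₀ : 1 / 2 ≤ s₀ := ge_of_tendsto' h.2.2.1 fun j => (h.1 j).1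
  rcases hs₀.eq_or_lt with hs₀ | hs₀
  · subst hs₀
    have h1 : Tendsto (fun j => 1 / logInt (ε j) (s j)) atTop (𝓝 0) :=
      tendsto_const_nhds.div_atTop h.tendsto_logInt
    refine tendsto_of_tendsto_of_tendsto_of_le_of_le' tendsto_const_nhds h1 ?_ ?_
    · filter_upwards [h.eventually_mem one_pos] with j hj
      rw [scaling_eq hj]
      have := logInt_pos hj (s j)
      have := Real.rpow_nonneg hj.1.le (2 * s j - 1)
      positivity
    · filter_upwards [h.eventually_mem one_pos] with j hj
      rw [scaling_eq hj]
      have := logInt_pos hj (s j)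
      exact mul_le_of_le_one_right (by positivity)
        (Real.rpow_le_one hj.1.le hj.2.le (by linarith [(h.1 j).1]))
  · have := (h.tendsto_scaling hs₀).mul (h.tendsto_rpow hs₀)
    rwa [mul_zero] at this

/-- A single profile whose scaled energy is asymptotically almost optimal. -/
lemma exists_profile_recovery {W : ℝ → ℝ} (hW : IsDoubleWell W) {s₀ : ℝ}
    (hs₀ : s₀ ∈ Ico (1 / 2 : ℝ) 1) {s ε : ℕ → ℝ} (happ : Approaches s ε s₀) {d : ℝ} (hd : 0 < d) :
    ∃ u R D, IsProfile u R D ∧ ∀ᶠ j in atTop, ENNReal.ofReal (scaling (ε j) (s j)) *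
      energy W (s j) (Ioo (-(1 / (2 * ε j))) (1 / (2 * ε j))) u ≤
        rescaledTension W s₀ + ENNReal.ofReal d := by
  have hd0 : (0 : ℝ≥0∞) < ENNReal.ofReal d := by simpa using hd
  rcases eq_or_lt_of_le hs₀.1 with h | h
  · subst h
    refine ⟨trunc, 1, 2, isProfile_trunc, ?_⟩
    have hP := hW.potentialEnergy_lt_top isProfile_trunc.left isProfile_trunc.right
      isProfile_trunc.bound
    set P := potentialEnergy W univ trunc
    have hlim : Tendsto (fun j => ENNReal.ofReal (1 / logInt (ε j) (s j)) * (P + ENNReal.ofReal 64))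
        atTop (𝓝 0) := by
      have h1 : Tendsto (fun j => 1 / logInt (ε j) (s j)) atTop (𝓝 0) :=
        tendsto_const_nhds.div_atTop happ.tendsto_logInt
      have := ENNReal.Tendsto.mul_const (b := P + ENNReal.ofReal 64) (ENNReal.tendsto_ofReal h1)
        (Or.inr (ENNReal.add_lt_top.2 ⟨hP, ENNReal.ofReal_lt_top⟩).ne)
      rwa [ENNReal.ofReal_zero, zero_mul] at this
    filter_upwards [hlim.eventually (eventually_le_nhds hd0), happ.eventually_mem one_pos,
      happ.2.2.1.eventually (gt_mem_nhds (show (1 / 2 : ℝ) < 3 / 4 by norm_num))] with j h1 h2 h3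
    have hΛ := logInt_pos h2 (s j)
    -- Distances inside the blown-up interval are at most `1/ε`, and the integral of `h^{-2s}` over
    -- `[1,1/ε]` is exactly `Λ`, so the scaled leading term is `8`.
    have h4 := gagliardoSq_trunc_le (s := s j) ⟨(happ.1 j).1, le_of_lt h3⟩
      (E := Ioo (-(1 / (2 * ε j))) (1 / (2 * ε j))) (S := Iic (1 / ε j))
      measurableSet_Ioo measurableSet_Iic (fun h hh x _ hx hxh => hh (show h ≤ 1 / ε j by
        have e : 1 / ε j = 1 / (2 * ε j) + 1 / (2 * ε j) := by field_simp; norm_num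
        rw [e]; linarith [hx.1, hxh.2]))
    have h5 : Ioi (1 : ℝ) ∩ Iic (1 / ε j) = Ioc 1 (1 / ε j) := rfl
    rw [h5, lintegral_Ioc_rpow one_pos (by rw [le_div_iff₀ h2.1]; linarith [h2.2]),
      integral_rpow_one_inv h2.1] at h4
    rw [scaling_eq h2, rescaledTension, if_pos rfl]
    calc _ ≤ ENNReal.ofReal (1 / logInt (ε j) (s j)) *
          (P + (ENNReal.ofReal 64 + 8 * ENNReal.ofReal (logInt (ε j) (s j)))) :=
          mul_le_mul_right (add_le_add (potentialEnergy_mono_set W (subset_univ _) _) h4) _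
      _ = ENNReal.ofReal (1 / logInt (ε j) (s j)) * (P + ENNReal.ofReal 64) +
          8 * (ENNReal.ofReal (1 / logInt (ε j) (s j)) * ENNReal.ofReal (logInt (ε j) (s j))) := by
          ring
      _ ≤ ENNReal.ofReal d + 8 * 1 := by
          refine add_le_add h1 (mul_le_mul_right (le_of_eq ?_) 8)
          rw [← ENNReal.ofReal_mul (by positivity), one_div_mul_cancel hΛ.ne', ENNReal.ofReal_one]
      _ = _ := by rw [mul_one, add_comm]
  · have hs₀' : s₀ ∈ Ioo (1 / 2 : ℝ) 1 := ⟨h, hs₀.2⟩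
    have hd2 : 0 < d / 2 := by positivity
    obtain ⟨u, R, D, hu, hE⟩ := exists_profile_upper hW hs₀' (d := ENNReal.ofReal (d / 2))
      (by simpa using hd)
    refine ⟨u, R, D, hu, ?_⟩
    have hPt := (profileTension_lt_top hW hs₀').ne
    have hlim : Tendsto (fun j => ENNReal.ofReal (scaling (ε j) (s j)) *
        (profileTension W s₀ + ENNReal.ofReal (d / 2))) atTop
        (𝓝 (ENNReal.ofReal (2 * s₀ - 1) * (profileTension W s₀ + ENNReal.ofReal (d / 2)))) :=
      ENNReal.Tendsto.mul_const (ENNReal.tendsto_ofReal (happ.tendsto_scaling h))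
        (Or.inr (ENNReal.add_ne_top.2 ⟨hPt, ENNReal.ofReal_ne_top⟩))
    have hlt : ENNReal.ofReal (2 * s₀ - 1) * (profileTension W s₀ + ENNReal.ofReal (d / 2)) <
        rescaledTension W s₀ + ENNReal.ofReal d := by
      rw [← rescaledProfileTension_eq hW hs₀, rescaledProfileTension, if_neg h.ne', mul_add]
      refine ENNReal.add_lt_add_of_le_of_lt (ENNReal.mul_ne_top ENNReal.ofReal_ne_top hPt) le_rfl ?_
      refine lt_of_le_of_lt (mul_le_of_le_one_left' ?_)
        ((ENNReal.ofReal_lt_ofReal_iff hd).2 (half_lt_self hd))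
      rw [← ENNReal.ofReal_one]
      exact ENNReal.ofReal_le_ofReal (by linarith [hs₀.2])
    filter_upwards [hlim.eventually (gt_mem_nhds hlt), happ.2.2.1.eventually hE] with j h1 h2
    exact (mul_le_mul_right ((energy_mono_set W _ (subset_univ _) u).trans h2) _).trans h1.le

/-! ### Recovery: gluing transitions along the jump set -/

/-- The function that replaces every jump of `w` in `J` by the profile `u` at scale `ε`. -/
def smoothed (u w : ℝ → ℝ) (J : Set ℝ) (ε x : ℝ) : ℝ := u (w x * Metric.infDist x J / ε)

lemma measurable_smoothed {u w : ℝ → ℝ} (hu : Measurable u) (hw : Measurable w) (J : Set ℝ)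
    (ε : ℝ) : Measurable (smoothed u w J ε) :=
  hu.comp ((hw.mul (Metric.continuous_infDist_pt J).measurable).div_const ε)

lemma IsProfile.smoothed_eq {u : ℝ → ℝ} {R D : ℝ} (hu : IsProfile u R D) {w : ℝ → ℝ} {J : Set ℝ}
    {ε x : ℝ} (hε : 0 < ε) (hw : w x = 1 ∨ w x = -1) (hx : ε * R ≤ Metric.infDist x J) :
    smoothed u w J ε x = w x := by
  have h1 : R ≤ Metric.infDist x J / ε := by rw [le_div_iff₀ hε]; linarith
  rcases hw with h | h
  · rw [smoothed, h, one_mul, hu.right _ h1]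
  · rw [smoothed, h, neg_one_mul, neg_div, hu.left _ (neg_le_neg h1)]

lemma infDist_eq_of_isolated {J : Set ℝ} {t δ x : ℝ} (ht : t ∈ J)
    (hiso : ∀ t' ∈ J, t' ∈ Ioo (t - δ) (t + δ) → t' = t) (hx : x ∈ Ioo (t - δ / 2) (t + δ / 2)) :
    Metric.infDist x J = |x - t| := by
  refine le_antisymm ?_ ((Metric.le_infDist ⟨t, ht⟩).2 fun t' ht' => ?_)
  · have := Metric.infDist_le_dist_of_mem (x := x) ht
    rwa [Real.dist_eq] at this
  · rw [Real.dist_eq]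
    by_cases h : t' ∈ Ioo (t - δ) (t + δ)
    · rw [hiso t' ht' h]
    · have h1 : |x - t| < δ / 2 := abs_lt.2 ⟨by linarith [hx.1], by linarith [hx.2]⟩
      have h2 : δ ≤ |t' - t| := by
        by_contra hcon
        have := abs_lt.1 (not_le.1 hcon)
        exact h ⟨by linarith, by linarith⟩
      have h3 := abs_sub_le t' x t
      rw [abs_sub_comm t' x] at h3
      linarith

/-- Near an isolated jump, the smoothed function is a rescaled copy of the profile. -/
lemma IsSignRep.exists_smoothed_eq {v w : ℝ → ℝ} (hw : IsSignRep v w) (u : ℝ → ℝ) {t δ : ℝ}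
    (ht : t ∈ essJump v) (hδ : 0 < δ) (h01 : Ioo (t - δ) (t + δ) ⊆ Ioo 0 1)
    (hiso : ∀ t' ∈ essJump v, t' ∈ Ioo (t - δ) (t + δ) → t' = t) (ε : ℝ) :
    ∃ z : ℝ, (z = 1 ∨ z = -1) ∧ ∀ x ∈ Ioo (t - δ / 2) (t + δ / 2),
      smoothed u w (essJump v) ε x = u (z * (x - t) / ε) := by
  obtain ⟨z, hz, hl, hr⟩ := hw.exists_step ht hδ h01 hiso
  refine ⟨z, hz, fun x hx => ?_⟩
  rw [smoothed, infDist_eq_of_isolated ht hiso hx]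
  rcases lt_trichotomy x t with h | h | h
  · rw [hl x ⟨by linarith [hx.1], h⟩, abs_of_neg (by linarith)]
    congr 2; ring
  · rw [h]; simp
  · rw [hr x ⟨h, by linarith [hx.2]⟩, abs_of_pos (by linarith)]

/-- Blowing up at `t` gives the profile itself, up to a reflection at a downward jump. The interval
is enlarged from radius `δ/(2ε)` to `1/(2ε)`, so the bound is the same at every jump. -/
lemma localEnergy_smoothed_le (W : ℝ → ℝ) {v w : ℝ → ℝ} (hw : IsSignRep v w) (u : ℝ → ℝ)
    {t δ ε : ℝ} (ht : t ∈ essJump v) (hδ : 0 < δ) (hε : 0 < ε)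
    (h01 : Ioo (t - δ) (t + δ) ⊆ Ioo 0 1)
    (hiso : ∀ t' ∈ essJump v, t' ∈ Ioo (t - δ) (t + δ) → t' = t) (s : ℝ) :
    localEnergy W ε s (Ioo (t - δ / 2) (t + δ / 2)) (smoothed u w (essJump v) ε) ≤
      ENNReal.ofReal (scaling ε s) * energy W s (Ioo (-(1 / (2 * ε))) (1 / (2 * ε))) u := by
  obtain ⟨z, hz, hzx⟩ := hw.exists_smoothed_eq u ht hδ h01 hiso ε
  have hδ1 : δ ≤ 1 := by
    have h1 := (Ioo_subset_Ioo_iff (by linarith)).1 h01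
    linarith [h1.1, h1.2]
  have hae : smoothed u w (essJump v) ε =ᵐ[volume.restrict (Ioo (t - δ / 2) (t + δ / 2))]
      fun x => u (z * (x - t) / ε) :=
    (ae_restrict_iff' measurableSet_Ioo).2 (Eventually.of_forall hzx)
  rw [localEnergy, potentialEnergy_congr_ae W hae, gagliardoSq_congr_ae hae,
    scaled_energy_affine W s measurableSet_Ioo _ t hε, preimage_affine_Ioo t _ _ hε]
  refine mul_le_mul_right ?_ _
  have e1 : (t - δ / 2 - t) / ε = -(δ / 2 / ε) := by ring
  have e2 : (t + δ / 2 - t) / ε = δ / 2 / ε := by ring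
  have e3 : (fun y => u (z * (t + ε * y - t) / ε)) = fun y => u (z * y) := by
    funext y; congr 1; field_simp; ring
  have hle : δ / 2 / ε ≤ 1 / (2 * ε) := by
    rw [div_div]; exact div_le_div_of_nonneg_right hδ1 (by positivity)
  rw [e1, e2, e3]
  refine (energy_mono_set W s (Ioo_subset_Ioo (neg_le_neg hle) hle) _).trans (le_of_eq ?_)
  rcases hz with rfl | rfl
  · simp only [one_mul]
  · rw [energy_reflect W s measurableSet_Ioo u 0]
    simp only [zero_sub, neg_one_mul]
    congr 1
    ext y
    simp only [mem_preimage, mem_Ioo]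
    constructor <;> rintro ⟨h1, h2⟩ <;> constructor <;> linarith

/-- Either one of the two points is within `εR` of a jump, or both values are those of `w` and a
jump separates them. In both cases the points are close enough to share the interval around that
jump. -/
lemma IsSignRep.exists_common_interval {v w : ℝ → ℝ} (hw : IsSignRep v w)
    (hne : (essJump v).Nonempty) {u : ℝ → ℝ} {R D : ℝ} (hu : IsProfile u R D) {ε δ : ℝ}
    (hε : 0 < ε) (hεδ : ε * R ≤ δ / 2) {x y : ℝ} (hx : x ∈ Ioo (0 : ℝ) 1) (hy : y ∈ Ioo (0 : ℝ) 1)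
    (hxy : |x - y| < δ / 2)
    (h : smoothed u w (essJump v) ε x ≠ smoothed u w (essJump v) ε y) :
    ∃ t ∈ essJump v, x ∈ Ioo (t - δ) (t + δ) ∧ y ∈ Ioo (t - δ) (t + δ) := by
  have hxy' := abs_lt.1 hxy
  have near : ∀ z, Metric.infDist z (essJump v) < ε * R → ∃ t ∈ essJump v, |z - t| < δ / 2 :=
    fun z hz => by
      obtain ⟨t, ht, htz⟩ := (Metric.infDist_lt_iff hne).1 hz
      rw [Real.dist_eq] at htz
      exact ⟨t, ht, htz.trans_le hεδ⟩
  by_cases h1 : ε * R ≤ Metric.infDist x (essJump v)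
  · by_cases h2 : ε * R ≤ Metric.infDist y (essJump v)
    · rw [hu.smoothed_eq hε (hw.sign x) h1, hu.smoothed_eq hε (hw.sign y) h2] at h
      rcases le_total x y with hle | hle
      · obtain ⟨t, ht, htm⟩ := hw.exists_jump hx hy hle h
        exact ⟨t, ht, ⟨by linarith [htm.2], by linarith [htm.1]⟩, by linarith [htm.2],
          by linarith [htm.1]⟩
      · obtain ⟨t, ht, htm⟩ := hw.exists_jump hy hx hle h.symm
        exact ⟨t, ht, ⟨by linarith [htm.2], by linarith [htm.1]⟩, by linarith [htm.2],
          by linarith [htm.1]⟩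
    · obtain ⟨t, ht, htz⟩ := near y (not_le.1 h2)
      have := abs_lt.1 htz
      exact ⟨t, ht, ⟨by linarith, by linarith⟩, by linarith, by linarith⟩
  · obtain ⟨t, ht, htz⟩ := near x (not_le.1 h1)
    have := abs_lt.1 htz
    exact ⟨t, ht, ⟨by linarith, by linarith⟩, by linarith, by linarith⟩

lemma lintegral_biUnion_finset_le {α ι : Type*} [MeasurableSpace α] (μ : Measure α) (S : Finset ι)
    (E : ι → Set α) (f : α → ℝ≥0∞) :
    ∫⁻ a in ⋃ i ∈ S, E i, f a ∂μ ≤ ∑ i ∈ S, ∫⁻ a in E i, f a ∂μ := by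
  classical
  induction S using Finset.induction_on with
  | empty => simp
  | insert i S hi ih =>
    rw [Finset.set_biUnion_insert, Finset.sum_insert hi]
    exact (lintegral_union_le f _ _).trans (add_le_add le_rfl ih)

lemma gagliardoSq_eq_prod {u : ℝ → ℝ} (hu : Measurable u) (s : ℝ) (E : Set ℝ) :
    gagliardoSq s E u = ∫⁻ p in E ×ˢ E, sqDist (u p.1) (u p.2) * fracKernel s (p.1 - p.2)
      ∂(volume : Measure ℝ).prod volume := by
  rw [gagliardoSq_eq, setLIntegral_prod _ (measurable_gagliardo_integrand hu s).aemeasurable]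

/-- If increments vanish at short distance except within the sets `E i`, then the seminorm is
essentially the sum of the local ones. -/
lemma gagliardoSq_le_sum_add {ι : Type*} (S : Finset ι) (E : ι → Set ℝ)
    (hE : ∀ i ∈ S, MeasurableSet (E i)) {u : ℝ → ℝ} (hu : Measurable u) (hb : ∀ x, |u x| ≤ 1)
    {s r : ℝ} (hs : s ∈ Icc (1 / 2 : ℝ) 1) (hr : r ∈ Ioc (0 : ℝ) 1)
    (h : ∀ x ∈ Ioo (0 : ℝ) 1, ∀ y ∈ Ioo (0 : ℝ) 1, |x - y| < r → u x ≠ u y →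
      ∃ i ∈ S, x ∈ E i ∧ y ∈ E i) :
    gagliardoSq s (Ioo 0 1) u ≤ ∑ i ∈ S, gagliardoSq s (E i) u + ENNReal.ofReal (4 / r ^ 3) := by
  simp only [gagliardoSq_eq_prod hu]
  set F : ℝ × ℝ → ℝ≥0∞ := fun p => sqDist (u p.1) (u p.2) * fracKernel s (p.1 - p.2)
  set I : Set (ℝ × ℝ) := Ioo 0 1 ×ˢ Ioo 0 1
  set U : Set (ℝ × ℝ) := ⋃ i ∈ S, E i ×ˢ E i with hU
  have hUm : MeasurableSet U := S.measurableSet_biUnion fun i hi => (hE i hi).prod (hE i hi)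
  have hIm : MeasurableSet I := measurableSet_Ioo.prod measurableSet_Ioo
  rw [← lintegral_inter_add_sdiff F I hUm]
  refine add_le_add ((lintegral_mono_set inter_subset_right).trans
    (lintegral_biUnion_finset_le _ S _ _)) ?_
  have hpt : ∀ p ∈ I \ U, F p ≤ ENNReal.ofReal (4 / r ^ 3) := by
    rintro ⟨x, y⟩ ⟨⟨hx, hy⟩, hn⟩
    by_cases hxy : u x = u y
    · simp only [F, hxy, sqDist_self, zero_mul]; exact bot_le
    by_cases hd : |x - y| < r
    · obtain ⟨i, hi, hxi, hyi⟩ := h x hx y hy hd hxy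
      exact absurd (mem_biUnion (t := fun i => E i ×ˢ E i) (show i ∈ (S : Set ι) from hi)
        ⟨hxi, hyi⟩) hn
    · rw [not_lt] at hd
      show ENNReal.ofReal (|u x - u y| ^ 2) * ENNReal.ofReal (1 / |x - y| ^ (1 + 2 * s)) ≤ _
      rw [← ENNReal.ofReal_mul (by positivity)]
      refine ENNReal.ofReal_le_ofReal ?_
      have h1 : |u x - u y| ^ 2 ≤ 4 := by
        have h2 : |u x - u y| ≤ 2 := by
          have h3 := abs_sub (u x) (u y)
          linarith [hb x, hb y]
        nlinarith [abs_nonneg (u x - u y)]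
      have h2 : r ^ 3 ≤ |x - y| ^ (1 + 2 * s) := by
        have e1 : r ^ (3 : ℝ) ≤ r ^ (1 + 2 * s) :=
          Real.rpow_le_rpow_of_exponent_ge hr.1 hr.2 (by linarith [hs.2])
        have e2 : r ^ (1 + 2 * s) ≤ |x - y| ^ (1 + 2 * s) :=
          Real.rpow_le_rpow hr.1.le hd (by linarith [hs.1])
        have e3 : r ^ (3 : ℝ) = r ^ 3 := by norm_cast
        rw [← e3]
        exact e1.trans e2
      have h3 : 0 < r ^ 3 := pow_pos hr.1 3
      rw [mul_one_div]
      exact div_le_div₀ (by norm_num) h1 h3 h2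
  calc _ ≤ ∫⁻ _ in I \ U, ENNReal.ofReal (4 / r ^ 3) ∂(volume : Measure ℝ).prod volume :=
        setLIntegral_mono' (hIm.diff hUm) hpt
    _ ≤ ∫⁻ _ in I, ENNReal.ofReal (4 / r ^ 3) ∂(volume : Measure ℝ).prod volume :=
        lintegral_mono_set sdiff_subset
    _ = _ := by
        rw [setLIntegral_const, Measure.prod_prod]
        simp

/-! ### The upper bound of the `Γ`-limit -/

lemma potentialEnergy_le_sum {ι : Type*} (W : ℝ → ℝ) (S : Finset ι) (E : ι → Set ℝ) {F : Set ℝ}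
    (hE : ∀ i ∈ S, MeasurableSet (E i)) (hF : MeasurableSet F) {u : ℝ → ℝ}
    (h : ∀ x ∈ F, (∀ i ∈ S, x ∉ E i) → W (u x) = 0) :
    potentialEnergy W F u ≤ ∑ i ∈ S, potentialEnergy W (E i) u := by
  unfold potentialEnergy
  have hUm : MeasurableSet (⋃ i ∈ S, E i) := S.measurableSet_biUnion hE
  rw [← lintegral_inter_add_sdiff _ F hUm]
  have h0 : ∫⁻ x in F \ ⋃ i ∈ S, E i, ENNReal.ofReal (W (u x)) = 0 := by
    rw [setLIntegral_congr_fun (g := fun _ => 0) (hF.diff hUm)]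
    · simp
    · rintro x ⟨hx, hn⟩
      show ENNReal.ofReal (W (u x)) = 0
      rw [h x hx fun i hi hxi => hn (mem_biUnion (show i ∈ (S : Set ι) from hi) hxi)]
      simp
  rw [h0, add_zero]
  exact (lintegral_mono_set inter_subset_right).trans (lintegral_biUnion_finset_le _ S _ _)

lemma IsDoubleWell.eq_zero_of_sign {W : ℝ → ℝ} (hW : IsDoubleWell W) {z : ℝ}
    (hz : z = 1 ∨ z = -1) : W z = 0 := (hW.zero_iff z).2 hz

lemma IsProfile.abs_smoothed_le {u : ℝ → ℝ} {R D : ℝ} (hu : IsProfile u R D) (w : ℝ → ℝ)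
    (J : Set ℝ) (ε x : ℝ) : |smoothed u w J ε x| ≤ 1 := hu.bound _

/-- The energy of the smoothed function is the sum of the energies of the transitions, up to a
remainder. -/
lemma localEnergy_smoothed_le_sum {W : ℝ → ℝ} (hW : IsDoubleWell W) {v w : ℝ → ℝ}
    (hw : IsSignRep v w) (hJ : (essJump v).Finite) (hne : (essJump v).Nonempty) {u : ℝ → ℝ}
    {R D : ℝ} (hu : IsProfile u R D) {δ ε s : ℝ} (hδ : δ ∈ Ioc (0 : ℝ) 1) (hε : 0 < ε)
    (hεδ : ε * R ≤ δ / 4) (hs : s ∈ Icc (1 / 2 : ℝ) 1)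
    (hiso : ∀ t ∈ essJump v, Ioo (t - δ) (t + δ) ⊆ Ioo 0 1 ∧
      ∀ t' ∈ essJump v, t' ∈ Ioo (t - δ) (t + δ) → t' = t) :
    localEnergy W ε s (Ioo 0 1) (smoothed u w (essJump v) ε) ≤
      (essJump v).ncard * (ENNReal.ofReal (scaling ε s) *
        energy W s (Ioo (-(1 / (2 * ε))) (1 / (2 * ε))) u) +
      ENNReal.ofReal (scaling ε s) * ENNReal.ofReal (ε ^ (2 * s - 1)) *
        ENNReal.ofReal (4 / (δ / 4) ^ 3) := by
  set f := smoothed u w (essJump v) ε with hf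
  set E : ℝ → Set ℝ := fun t => Ioo (t - δ / 2) (t + δ / 2) with hEdef
  have hpot : potentialEnergy W (Ioo 0 1) f ≤ ∑ t ∈ hJ.toFinset, potentialEnergy W (E t) f := by
    refine potentialEnergy_le_sum W _ _ (fun _ _ => measurableSet_Ioo) measurableSet_Ioo
      fun x hx hxE => ?_
    have h1 : ε * R ≤ Metric.infDist x (essJump v) := by
      refine hεδ.trans ((Metric.le_infDist hne).2 fun t ht => ?_)
      rw [Real.dist_eq]
      by_contra hcon
      have := abs_lt.1 (not_le.1 hcon)
      exact hxE t (by simpa using ht) ⟨by linarith [hδ.1], by linarith [hδ.1]⟩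
    rw [hf, hu.smoothed_eq hε (hw.sign x) h1]
    exact hW.eq_zero_of_sign (hw.sign x)
  have hgag : gagliardoSq s (Ioo 0 1) f ≤ ∑ t ∈ hJ.toFinset, gagliardoSq s (E t) f +
      ENNReal.ofReal (4 / (δ / 4) ^ 3) := by
    refine gagliardoSq_le_sum_add _ E (fun _ _ => measurableSet_Ioo)
      (measurable_smoothed hu.step.continuous.measurable hw.measurable _ _)
      (hu.abs_smoothed_le w _ _) hs ⟨by linarith [hδ.1], by linarith [hδ.2]⟩
      fun x hx y hy hxy hne' => ?_
    -- Applied with radius `δ/2`, so that the common intervals are the sets `E t` and the distance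
    -- threshold is `δ/4`.
    obtain ⟨t, ht, h1, h2⟩ := hw.exists_common_interval hne hu (δ := δ / 2) hε (by linarith) hx hy
      (by linarith) hne'
    exact ⟨t, by simpa using ht, h1, h2⟩
  have hloc : ∀ t ∈ hJ.toFinset, localEnergy W ε s (E t) f ≤ ENNReal.ofReal (scaling ε s) *
      energy W s (Ioo (-(1 / (2 * ε))) (1 / (2 * ε))) u := fun t ht =>
    have ht : t ∈ essJump v := by simpa using ht
    localEnergy_smoothed_le W hw u ht hδ.1 hε (hiso t ht).1 (hiso t ht).2 s
  have hsum := Finset.sum_le_sum hloc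
  rw [Finset.sum_const, nsmul_eq_mul, ← ncard_eq_toFinset_card _ hJ] at hsum
  calc _ ≤ ENNReal.ofReal (scaling ε s) *
        (ENNReal.ofReal (1 / ε) * ∑ t ∈ hJ.toFinset, potentialEnergy W (E t) f
          + ENNReal.ofReal (ε ^ (2 * s - 1)) * (∑ t ∈ hJ.toFinset, gagliardoSq s (E t) f +
            ENNReal.ofReal (4 / (δ / 4) ^ 3))) :=
        mul_le_mul_right (add_le_add (mul_le_mul_right hpot _) (mul_le_mul_right hgag _)) _
    _ = ∑ t ∈ hJ.toFinset, localEnergy W ε s (E t) f +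
        ENNReal.ofReal (scaling ε s) * ENNReal.ofReal (ε ^ (2 * s - 1)) *
          ENNReal.ofReal (4 / (δ / 4) ^ 3) := by
        unfold localEnergy
        rw [← Finset.mul_sum, Finset.sum_add_distrib, ← Finset.mul_sum, ← Finset.mul_sum]
        ring
    _ ≤ _ := add_le_add hsum le_rfl

/-- The two functions differ only within `εR` of a jump, and there by at most `2`. -/
lemma eLpNorm_smoothed_sub_le {v w : ℝ → ℝ} (hw : IsSignRep v w) (hJ : (essJump v).Finite)
    (hne : (essJump v).Nonempty) {u : ℝ → ℝ} {R D : ℝ} (hu : IsProfile u R D) {ε : ℝ}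
    (hε : 0 < ε) :
    eLpNorm (fun x => smoothed u w (essJump v) ε x - v x) 2
      ((volume : Measure ℝ).restrict (Ioo 0 1)) ≤
      2 * ((essJump v).ncard * ENNReal.ofReal (2 * (ε * R))) ^ (1 / 2 : ℝ) := by
  set B : Set ℝ := ⋃ t ∈ hJ.toFinset, Ioo (t - ε * R) (t + ε * R) with hB
  have hBm : MeasurableSet B := hJ.toFinset.measurableSet_biUnion fun _ _ => measurableSet_Ioo
  have hvol : volume B ≤ (essJump v).ncard * ENNReal.ofReal (2 * (ε * R)) := by
    refine (measure_biUnion_finset_le _ _).trans (le_of_eq ?_)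
    simp only [Real.volume_Ioo]
    rw [Finset.sum_congr rfl fun t _ => show ENNReal.ofReal (t + ε * R - (t - ε * R)) =
      ENNReal.ofReal (2 * (ε * R)) by congr 1; ring, Finset.sum_const, nsmul_eq_mul,
      ncard_eq_toFinset_card _ hJ]
  have hle : ∀ᵐ x ∂(volume : Measure ℝ).restrict (Ioo 0 1),
      ‖smoothed u w (essJump v) ε x - v x‖ ≤ ‖B.indicator (fun _ => (2 : ℝ)) x‖ := by
    filter_upwards [hw.ae_eq] with x hx
    rw [hx]
    by_cases h1 : ε * R ≤ Metric.infDist x (essJump v)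
    · rw [hu.smoothed_eq hε (hw.sign x) h1, sub_self, norm_zero]
      exact norm_nonneg _
    · obtain ⟨t, ht, htx⟩ := (Metric.infDist_lt_iff hne).1 (not_le.1 h1)
      rw [Real.dist_eq] at htx
      have := abs_lt.1 htx
      have hxB : x ∈ B := mem_biUnion (show t ∈ (hJ.toFinset : Set ℝ) by simpa using ht)
        ⟨by linarith, by linarith⟩
      rw [indicator_of_mem hxB, Real.norm_eq_abs, Real.norm_eq_abs]
      have h2 := abs_sub (smoothed u w (essJump v) ε x) (w x)
      have h3 := hu.abs_smoothed_le w (essJump v) ε x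
      have h4 : |w x| = 1 := by rcases hw.sign x with h | h <;> rw [h] <;> norm_num
      rw [abs_of_pos (show (0 : ℝ) < 2 by norm_num)]
      linarith
  refine (eLpNorm_mono_ae hle).trans ?_
  rw [eLpNorm_indicator_const hBm (by norm_num) (by norm_num)]
  have e1 : ‖(2 : ℝ)‖ₑ = 2 := by
    rw [Real.enorm_eq_ofReal (by norm_num)]; norm_num
  rw [e1, ENNReal.toReal_ofNat]
  refine mul_le_mul_right (ENNReal.rpow_le_rpow ?_ (by norm_num)) 2
  exact (Measure.restrict_apply_le _ _).trans hvol

lemma scaledEnergy_mk (W : ℝ → ℝ) (ε s : ℝ) {f : ℝ → ℝ} (hf : AEStronglyMeasurable f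
    ((volume : Measure ℝ).restrict (Ioo 0 1))) :
    scaledEnergy W ε s (AEEqFun.mk f hf) = localEnergy W ε s (Ioo 0 1) f := by
  have h := AEEqFun.coeFn_mk f hf
  rw [scaledEnergy_eq, localEnergy, localEnergy, potentialEnergy_congr_ae W h,
    gagliardoSq_congr_ae h]

lemma scaledEnergy_eq_zero {W : ℝ → ℝ} (hW : IsDoubleWell W) (ε s : ℝ) {v : UnitFun}
    (hv : IsSign v) (hJ : essJump v = ∅) : scaledEnergy W ε s v = 0 := by
  obtain ⟨z, hz, h⟩ : ∃ z : ℝ, (z = 1 ∨ z = -1) ∧ Ioo 0 1 ⊆ essRegion v z := by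
    rcases hv.subset_or_subset isPreconnected_Ioo subset_rfl (fun t _ ht => by
      rw [hJ] at ht; exact ht) with h | h
    · exact ⟨1, Or.inl rfl, h⟩
    · exact ⟨-1, Or.inr rfl, h⟩
  have hae : (v : ℝ → ℝ) =ᵐ[(volume : Measure ℝ).restrict (Ioo 0 1)] fun _ => z := by
    rw [EventuallyEq, ae_restrict_iff' measurableSet_Ioo, ae_iff]
    refine measure_mono_null (fun x hx => ?_) (measure_essRegion v z)
    have hx : ¬ (x ∈ Ioo (0 : ℝ) 1 → v x = z) := hx
    rw [Classical.not_imp] at hx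
    exact ⟨h hx.1, hx.2⟩
  rw [scaledEnergy, potentialEnergy_congr_ae W hae, gagliardoSq_congr_ae hae, potentialEnergy,
    gagliardoSq, hW.eq_zero_of_sign hz]
  simp

lemma eventually_exists_recovery {W : ℝ → ℝ} (hW : IsDoubleWell W) {s₀ : ℝ}
    (hs₀ : s₀ ∈ Ico (1 / 2 : ℝ) 1) {s ε : ℕ → ℝ} (happ : Approaches s ε s₀) {v : UnitFun}
    (hv : IsBVSign v) {d : ℝ} (hd : 0 < d) :
    ∀ᶠ j in atTop, ∃ u : UnitFun,
      eLpNorm (fun x => u x - v x) 2 ((volume : Measure ℝ).restrict (Ioo 0 1)) ≤ ENNReal.ofReal d ∧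
      scaledEnergy W (ε j) (s j) u ≤
        sharpInterface (rescaledTension W s₀) v + ENNReal.ofReal d := by
  have hsign : IsSign v := hv.2
  have hJ := hv.finite_essJump
  have hd0 : (0 : ℝ≥0∞) < ENNReal.ofReal d := by simpa using hd
  rcases (essJump v).eq_empty_or_nonempty with he | hne
  · refine Eventually.of_forall fun j => ⟨v, ?_, ?_⟩
    · simp
    · rw [scaledEnergy_eq_zero hW _ _ hsign he]; exact bot_le
  obtain ⟨w, hw⟩ := hsign.exists_rep hJ
  set n := (essJump v).ncard with hn
  -- The `n` transitions together lose at most `n d' ≤ d/2`; the other half is reserved for the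
  -- long-range remainder.
  set d' : ℝ := d / (2 * (n + 1)) with hd'
  have hd'0 : 0 < d' := by positivity
  obtain ⟨u, R, D, hu, hE⟩ := exists_profile_recovery hW hs₀ happ hd'0
  obtain ⟨δ, hδ, hiso⟩ := exists_uniform_isolating_radius hJ fun t ht => ht.1
  have hδ1 : δ ≤ 1 := by
    obtain ⟨t, ht⟩ := hne
    have h1 := (Ioo_subset_Ioo_iff (by linarith)).1 (hiso t ht).1
    linarith [h1.1, h1.2]
  have hεR : Tendsto (fun j => ε j * R) atTop (𝓝 0) := by
    have := happ.2.2.2.mul_const R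
    rwa [zero_mul] at this
  have hL2 : Tendsto (fun j => (2 : ℝ≥0∞) * (n * ENNReal.ofReal (2 * (ε j * R))) ^ (1 / 2 : ℝ))
      atTop (𝓝 0) := by
    have h1 := ENNReal.Tendsto.const_mul (a := (n : ℝ≥0∞))
      (ENNReal.tendsto_ofReal (hεR.const_mul 2)) (Or.inr (ENNReal.natCast_ne_top n))
    rw [mul_zero, ENNReal.ofReal_zero, mul_zero] at h1
    have h2 := ENNReal.Tendsto.const_mul (a := (2 : ℝ≥0∞))
      (((ENNReal.continuous_rpow_const (y := 1 / 2)).tendsto 0).comp h1)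
      (Or.inr (by norm_num))
    rwa [ENNReal.zero_rpow_of_pos (by norm_num), mul_zero] at h2
  have hrem : Tendsto (fun j => ENNReal.ofReal (scaling (ε j) (s j) * ε j ^ (2 * s j - 1)) *
      ENNReal.ofReal (4 / (δ / 4) ^ 3)) atTop (𝓝 0) := by
    have := ENNReal.Tendsto.mul_const (b := ENNReal.ofReal (4 / (δ / 4) ^ 3))
      (ENNReal.tendsto_ofReal happ.tendsto_scaling_mul_rpow) (Or.inr ENNReal.ofReal_ne_top)
    rwa [ENNReal.ofReal_zero, zero_mul] at this
  filter_upwards [hE, hεR.eventually (gt_mem_nhds (show 0 < δ / 4 by positivity)),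
    hL2.eventually (eventually_le_nhds hd0), happ.eventually_mem one_pos,
    hrem.eventually (eventually_le_nhds (show (0 : ℝ≥0∞) < ENNReal.ofReal (d / 2) by
      simpa using hd))] with j h1 h2 h3 h4 h5
  have hm := measurable_smoothed hu.step.continuous.measurable hw.measurable (essJump v) (ε j)
  refine ⟨AEEqFun.mk (smoothed u w (essJump v) (ε j)) hm.aestronglyMeasurable, ?_, ?_⟩
  · refine le_trans (le_of_eq (eLpNorm_congr_ae ?_))
      ((eLpNorm_smoothed_sub_le hw hJ hne hu h4.1).trans h3)
    filter_upwards [AEEqFun.coeFn_mk (μ := (volume : Measure ℝ).restrict (Ioo 0 1))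
      (smoothed u w (essJump v) (ε j)) hm.aestronglyMeasurable] with x hx
    rw [hx]
  · rw [scaledEnergy_mk, sharpInterface_of_isBVSign hv]
    refine (localEnergy_smoothed_le_sum hW hw hJ hne hu ⟨hδ, hδ1⟩ h4.1 h2.le
      ⟨(happ.1 j).1, (happ.1 j).2.le⟩ hiso).trans ?_
    have hsc : 0 ≤ scaling (ε j) (s j) := by
      rw [scaling_eq h4]
      have := logInt_pos h4 (s j)
      positivity
    rw [← ENNReal.ofReal_mul hsc]
    refine (add_le_add (mul_le_mul_right h1 _) h5).trans ?_
    rw [mul_add, mul_comm (n : ℝ≥0∞) (rescaledTension W s₀), add_assoc]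
    refine add_le_add le_rfl ?_
    rw [← ENNReal.ofReal_natCast, ← ENNReal.ofReal_mul (by positivity),
      ← ENNReal.ofReal_add (by positivity) (by positivity)]
    refine ENNReal.ofReal_le_ofReal ?_
    have : (n : ℝ) * d' ≤ d / 2 := by
      rw [hd', mul_div_assoc', div_le_div_iff₀ (by positivity) (by positivity)]
      nlinarith
    linarith

/-- Selection of a recovery sequence from almost optimal competitors at each fixed accuracy. -/
lemma exists_recovery_sequence {X : Type*} [Nonempty X] (ρ : X → ℝ≥0∞) (E : ℕ → X → ℝ≥0∞)
    (g : ℝ≥0∞) (h : ∀ d : ℝ, 0 < d → ∀ᶠ j in atTop, ∃ u, ρ u ≤ ENNReal.ofReal d ∧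
      E j u ≤ g + ENNReal.ofReal d) :
    ∃ u : ℕ → X, Tendsto (fun j => ρ (u j)) atTop (𝓝 0) ∧
      limsup (fun j => E j (u j)) atTop ≤ g := by
  -- The larger of the distance and the energy excess. Its infimum tends to `0`, so near-minimizers
  -- serve every accuracy at once and no diagonal sequence is needed.
  set m : ℕ → X → ℝ≥0∞ := fun j u => max (ρ u) (E j u - g) with hm
  have hsel : ∀ j : ℕ, ∃ u, m j u ≤ (⨅ u, m j u) + ENNReal.ofReal (1 / ((j : ℝ) + 1)) := by
    intro j
    by_cases ht : (⨅ u, m j u) = ⊤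
    · exact ⟨Classical.arbitrary X, by rw [ht, top_add]; exact le_top⟩
    · have hpos : (0 : ℝ) < 1 / ((j : ℝ) + 1) := by positivity
      obtain ⟨u, hu⟩ := iInf_lt_iff.1 (ENNReal.lt_add_right ht
        (b := ENNReal.ofReal (1 / ((j : ℝ) + 1))) (by simpa using hpos))
      exact ⟨u, hu.le⟩
  choose u hu using hsel
  have hinf : Tendsto (fun j => ⨅ u, m j u) atTop (𝓝 0) := by
    refine ENNReal.tendsto_nhds_zero.2 fun c hc => ?_
    obtain ⟨d, hd, hdc⟩ := ENNReal.lt_iff_exists_nnreal_btwn.1 hc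
    have hd : (0 : ℝ) < d := by exact_mod_cast hd
    refine (h d hd).mono fun j ⟨x, hx1, hx2⟩ => (iInf_le _ x).trans ?_
    rw [ENNReal.ofReal_coe_nnreal] at hx1 hx2
    exact max_le (hx1.trans hdc.le) ((tsub_le_iff_left.2 hx2).trans hdc.le)
  have hone : Tendsto (fun j : ℕ => ENNReal.ofReal (1 / ((j : ℝ) + 1))) atTop (𝓝 0) := by
    have := ENNReal.tendsto_ofReal (tendsto_one_div_add_atTop_nhds_zero_nat (𝕜 := ℝ))
    rwa [ENNReal.ofReal_zero] at this
  have hto : Tendsto (fun j => m j (u j)) atTop (𝓝 0) := by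
    have h1 := hinf.add hone
    rw [add_zero] at h1
    exact tendsto_of_tendsto_of_tendsto_of_le_of_le tendsto_const_nhds h1 (fun _ => bot_le) hu
  refine ⟨u, tendsto_of_tendsto_of_tendsto_of_le_of_le tendsto_const_nhds hto (fun _ => bot_le)
    fun j => le_max_left _ _, ?_⟩
  have h2 : Tendsto (fun j => g + m j (u j)) atTop (𝓝 g) := by
    have := (tendsto_const_nhds (x := g)).add hto
    rwa [add_zero] at this
  rw [← h2.limsup_eq]
  exact limsup_le_limsup (Eventually.of_forall fun j =>
    le_add_tsub.trans (add_le_add le_rfl (le_max_right _ _)))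

/-! ### `Γ`-convergence -/

lemma ConvL2.convMeasure {u : ℕ → UnitFun} {v : UnitFun} (h : ConvL2 u v) : ConvMeasure u v :=
  tendstoInMeasure_of_tendsto_eLpNorm (p := 2) (by norm_num)
    (fun j => (u j).aestronglyMeasurable) v.aestronglyMeasurable h

theorem exists_recovery {W : ℝ → ℝ} (hW : IsDoubleWell W) {s₀ : ℝ}
    (hs₀ : s₀ ∈ Ico (1 / 2 : ℝ) 1) {s ε : ℕ → ℝ} (happ : Approaches s ε s₀) (v : UnitFun) :
    ∃ u : ℕ → UnitFun, ConvL2 u v ∧ limsup (fun j => scaledEnergy W (ε j) (s j) (u j)) atTop ≤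
      sharpInterface (rescaledTension W s₀) v := by
  by_cases hv : IsBVSign v
  · exact exists_recovery_sequence (fun u : UnitFun => eLpNorm (fun x => u x - v x) 2
      ((volume : Measure ℝ).restrict (Ioo 0 1))) (fun j => scaledEnergy W (ε j) (s j)) _
      fun d hd => eventually_exists_recovery hW hs₀ happ hv hd
  · refine ⟨fun _ => v, ?_, ?_⟩
    · simp [ConvL2]
    · rw [sharpInterface, if_neg hv]; exact le_top

theorem gammaConverges_convL2 {W : ℝ → ℝ} (hW : IsDoubleWell W) {s₀ : ℝ}
    (hs₀ : s₀ ∈ Ico (1 / 2 : ℝ) 1) {s ε : ℕ → ℝ} (happ : Approaches s ε s₀) :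
    GammaConverges ConvL2 (fun j => scaledEnergy W (ε j) (s j))
      (sharpInterface (rescaledTension W s₀)) :=
  ⟨fun _ _ huv => sharpInterface_le_liminf hW hs₀ happ huv.convMeasure,
    exists_recovery hW hs₀ happ⟩

theorem gammaConverges_convMeasure {W : ℝ → ℝ} (hW : IsDoubleWell W) {s₀ : ℝ}
    (hs₀ : s₀ ∈ Ico (1 / 2 : ℝ) 1) {s ε : ℕ → ℝ} (happ : Approaches s ε s₀) :
    GammaConverges ConvMeasure (fun j => scaledEnergy W (ε j) (s j))
      (sharpInterface (rescaledTension W s₀)) :=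
  ⟨fun _ _ huv => sharpInterface_le_liminf hW hs₀ happ huv, fun v =>
    let ⟨u, h1, h2⟩ := exists_recovery hW hs₀ happ v
    ⟨u, h1.convMeasure, h2⟩⟩

/-! ### Dependence of the limit on the surface tension -/

lemma tendsto_sharpInterface {α : Type*} {l : Filter α} {c : α → ℝ≥0∞} {c₀ : ℝ≥0∞}
    (hc : Tendsto c l (𝓝 c₀)) (v : UnitFun) :
    Tendsto (fun a => sharpInterface (c a) v) l (𝓝 (sharpInterface c₀ v)) := by
  by_cases hv : IsBVSign v
  · simp only [sharpInterface_of_isBVSign hv]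
    exact ENNReal.Tendsto.mul_const hc (Or.inr (ENNReal.natCast_ne_top _))
  · simp only [sharpInterface, if_neg hv]
    exact tendsto_const_nhds

/-- Convergence in measure transports the positivity of the measure of a level set. -/
lemma ConvMeasure.eventually_measure_ne_zero {u : ℕ → UnitFun} {v : UnitFun}
    (huv : ConvMeasure u v) {E : Set ℝ} (hE : E ⊆ Ioo 0 1) {z : ℝ} (hz : z = 1 ∨ z = -1)
    (h : volume (E ∩ {x | v x = z}) ≠ 0) :
    ∀ᶠ j in atTop, IsSign (u j) → volume (E ∩ {x | u j x = z}) ≠ 0 := by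
  refine ((huv.tendsto_volume hE one_pos).eventually
    (gt_mem_nhds (pos_iff_ne_zero.2 h))).mono fun j hj hs h0 => ?_
  refine absurd hj (not_lt.2 ?_)
  have hsub : E ∩ {x | v x = z} ⊆ (E ∩ {x | 1 ≤ |u j x - v x|}) ∪ ((E ∩ {x | u j x = z}) ∪
      (Ioo 0 1 ∩ {x | ¬ (u j x = 1 ∨ u j x = -1)})) := by
    rintro x ⟨hx, hxz⟩
    have hxz : v x = z := hxz
    by_cases h1 : u j x = 1 ∨ u j x = -1
    · by_cases h2 : u j x = z
      · exact Or.inr (Or.inl ⟨hx, h2⟩)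
      · refine Or.inl ⟨hx, ?_⟩
        show 1 ≤ |u j x - v x|
        rw [hxz]
        rcases h1 with h1 | h1 <;> rcases hz with hz | hz <;> rw [h1, hz] at h2 ⊢ <;>
          first | exact absurd rfl h2 | norm_num
    · exact Or.inr (Or.inr ⟨hE hx, h1⟩)
  calc _ ≤ volume (E ∩ {x | 1 ≤ |u j x - v x|}) + (volume (E ∩ {x | u j x = z}) +
        volume (Ioo 0 1 ∩ {x | ¬ (u j x = 1 ∨ u j x = -1)})) :=
        (measure_mono hsub).trans ((measure_union_le _ _).trans
          (add_le_add le_rfl (measure_union_le _ _)))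
    _ = _ := by rw [h0, hs.measure_eq_zero, add_zero, add_zero]

/-- Convergence in measure keeps both phases of positive measure in each of the disjoint intervals
around the points of `S`. Each interval then contains an essential jump of `u j`, and disjointness
makes these distinct. -/
lemma eventually_card_le_ncard {u : ℕ → UnitFun} {v : UnitFun} (huv : ConvMeasure u v)
    (S : Finset ℝ) (hS : (S : Set ℝ) ⊆ essJump v) :
    ∀ᶠ j in atTop, IsBVSign (u j) → S.card ≤ (essJump (u j)).ncard := by
  obtain ⟨δ, hδ, h01, hdis⟩ := exists_disjoint_intervals S fun t ht => (hS ht).1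
  have hev : ∀ᶠ j in atTop, ∀ t ∈ S, IsSign (u j) → ∃ x ∈ Ioo (t - δ) (t + δ), x ∈ essJump (u j) := by
    refine (Filter.eventually_all_finset S).2 fun t ht => ?_
    obtain ⟨h1, h2⟩ := (hS ht).2 (t - δ) (t + δ) ⟨by linarith, by linarith⟩
    filter_upwards [huv.eventually_measure_ne_zero (h01 t ht) (Or.inl rfl) h1,
      huv.eventually_measure_ne_zero (h01 t ht) (Or.inr rfl) h2] with j e1 e2 hs
    exact hs.exists_mem_essJump (h01 t ht) (e1 hs) (e2 hs)
  refine hev.mono fun j hj hbv => ?_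
  have hs : IsSign (u j) := hbv.2
  choose! f hf1 hf2 using fun t ht => hj t ht hs
  rw [ncard_eq_toFinset_card _ hbv.finite_essJump]
  refine Finset.card_le_card_of_injOn f (fun t ht => ?_) fun t ht t' ht' heq => ?_
  · simpa using hf2 t ht
  · by_contra hne
    exact Set.disjoint_left.1 (hdis ht ht' hne) (hf1 t ht) (heq ▸ hf1 t' ht')

/-- The lower bound combines `c j → c₀` with the lower semicontinuity of the number of jumps; `c₀ ≠
0` is needed so that a bounded energy bounds that number. A constant sequence recovers. -/
theorem gammaConverges_sharpInterface {c : ℕ → ℝ≥0∞} {c₀ : ℝ≥0∞} (hc : Tendsto c atTop (𝓝 c₀))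
    (h0 : c₀ ≠ 0) :
    GammaConverges ConvMeasure (fun j => sharpInterface (c j)) (sharpInterface c₀) := by
  refine ⟨fun u v huv => ?_, fun v => ⟨fun _ => v, ?_, (tendsto_sharpInterface hc v).limsup_eq.le⟩⟩
  · by_cases hL : liminf (fun j => sharpInterface (c j) (u j)) atTop = ⊤
    · rw [hL]; exact le_top
    have hfreq : ∃ᶠ j in atTop, IsBVSign (u j) := by
      refine (frequently_lt_of_liminf_lt (by isBoundedDefault)
        (lt_top_iff_ne_top.2 hL)).mono fun j hj => ?_
      by_contra hbv
      rw [sharpInterface, if_neg hbv] at hj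
      exact lt_irrefl _ hj
    have hsign : IsSign v := by
      refine huv.isSign fun θ hθ r hr => hfreq.mono fun j hj => ?_
      have hs : IsSign (u j) := hj.2
      refine (measure_mono_null ?_ hs.measure_eq_zero).le.trans bot_le
      rintro x ⟨hx, h1, h2⟩
      refine ⟨hx, fun h => ?_⟩
      rcases h with h | h
      · rw [h, sub_self, abs_zero] at h1; linarith
      · rw [h, sub_self, abs_zero] at h2; linarith
    refine sharpInterface_le_of_card_mul_le hsign h0 fun S hS => ?_
    have hlim := ENNReal.Tendsto.mul_const (b := (S.card : ℝ≥0∞)) hc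
      (Or.inr (ENNReal.natCast_ne_top _))
    rw [← hlim.liminf_eq]
    refine liminf_le_liminf ((eventually_card_le_ncard huv S hS).mono fun j hj => ?_)
    show c j * S.card ≤ sharpInterface (c j) (u j)
    by_cases hbv : IsBVSign (u j)
    · rw [sharpInterface_of_isBVSign hbv]
      exact mul_le_mul_right (by exact_mod_cast hj hbv) _
    · rw [sharpInterface, if_neg hbv]; exact le_top
  · exact ConvL2.convMeasure (by simp [ConvL2])

end FracPhase

end

theorem mainTheorem4 (W : ℝ → ℝ) (hW : FracPhase.IsDoubleWell W) :
    -- the scaling factor is jointly continuous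
    ContinuousOn (fun p : ℝ × ℝ => FracPhase.scaling p.1 p.2)
      (Ioo (0 : ℝ) 1 ×ˢ Ico (1 / 2 : ℝ) 1) ∧
    -- every point of `[1/2,1)` is regular
    (∀ s₀ ∈ Ico (1 / 2 : ℝ) 1,
      FracPhase.IsRegularPoint FracPhase.ConvMeasure W s₀ ∧
      FracPhase.IsRegularPoint FracPhase.ConvL2 W s₀) ∧
    -- the value of the `Γ`-limit
    (∀ s₀ ∈ Ico (1 / 2 : ℝ) 1, ∀ s ε : ℕ → ℝ, FracPhase.Approaches s ε s₀ →
      FracPhase.GammaConverges FracPhase.ConvMeasure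
        (fun j => FracPhase.scaledEnergy W (ε j) (s j))
        (FracPhase.sharpInterface (FracPhase.rescaledTension W s₀)) ∧
      FracPhase.GammaConverges FracPhase.ConvL2
        (fun j => FracPhase.scaledEnergy W (ε j) (s j))
        (FracPhase.sharpInterface (FracPhase.rescaledTension W s₀))) ∧
    -- the `Γ`-limits are continuous in `s`, pointwise and in the sense of `Γ`-convergence
    (∀ u : FracPhase.UnitFun, ContinuousOn
      (fun s => FracPhase.sharpInterface (FracPhase.rescaledTension W s) u)
      (Ico (1 / 2 : ℝ) 1)) ∧
    (∀ s₀ ∈ Ico (1 / 2 : ℝ) 1, ∀ s : ℕ → ℝ, (∀ j, s j ∈ Ico (1 / 2 : ℝ) 1) →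
      Tendsto s atTop (𝓝 s₀) →
      FracPhase.GammaConverges FracPhase.ConvMeasure
        (fun j => FracPhase.sharpInterface (FracPhase.rescaledTension W (s j)))
        (FracPhase.sharpInterface (FracPhase.rescaledTension W s₀))) ∧
    -- the rescaled surface tensions are positive, finite and continuous in `s`
    (∀ s ∈ Ico (1 / 2 : ℝ) 1,
      0 < FracPhase.rescaledTension W s ∧ FracPhase.rescaledTension W s < ⊤) ∧
    ContinuousOn (FracPhase.rescaledTension W) (Ico (1 / 2 : ℝ) 1) := by
  have hlim := fun s₀ (hs₀ : s₀ ∈ Ico (1 / 2 : ℝ) 1) s ε (happ : FracPhase.Approaches s ε s₀) =>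
    And.intro (FracPhase.gammaConverges_convMeasure hW hs₀ happ)
      (FracPhase.gammaConverges_convL2 hW hs₀ happ)
  have hcont := FracPhase.continuousOn_rescaledTension hW
  refine ⟨FracPhase.continuousOn_scaling, fun s₀ hs₀ => ⟨?_, ?_⟩, hlim, fun u s hs => ?_,
    fun s₀ hs₀ s hs hs' => ?_, fun s hs =>
      ⟨FracPhase.rescaledTension_pos hW hs, FracPhase.rescaledTension_lt_top hW hs⟩, hcont⟩
  · exact fun s ε s' ε' h h' => ⟨_, (hlim s₀ hs₀ s ε h).1, (hlim s₀ hs₀ s' ε' h').1⟩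
  · exact fun s ε s' ε' h h' => ⟨_, (hlim s₀ hs₀ s ε h).2, (hlim s₀ hs₀ s' ε' h').2⟩
  · exact FracPhase.tendsto_sharpInterface (hcont s hs) u
  · exact FracPhase.gammaConverges_sharpInterface
      ((hcont s₀ hs₀).tendsto.comp (tendsto_nhdsWithin_iff.2 ⟨hs', Eventually.of_forall hs⟩))
      (FracPhase.rescaledTension_pos hW hs₀).ne'
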